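/- Let $k$ be a field, and let $\mathcal S$ be the category of noetherian $k$-schemes with all $k$-morphisms. A morphism $\pi:X\to Y$ in $\mathcal S$ is called admissible if, for some extension field $L$ of $k$, $X$ and $Y$ are smooth $L$-schemes (with $L$-structures inducing the given $k$-structures) and $\pi$ is a finite flat $L$-morphism. A contravariant functor $V$ from $\mathcal S$ to the category of abelian groups is called sufficiently rigid if: (a) Every admissible $\pi:X\to Y$ has a transfer homomorphism $\pi_*:V(X)\to V(Y)$, with $\mathrm{id}_*=\mathrm{id}$ and $(\rho\pi)_*=\rho_*\pi_*$ whenever $\pi$, $\rho$ and $\rho\pi$ are admissible. (b) For every cartesian diagram of schemes lying in $\mathcal S$, with $f:Y'\to Y$, $\pi:X\to Y$, $f':X'\to X$, $\pi':X'\to Y'$, and with $\pi$ and $\pi'$ admissible, one has $f^*\pi_*=\pi'_*f'^*:V(X)\to V(Y')$. (c) Let $L$ be an extension field of $k$, let $\pi:C\to D$ be a finite flat $L$-morphism of smooth curves over $L$ (noetherian smooth $L$-schemes of relative dimension $1$), let $X$ be a noetherian smooth $L$-scheme, $y\in D$, and let $U\subseteq X\times_L D$ be an open subscheme (possibly all of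 $X\times_L D$). For the points $x\in C$ with $\pi(x)=y$ denote by $\pi:U_C\to U$, $\varphi_y:U_y\to U$, $\varphi_x:U_x\to U_C$ and $\pi_x:U_x\to U_y$ the base changes with $U$ of the canonical morphisms $X\times_L C\to X\times_L D$, $X\times_L\kappa(y)\to X\times_L D$, $X\times_L\kappa(x)\to X\times_L C$ and $X\times_L\kappa(x)\to X\times_L\kappa(y)$. If all $\pi_x$ are admissible, then $$\varphi_y^*\,\pi_*=\sum_{\pi(x)=y}e(x/y)\,(\pi_x)_*\,\varphi_x^*:\;V(U_C)\to V(U_y),$$ where $e(x/y)$ is the ramification index, i.e. the length of $\mathcal O_{C,x}/\mathfrak m_y\mathcal O_{C,x}$ as an $\mathcal O_{C,x}$-module. (d) If $X$ in $\mathcal S$ is smooth over some extension field of $k$, then the projection $p:\mathbb A^1_X\to X$ induces an isomorphism $p^*:V(X)\to V(\mathbb A^1_X)$. (e) If $(X_i)$ is a filtered projective system in $\mathcal S$ with affine transition morphisms whose limit $X=\varprojlim X_i$ in schemes lies in $\mathcal S$, then the canonical map $\varinjlim V(X_i)\to V(X)$ is an isomorphism. For a contravariant functor $V$ from $\mathcal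 S$ to abelian groups let $\mathcal V$ be the associated sheaf for the Zariski topology on $\mathcal S$, and let $H^\nu(Y,\mathcal V)$ be the $\nu$-th Zariski cohomology of $\mathcal V$ on $Y$, i.e. the $\nu$-th derived functor of $\mathcal F\mapsto\mathcal F(Y)$ on abelian sheaves on $\mathcal S$, evaluated at $\mathcal V$; it is contravariant in $Y$. **Theorem 4.1.** Let $V$ be a sufficiently rigid functor on $\mathcal S$. Assume that the following holds for all $k$-algebras $A$ which are localizations of coordinate rings of smooth affine $L$-schemes, for extension fields $L$ of $k$: (i) If $A$ is semi-local (i.e. has only finitely many maximal ideals; the zero ring is included), then the natural map $V(\operatorname{Spec}A)\to H^0(\operatorname{Spec}A,\mathcal V)$ is an isomorphism, and $H^i(\operatorname{Spec}A,\mathcal V)=0$ for all $i>0$. (ii) If $A$ is local, then the restriction map $H^0(\operatorname{Spec}A,\mathcal V)\to H^0(\operatorname{Spec}A[T],\mathcal V)$ is an isomorphism, and $H^i(\operatorname{Spec}A[T],\mathcal V)=0$ for all $i>0$. Then for every $\nu\ge 0$ the functor $Y\mapsto H^\nu(Y,\mathcal V)$ is a sufficiently rigid functor on $\mathcal S$.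 -/

import Mathlib

open CategoryTheory CategoryTheory.Limits AlgebraicGeometry Opposite

universe w u

namespace SuffRigid

noncomputable section

/-! ### Noetherian schemes over a field -/

/-- The `k`-schemes whose underlying scheme is noetherian. -/
def isNoetherianOver (k : Type u) [Field k] :
    ObjectProperty (Over (Spec (CommRingCat.of k))) :=
  fun X => AlgebraicGeometry.IsNoetherian X.left

/-- The category of noetherian `k`-schemes and all `k`-morphisms. -/
abbrev NoethSch (k : Type u) [Field k] : Type (u + 1) :=
  (isNoetherianOver k).FullSubcategory

variable {k : Type u} [Field k]

/-- The functor that forgets the `k`-structure. -/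
abbrev toScheme (k : Type u) [Field k] : NoethSch k ⥤ Scheme.{u} :=
  (isNoetherianOver k).ι ⋙ Over.forget _

/-- The underlying scheme of a noetherian `k`-scheme. -/
abbrev NoethSch.sch (X : NoethSch k) : Scheme.{u} := (toScheme k).obj X

/-- The underlying morphism of schemes of a morphism of noetherian `k`-schemes. -/
abbrev mor {X Y : NoethSch k} (f : X ⟶ Y) : X.sch ⟶ Y.sch := (toScheme k).map f

/-- The structure morphism of a noetherian `k`-scheme. -/
abbrev NoethSch.str (X : NoethSch k) : X.sch ⟶ Spec (CommRingCat.of k) := X.obj.hom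

instance (X : NoethSch k) : IsNoetherian X.sch := X.property

/-- A noetherian scheme with a morphism to `Spec k`, as an object of `NoethSch k`. -/
def mkObj {X : Scheme.{u}} [hX : IsNoetherian X] (s : X ⟶ Spec (CommRingCat.of k)) :
    NoethSch k :=
  ⟨Over.mk s, hX⟩

/-- A morphism of schemes compatible with the structure morphisms, as a morphism in
`NoethSch k`. -/
def mkHom {X Y : NoethSch k} (f : X.sch ⟶ Y.sch) (hf : f ≫ Y.str = X.str) : X ⟶ Y :=
  ObjectProperty.homMk (Over.homMk f hf)

/-- The spectrum of a noetherian `k`-algebra. -/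
def specObj (k : Type u) [Field k] (A : Type u) [CommRing A] [Algebra k A]
    [IsNoetherianRing A] : NoethSch k :=
  mkObj (Spec.map (CommRingCat.ofHom (algebraMap k A)))

/-- The morphism of spectra induced by a homomorphism of `k`-algebras. -/
def specMap {A B : Type u} [CommRing A] [Algebra k A] [IsNoetherianRing A]
    [CommRing B] [Algebra k B] [IsNoetherianRing B] (φ : A →ₐ[k] B) :
    specObj k B ⟶ specObj k A :=
  mkHom (Spec.map (CommRingCat.ofHom φ.toRingHom)) (by
    change Spec.map _ ≫ Spec.map _ = Spec.map _
    rw [← Spec.map_comp, ← CommRingCat.ofHom_comp]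
    congr 2
    exact φ.comp_algebraMap)

lemma isNoetherian_affineLine (X : Scheme.{u}) [IsNoetherian X] :
    IsNoetherian (𝔸(PUnit.{u + 1}; X)) := by
  have h1 : IsLocallyNoetherian (𝔸(PUnit.{u + 1}; X)) :=
    LocallyOfFiniteType.isLocallyNoetherian (𝔸(PUnit.{u + 1}; X) ↘ X)
  have h2 : CompactSpace (𝔸(PUnit.{u + 1}; X)) :=
    QuasiCompact.compactSpace_of_compactSpace (𝔸(PUnit.{u + 1}; X) ↘ X)
  exact { toIsLocallyNoetherian := h1, toCompactSpace := h2 }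

/-- The affine line over a noetherian `k`-scheme. -/
def affineLine (X : NoethSch k) : NoethSch k :=
  haveI := isNoetherian_affineLine X.sch
  mkObj ((𝔸(PUnit.{u + 1}; X.sch) ↘ X.sch) ≫ X.str)

/-- The projection from the affine line over `X` to `X`. -/
def affineLineProj (X : NoethSch k) : affineLine X ⟶ X :=
  mkHom (𝔸(PUnit.{u + 1}; X.sch) ↘ X.sch) rfl

/-! ### Smooth schemes over extension fields and admissible morphisms -/

/-- `s` makes the noetherian `k`-scheme `X` a scheme over the extension field `L` of `k`: the
given `k`-structure of `X` is the one that is induced by `s`. -/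
def IsStructureOver (L : Type u) [Field L] [Algebra k L] (X : NoethSch k)
    (s : X.sch ⟶ Spec (CommRingCat.of L)) : Prop :=
  s ≫ Spec.map (CommRingCat.ofHom (algebraMap k L)) = X.str

/-- `X` is a smooth `L`-scheme for some extension field `L` of `k`. -/
def IsSmoothOverExtension (X : NoethSch k) : Prop :=
  ∃ (L : Type u) (_ : Field L) (_ : Algebra k L) (s : X.sch ⟶ Spec (CommRingCat.of L)),
    IsStructureOver L X s ∧ Smooth s

/-- Admissible morphisms: finite flat `L`-morphisms between smooth `L`-schemes, for some
extension field `L` of `k`. -/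
def Admissible {X Y : NoethSch k} (π : X ⟶ Y) : Prop :=
  IsFinite (mor π) ∧ Flat (mor π) ∧
    ∃ (L : Type u) (_ : Field L) (_ : Algebra k L) (s : Y.sch ⟶ Spec (CommRingCat.of L)),
      IsStructureOver L Y s ∧ Smooth s ∧ Smooth (mor π ≫ s)

/-- The ramification index of a morphism `f` at a point `x`: the length of the local ring
`𝒪_{X,x} / 𝔪_y 𝒪_{X,x}` of the fibre over `y = f x`. For a finite flat morphism of smooth curves
and a closed point `x` this is the exponent `e` in `𝔪_y 𝒪_{X,x} = 𝔪_x ^ e`. -/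
def ramificationIndex {X Y : Scheme.{u}} (f : X ⟶ Y) (x : X) : ℕ :=
  (Module.length (X.presheaf.stalk x)
    (X.presheaf.stalk x ⧸
      (IsLocalRing.maximalIdeal (Y.presheaf.stalk (f x))).map (f.stalkMap x).hom)).toNat

/-! ### Sufficiently rigid functors -/

/-- Transfer maps for the admissible morphisms, for a contravariant functor `V` with values in
abelian groups. -/
structure TransferStructure (V : (NoethSch k)ᵒᵖ ⥤ AddCommGrpCat.{w}) where
  /-- the transfer map `π_* : V(X) → V(Y)` of an admissible morphism `π : X → Y` -/
  tr : ∀ {X Y : NoethSch k} (π : X ⟶ Y), Admissible π → (V.obj (op X) ⟶ V.obj (op Y))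
  /-- `id_* = id` -/
  tr_id : ∀ (X : NoethSch k) (h : Admissible (𝟙 X)), tr (𝟙 X) h = 𝟙 _
  /-- `(ρπ)_* = ρ_* π_*` -/
  tr_comp : ∀ {X Y Z : NoethSch k} (π : X ⟶ Y) (ρ : Y ⟶ Z) (hπ : Admissible π)
    (hρ : Admissible ρ) (hπρ : Admissible (π ≫ ρ)), tr (π ≫ ρ) hπρ = tr π hπ ≫ tr ρ hρ
  /-- `f^* π_* = π'_* f'^*` for a cartesian square of schemes with `π` and `π'` admissible -/
  base_change : ∀ {X' X Y' Y : NoethSch k} (f' : X' ⟶ X) (π' : X' ⟶ Y') (π : X ⟶ Y)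
    (f : Y' ⟶ Y), IsPullback (mor f') (mor π') (mor π) (mor f) →
    ∀ (hπ : Admissible π) (hπ' : Admissible π'),
      tr π hπ ≫ V.map f.op = V.map f'.op ≫ tr π' hπ'
  /-- Let `π : C → D` be a finite flat morphism of smooth curves over an extension `L` of `k`,
  let `X` be a smooth `L`-scheme, `y ∈ D`, and let `U` be an open subscheme of `X ×_L D` (possibly
  all of it). Let `πU : UC → U`, `φy : Uy → U`, `φx : Ux → UC` and `πx : Ux → Uy` be obtained by
  base change with `U` from the canonical morphisms `X ×_L C → X ×_L D`,
  `X ×_L κ(y) → X ×_L D`, `X ×_L κ(x) → X ×_L C` and `X ×_L κ(x) → X ×_L κ(y)`, where `x` runs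
  through the (finitely many) points of `C` over `y`; thus `UC = U ×_D C`, `Uy = U ×_D κ(y)` and
  `Ux = UC ×_C κ(x)`. If the `πx` are admissible, so that all terms are defined, then
  `φy^* πU_* = ∑_x e(x/y) πx_* φx^*`. (The morphism `πU` is always admissible.) -/
  ramification : ∀ (L : Type u) [Field L] [Algebra k L] {C D X : NoethSch k} (π : C ⟶ D)
    (d : D.sch ⟶ Spec (CommRingCat.of L)) (s : X.sch ⟶ Spec (CommRingCat.of L)),
    IsStructureOver L D d → IsStructureOver L X s →
    SmoothOfRelativeDimension 1 d → SmoothOfRelativeDimension 1 (mor π ≫ d) → Smooth s →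
    IsFinite (mor π) → Flat (mor π) →
    ∀ (y : D.sch) {U UC Uy : NoethSch k} (j : U.sch ⟶ pullback s d),
    IsOpenImmersion j → IsStructureOver L U (j ≫ pullback.snd s d ≫ d) →
    ∀ (πU : UC ⟶ U) (q : UC.sch ⟶ C.sch),
    IsPullback q (mor πU) (mor π) (j ≫ pullback.snd s d) →
    ∀ (φy : Uy ⟶ U) (qy : Uy.sch ⟶ Spec (D.sch.residueField y)),
    IsPullback qy (mor φy) (D.sch.fromSpecResidueField y) (j ≫ pullback.snd s d) →
    ∀ (Ux : {x : C.sch // mor π x = y} → NoethSch k) (φx : ∀ x, Ux x ⟶ UC)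
      (qx : ∀ x, (Ux x).sch ⟶ Spec (C.sch.residueField x.1)),
    (∀ x, IsPullback (qx x) (mor (φx x)) (C.sch.fromSpecResidueField x.1) q) →
    ∀ (πx : ∀ x, Ux x ⟶ Uy), (∀ x, πx x ≫ φy = φx x ≫ πU) →
    ∀ (hπ : Admissible πU) (hπx : ∀ x, Admissible (πx x)),
      tr πU hπ ≫ V.map φy.op =
        ∑ᶠ x, ramificationIndex (mor π) x.1 • (V.map (φx x).op ≫ tr (πx x) (hπx x))

/-- Sufficiently rigid contravariant functors from noetherian `k`-schemes to abelian groups. -/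
structure IsSufficientlyRigid (V : (NoethSch k)ᵒᵖ ⥤ AddCommGrpCat.{w}) : Prop where
  /-- transfer maps exist -/
  transfers : Nonempty (TransferStructure V)
  /-- homotopy invariance for smooth schemes over extensions of `k` -/
  homotopy : ∀ X : NoethSch k, IsSmoothOverExtension X → IsIso (V.map (affineLineProj X).op)
  /-- `colim V(X_i) → V(X)` is an isomorphism if `X` is the limit, in the category of schemes, of
  a filtered projective system `X_i` with affine transition morphisms -/
  continuity : ∀ (I : Type u) [SmallCategory I] [IsCofiltered I] (F : I ⥤ NoethSch k)
    (c : Cone F), (∀ {i j : I} (a : i ⟶ j), IsAffineHom (mor (F.map a))) →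
    Nonempty (IsLimit ((toScheme k).mapCone c)) → Nonempty (IsColimit (V.mapCocone c.op))

/-! ### The Zariski topology and Zariski cohomology -/

/-- The Zariski topology on noetherian `k`-schemes: a sieve on `X` is covering if its open
immersions cover `X`. -/
def zariskiTopology (k : Type u) [Field k] : GrothendieckTopology (NoethSch k) where
  sieves X := {R | ∀ x : X.sch, ∃ (U : NoethSch k) (j : U ⟶ X),
    R j ∧ IsOpenImmersion (mor j) ∧ x ∈ Set.range (mor j)}
  top_mem' X x := ⟨X, 𝟙 X, trivial, by
    rw [mor, CategoryTheory.Functor.map_id]; infer_instance, x, by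
    rw [mor, CategoryTheory.Functor.map_id]; rfl⟩
  pullback_stable' X Y R f hR y := by
    obtain ⟨U, j, hj, hjo, u, hu⟩ := hR (mor f y)
    have hr : Set.range (pullback.fst (mor f) (mor j)) =
        (mor f) ⁻¹' Set.range (mor j) := by
      rw [IsOpenImmersion.range_pullbackFst]
      rfl
    have : IsLocallyNoetherian (pullback (mor f) (mor j)) :=
      isLocallyNoetherian_of_isOpenImmersion (pullback.fst (mor f) (mor j))
    have : CompactSpace ↥(pullback (mor f) (mor j)) :=
      QuasiCompact.compactSpace_of_compactSpace (pullback.fst (mor f) (mor j))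
    have : AlgebraicGeometry.IsNoetherian (pullback (mor f) (mor j)) := { }
    let W : NoethSch k := mkObj (pullback.fst (mor f) (mor j) ≫ Y.str)
    let a : W ⟶ Y := mkHom (pullback.fst (mor f) (mor j)) rfl
    let b : W ⟶ U := mkHom (pullback.snd (mor f) (mor j)) (by
      have hf : mor f ≫ X.str = Y.str := Over.w f.hom
      have hj : mor j ≫ X.str = U.str := Over.w j.hom
      change pullback.snd (mor f) (mor j) ≫ U.str = pullback.fst (mor f) (mor j) ≫ Y.str
      rw [← hf, ← hj, pullback.condition_assoc])
    have hab : a ≫ f = b ≫ j :=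
      (toScheme k).map_injective (pullback.condition (f := mor f) (g := mor j))
    refine ⟨W, a, ?_, inferInstanceAs (IsOpenImmersion (pullback.fst (mor f) (mor j))), ?_⟩
    · change R (a ≫ f)
      rw [hab]
      exact R.downward_closed hj b
    · change y ∈ Set.range (pullback.fst (mor f) (mor j))
      rw [hr]
      exact ⟨u, hu⟩
  transitive' X R hR R' h x := by
    obtain ⟨U, j, hj, hjo, u, hu⟩ := hR x
    obtain ⟨W, i, hi, hio, v, hv⟩ := h hj u
    refine ⟨W, i ≫ j, hi, ?_, v, ?_⟩
    · rw [mor, Functor.map_comp]; infer_instance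
    · rw [mor, Functor.map_comp, Scheme.Hom.comp_apply]
      exact (congrArg (mor j) hv).trans hu

instance (J : GrothendieckTopology (NoethSch k)) :
    IsGrothendieckAbelian.{u + 1} (Sheaf J AddCommGrpCat.{u + 1}) := by
  have : EssentiallySmall.{u + 1} (NoethSch k) := inferInstance
  exact Sheaf.isGrothendieckAbelian_of_essentiallySmall J AddCommGrpCat.{u + 1}

/-- The Zariski sheaf `𝒱` associated with a presheaf `V`; its sections over `X` are
`H^0(X, 𝒱) = 𝒱(X)`. -/
def assocSheaf (V : (NoethSch k)ᵒᵖ ⥤ AddCommGrpCat.{u + 1}) :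
    Sheaf (zariskiTopology k) AddCommGrpCat.{u + 1} :=
  (presheafToSheaf (zariskiTopology k) AddCommGrpCat.{u + 1}).obj V

/-- The canonical morphism from `V` to (the presheaf underlying) the sheaf `𝒱`. -/
def toAssocSheaf (V : (NoethSch k)ᵒᵖ ⥤ AddCommGrpCat.{u + 1}) : V ⟶ (assocSheaf V).obj :=
  toSheafify (zariskiTopology k) V

/-- The functor that sends a noetherian `k`-scheme `X` to the Zariski sheaf `ℤ_X` associated with
the presheaf of free abelian groups `T ↦ ℤ[Hom(T, X)]`; it represents the functor of sections
`F ↦ F(X)`. -/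
def freeSheaf (k : Type u) [Field k] :
    NoethSch k ⥤ Sheaf (zariskiTopology k) AddCommGrpCat.{u + 1} :=
  uliftYoneda.{u + 1} ⋙ (Functor.whiskeringRight _ _ _).obj AddCommGrpCat.free ⋙
    presheafToSheaf (zariskiTopology k) AddCommGrpCat.{u + 1}

/-- The Zariski cohomology `X ↦ H^n(X, 𝒱)` of the sheaf associated with `V`, as a contravariant
functor on noetherian `k`-schemes: the `n`-th derived functor `Ext^n(ℤ_X, -)` of the functor
`F ↦ F(X) = Hom(ℤ_X, F)` on the category of abelian Zariski sheaves, evaluated at `𝒱`. -/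
def zariskiCohomology (V : (NoethSch k)ᵒᵖ ⥤ AddCommGrpCat.{u + 1}) (n : ℕ) :
    (NoethSch k)ᵒᵖ ⥤ AddCommGrpCat.{u + 1} :=
  ((freeSheaf k).op ⋙ Abelian.extFunctor n).flip.obj (assocSheaf V)

/-! ### Localizations of smooth algebras -/

/-- The `k`-algebra `A` is a localization of (the coordinate ring of) a smooth affine
`L`-scheme, for some extension field `L` of `k`. -/
def IsLocalizationOfSmooth (k : Type u) [Field k] (A : Type u) [CommRing A] [Algebra k A] :
    Prop :=
  ∃ (L : Type u) (_ : Field L) (_ : Algebra k L) (B : Type u) (_ : CommRing B)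
    (_ : Algebra L B) (_ : Algebra B A) (M : Submonoid B),
    Algebra.Smooth L B ∧ IsLocalization M A ∧
      (algebraMap B A).comp ((algebraMap L B).comp (algebraMap k L)) = algebraMap k A

/-- Localizations of smooth algebras over fields are noetherian, so that their spectra, and those of
polynomial rings over them, are objects of `NoethSch k`. -/
lemma IsLocalizationOfSmooth.isNoetherianRing {A : Type u} [CommRing A] [Algebra k A]
    (hA : IsLocalizationOfSmooth k A) : IsNoetherianRing A := by
  obtain ⟨L, _, _, B, _, _, _, M, hB, hM, -⟩ := hA
  have : IsNoetherianRing B := Algebra.FiniteType.isNoetherianRing L B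
  exact IsLocalization.isNoetherianRing M A this

end

end SuffRigid

open CategoryTheory CategoryTheory.Limits AlgebraicGeometry Opposite
open scoped ZeroObject

namespace SuffRigid

noncomputable section

variable {k : Type u} [Field k]

/-! ### Open subschemes of noetherian schemes -/

/-! Fix an injective resolution `I⁰ → I¹ → ⋯` of the sheaf `𝒱` on the big Zariski site. A cohomology
class of `X` is a cocycle in `I^n(X)` modulo coboundaries.

Transfers. Let `π : X ⟶ Y` be admissible. Pushed forward to the open subsets of `Y`, the complex of
presheaves `V → I⁰ → I¹ → ⋯` is exact on stalks: the base change of `X` to the local scheme of `Y`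
at a point is the spectrum of a semi-local ring, continuity identifies the stalks with sections and
cohomology there, and hypothesis (i) applies (`Admissible.locallyExact`). On the other side, the
push-forward of an injective sheaf along any `f : Z ⟶ Y` has the extension property for presheaves
on `Y`, because push-forward has an exact left adjoint (`exists_comp_eq_of_injective`). As in the
comparison theorem for resolutions, every map of presheaves `π_* V ⟶ f_* V` lifts to the
resolutions, uniquely up to homotopy (`LocallyExact.exists_isLift`, `LocallyExact.exists_homotopy`),
and so induces a map from `H^n(X)` to `H^n(Z)`. The transfers of `V` over all open subsets of `Y`
form such a map. Each axiom on transfers is an identity of maps of presheaves that holds for `V`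
over every open subset, and the uniqueness of lifts carries it over to cohomology.

Continuity and homotopy invariance. Both say that, for a cone over a cofiltered system, the colimit
of the complexes of sections maps quasi-isomorphically to the complex of the cone point; for
homotopy invariance the cone is the projection `𝔸¹_X ⟶ X` over a one-object system. `ConeExact`
expresses exactness of the mapping cone, for all open subsets at once. Restriction maps of injective
sheaves are surjective, so a Mayer–Vietoris argument by induction on the degree, with
quasi-compactness, makes the question local on the cone point (`coneExact_of_locally`, `coneExact`).
For a limit, sections of `𝒱` come locally from `V`, whose continuity concludes
(`coneExact_of_isLimit`). For the affine line, hypothesis (ii) at the local rings of `X` spreads out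
to neighbourhoods (`coneExact_affineLine`). -/

instance (X : NoethSch k) : TopologicalSpace.NoetherianSpace X.sch := inferInstance

lemma isNoetherian_opens (X : NoethSch k) (U : X.sch.Opens) :
    AlgebraicGeometry.IsNoetherian (U : Scheme.{u}) where
  toCompactSpace := isCompact_iff_compactSpace.mp
    (TopologicalSpace.NoetherianSpace.isCompact (U : Set X.sch))

/-- An open subscheme of a noetherian `k`-scheme, as a noetherian `k`-scheme. -/
def res (X : NoethSch k) (U : X.sch.Opens) : NoethSch k :=
  haveI := isNoetherian_opens X U
  mkObj (U.ι ≫ X.str)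

lemma mor_str {X Y : NoethSch k} (f : X ⟶ Y) : mor f ≫ Y.str = X.str := Over.w f.hom

lemma mor_injective {X Y : NoethSch k} {f g : X ⟶ Y} (h : mor f = mor g) : f = g :=
  (toScheme k).map_injective h

/-- The inclusion of an open subscheme. -/
def resι (X : NoethSch k) (U : X.sch.Opens) : res X U ⟶ X := mkHom U.ι rfl

instance (X : NoethSch k) (U : X.sch.Opens) : IsOpenImmersion (mor (resι X U)) :=
  inferInstanceAs (IsOpenImmersion U.ι)

/-- The morphism of open subschemes that is induced by a morphism of noetherian `k`-schemes. -/
def resMap {X Y : NoethSch k} (f : X ⟶ Y) (U : X.sch.Opens) (W : Y.sch.Opens)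
    (h : U ≤ mor f ⁻¹ᵁ W) : res X U ⟶ res Y W :=
  mkHom ((mor f).resLE W U h) (by
    change (mor f).resLE W U h ≫ W.ι ≫ Y.str = U.ι ≫ X.str
    rw [← Category.assoc, Scheme.Hom.resLE_comp_ι, Category.assoc, mor_str])

@[simp]
lemma resMap_resι {X Y : NoethSch k} (f : X ⟶ Y) (U : X.sch.Opens) (W : Y.sch.Opens)
    (h : U ≤ mor f ⁻¹ᵁ W) : resMap f U W h ≫ resι Y W = resι X U ≫ f :=
  mor_injective (Scheme.Hom.resLE_comp_ι _ _)

@[simp]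
lemma resMap_resι_assoc {X Y Z : NoethSch k} (f : X ⟶ Y) (U : X.sch.Opens) (W : Y.sch.Opens)
    (h : U ≤ mor f ⁻¹ᵁ W) (g : Y ⟶ Z) : resMap f U W h ≫ resι Y W ≫ g = resι X U ≫ f ≫ g := by
  rw [← Category.assoc, resMap_resι, Category.assoc]

instance mono_resι (X : NoethSch k) (U : X.sch.Opens) : Mono (resι X U) where
  right_cancellation f g h := mor_injective
    ((cancel_mono (f := U.ι) (Z := _) (g := mor f) (h := mor g)).mp (congrArg mor h))

@[simp]
lemma resMap_comp {X Y Z : NoethSch k} (f : X ⟶ Y) (g : Y ⟶ Z) (U : X.sch.Opens)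
    (W : Y.sch.Opens) (T : Z.sch.Opens) (h : U ≤ mor f ⁻¹ᵁ W) (h' : W ≤ mor g ⁻¹ᵁ T) :
    resMap f U W h ≫ resMap g W T h' =
      resMap (f ≫ g) U T (h.trans ((mor f).preimage_mono h')) := by
  rw [← cancel_mono (resι Z T)]
  simp

@[simp]
lemma resMap_id (X : NoethSch k) (U : X.sch.Opens) (h : U ≤ mor (𝟙 X) ⁻¹ᵁ U) :
    resMap (𝟙 X) U U h = 𝟙 _ := by
  rw [← cancel_mono (resι X U)]
  simp

lemma resMap_congr {X Y : NoethSch k} {f g : X ⟶ Y} (e : f = g) (U : X.sch.Opens)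
    (W : Y.sch.Opens) (h : U ≤ mor f ⁻¹ᵁ W) :
    resMap f U W h = resMap g U W (e ▸ h) := by
  subst e; rfl

/-- The inclusion of open subschemes. -/
def resLE (X : NoethSch k) {U U' : X.sch.Opens} (h : U ≤ U') : res X U ⟶ res X U' :=
  resMap (𝟙 X) U U' h

@[simp]
lemma resLE_resι (X : NoethSch k) {U U' : X.sch.Opens} (h : U ≤ U') :
    resLE X h ≫ resι X U' = resι X U :=
  (resMap_resι (𝟙 X) U U' h).trans (Category.comp_id _)

@[simp]
lemma resLE_resι_assoc (X : NoethSch k) {U U' : X.sch.Opens} (h : U ≤ U') {Z : NoethSch k}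
    (g : X ⟶ Z) : resLE X h ≫ resι X U' ≫ g = resι X U ≫ g := by
  rw [← Category.assoc, resLE_resι]

@[simp]
lemma resLE_comp (X : NoethSch k) {U U' U'' : X.sch.Opens} (h : U ≤ U') (h' : U' ≤ U'') :
    resLE X h ≫ resLE X h' = resLE X (h.trans h') := by
  rw [← cancel_mono (resι X U'')]
  simp

@[simp]
lemma resLE_refl (X : NoethSch k) {U : X.sch.Opens} (h : U ≤ U) : resLE X h = 𝟙 _ := by
  rw [← cancel_mono (resι X U)]
  simp

@[simp]
lemma resLE_resMap {X Y : NoethSch k} (f : X ⟶ Y) {U U' : X.sch.Opens} (W : Y.sch.Opens)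
    (h : U ≤ U') (h' : U' ≤ mor f ⁻¹ᵁ W) :
    resLE X h ≫ resMap f U' W h' = resMap f U W (h.trans h') := by
  rw [← cancel_mono (resι Y W)]
  simp

@[simp]
lemma resMap_resLE {X Y : NoethSch k} (f : X ⟶ Y) (U : X.sch.Opens) {W W' : Y.sch.Opens}
    (h : W ≤ W') (h' : U ≤ mor f ⁻¹ᵁ W) :
    resMap f U W h' ≫ resLE Y h = resMap f U W' (h'.trans ((mor f).preimage_mono h)) := by
  rw [← cancel_mono (resι Y W')]
  simp

/-- The identification of a scheme with its largest open subscheme. -/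
def toResTop (X : NoethSch k) : X ⟶ res X ⊤ :=
  mkHom X.sch.topIso.inv (by
    change X.sch.topIso.inv ≫ (⊤ : X.sch.Opens).ι ≫ X.str = X.str
    rw [← Category.assoc, ← Scheme.topIso_hom, Iso.inv_hom_id, Category.id_comp])

@[simp]
lemma toResTop_resι (X : NoethSch k) : toResTop X ≫ resι X ⊤ = 𝟙 X :=
  mor_injective X.sch.topIso.inv_hom_id

@[simp]
lemma toResTop_resι_assoc (X : NoethSch k) {Z : NoethSch k} (g : X ⟶ Z) :
    toResTop X ≫ resι X ⊤ ≫ g = g := by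
  rw [← Category.assoc, toResTop_resι, Category.id_comp]

@[simp]
lemma resι_toResTop (X : NoethSch k) : resι X ⊤ ≫ toResTop X = 𝟙 _ :=
  mor_injective X.sch.topIso.hom_inv_id

/-- Factorization of a morphism through an open subscheme that contains its image. -/
def toRes {T X : NoethSch k} (f : T ⟶ X) (U : X.sch.Opens) (h : mor f ⁻¹ᵁ U = ⊤) : T ⟶ res X U :=
  toResTop T ≫ resMap f ⊤ U h.ge

@[simp]
lemma toRes_resι {T X : NoethSch k} (f : T ⟶ X) (U : X.sch.Opens) (h : mor f ⁻¹ᵁ U = ⊤) :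
    toRes f U h ≫ resι X U = f := by
  rw [toRes, Category.assoc, resMap_resι, toResTop_resι_assoc]

/-- Used to apply the base change axiom over every open subset of the target, not only to the global
square. -/
lemma isPullback_resMap {X' X Y' Y : NoethSch k} {f' : X' ⟶ X} {π' : X' ⟶ Y'} {π : X ⟶ Y}
    {f : Y' ⟶ Y} (H : IsPullback (mor f') (mor π') (mor π) (mor f))
    (W : Y.sch.Opens) (W' : Y'.sch.Opens) (h : W' ≤ mor f ⁻¹ᵁ W) :
    IsPullback (mor (resMap f' (mor π' ⁻¹ᵁ W') (mor π ⁻¹ᵁ W) (by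
        have := (mor π').preimage_mono h
        rwa [← Scheme.Hom.comp_preimage, ← H.w, Scheme.Hom.comp_preimage] at this)))
      (mor (resMap π' (mor π' ⁻¹ᵁ W') W' le_rfl))
      (mor (resMap π (mor π ⁻¹ᵁ W) W le_rfl)) (mor (resMap f W' W h)) := by
  refine Scheme.Hom.isPullback_resLE H h le_rfl ?_
  refine (inf_eq_right.mpr ?_).symm
  have := (mor π').preimage_mono h
  rwa [← Scheme.Hom.comp_preimage, ← H.w, Scheme.Hom.comp_preimage] at this

lemma isPullback_w {X' X Y' Y : NoethSch k} {f' : X' ⟶ X} {π' : X' ⟶ Y'} {π : X ⟶ Y}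
    {f : Y' ⟶ Y} (H : IsPullback (mor f') (mor π') (mor π) (mor f)) : f' ≫ π = π' ≫ f :=
  mor_injective H.w

lemma isFinite_resLE {X Y : Scheme.{u}} (f : X ⟶ Y) (hf : IsFinite f) (W : Y.Opens) :
    IsFinite (f.resLE W (f ⁻¹ᵁ W) le_rfl) := by
  rw [Scheme.Hom.resLE_eq_morphismRestrict]
  exact MorphismProperty.of_isPullback (isPullback_morphismRestrict f W).flip hf

lemma flat_resLE {X Y : Scheme.{u}} (f : X ⟶ Y) (hf : Flat f) (W : Y.Opens) :
    Flat (f.resLE W (f ⁻¹ᵁ W) le_rfl) := by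
  rw [Scheme.Hom.resLE_eq_morphismRestrict]
  exact MorphismProperty.of_isPullback (isPullback_morphismRestrict f W).flip hf

lemma smooth_opensι_comp {X S : Scheme.{u}} (s : X ⟶ S) (hs : Smooth s) (W : X.Opens) :
    Smooth (W.ι ≫ s) := inferInstance

lemma smooth_resLE_comp {X Y S : Scheme.{u}} (f : X ⟶ Y) (s : Y ⟶ S) (hs : Smooth (f ≫ s))
    (W : Y.Opens) : Smooth (f.resLE W (f ⁻¹ᵁ W) le_rfl ≫ W.ι ≫ s) := by
  rw [Scheme.Hom.resLE_comp_ι_assoc]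
  infer_instance

lemma admissible_resMap {X Y : NoethSch k} {π : X ⟶ Y} (h : Admissible π) (W : Y.sch.Opens) :
    Admissible (resMap π (mor π ⁻¹ᵁ W) W le_rfl) := by
  obtain ⟨h1, h2, L, _, _, s, hs, h3, h4⟩ := h
  refine ⟨isFinite_resLE (mor π) h1 W, flat_resLE (mor π) h2 W, L, inferInstance, inferInstance,
    W.ι ≫ s, ?_, smooth_opensι_comp s h3 W, smooth_resLE_comp (mor π) s h4 W⟩
  change (W.ι ≫ s) ≫ _ = W.ι ≫ Y.str
  rw [Category.assoc]
  exact congrArg _ hs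

/-! ### Zariski sheaves -/

lemma isOpenImmersion_resLE_id (X : Scheme.{u}) {U U' : X.Opens} (h : U ≤ (𝟙 X) ⁻¹ᵁ U') :
    IsOpenImmersion (Scheme.Hom.resLE (𝟙 X) U' U h) := by
  have h' : U ≤ U' := h
  have : Scheme.Hom.resLE (𝟙 X) U' U h = X.homOfLE h' := Scheme.Hom.resLE_id _
  rw [this]
  infer_instance

/-- An open immersion identifies its source with its range. -/
def liftOpensRange {X Y : Scheme.{u}} (j : X ⟶ Y) [IsOpenImmersion j] :
    (j.opensRange : Scheme.{u}) ⟶ X :=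
  IsOpenImmersion.lift j j.opensRange.ι (by simp)

lemma liftOpensRange_fac {X Y : Scheme.{u}} (j : X ⟶ Y) [IsOpenImmersion j] :
    liftOpensRange j ≫ j = j.opensRange.ι :=
  IsOpenImmersion.lift_fac _ _ _

lemma preimage_inf_eq_top {T X : Scheme.{u}} {U U' : X.Opens} (g : T ⟶ (U : Scheme.{u}))
    (g' : T ⟶ (U' : Scheme.{u})) (e : g ≫ U.ι = g' ≫ U'.ι) :
    (g ≫ U.ι) ⁻¹ᵁ (U ⊓ U') = ⊤ := by
  rw [Scheme.Hom.preimage_inf, inf_eq_top_iff]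
  constructor
  · simp
  · rw [e]; simp

/-- An open immersion may be replaced by the inclusion of its range, so covers can be handled
through open subsets of `X`. -/
lemma exists_res_of_mem {X : NoethSch k} {R : Sieve X} (hR : R ∈ zariskiTopology k X)
    (x : X.sch) : ∃ U : X.sch.Opens, x ∈ U ∧ R (resι X U) := by
  obtain ⟨T, j, hj, hjo, t, ht⟩ := hR x
  refine ⟨(mor j).opensRange, ⟨t, ht⟩, ?_⟩
  let e : (res X (mor j).opensRange) ⟶ T :=
    mkHom (liftOpensRange (mor j)) (by
      rw [← mor_str j]
      exact congrArg (· ≫ X.str) (liftOpensRange_fac (mor j)))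
  have : resι X (mor j).opensRange = e ≫ j :=
    mor_injective (liftOpensRange_fac (mor j)).symm
  rw [this]
  exact R.downward_closed hj e

lemma mem_of_exists_res {X : NoethSch k} {R : Sieve X}
    (h : ∀ x : X.sch, ∃ U : X.sch.Opens, x ∈ U ∧ R (resι X U)) : R ∈ zariskiTopology k X := by
  intro x
  obtain ⟨U, hx, hU⟩ := h x
  exact ⟨res X U, resι X U, hU, inferInstance, ⟨x, hx⟩, rfl⟩

/-- Restriction of sections of a presheaf along a morphism. -/
abbrev rst (F : (NoethSch k)ᵒᵖ ⥤ AddCommGrpCat.{w}) {X Y : NoethSch k} (f : X ⟶ Y) :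
    F.obj (op Y) →+ F.obj (op X) := (F.map f.op).hom

lemma rst_comp (F : (NoethSch k)ᵒᵖ ⥤ AddCommGrpCat.{w}) {X Y Z : NoethSch k} (f : X ⟶ Y)
    (g : Y ⟶ Z) (s : F.obj (op Z)) : rst F f (rst F g s) = rst F (f ≫ g) s := by
  simp [rst]

lemma rst_id (F : (NoethSch k)ᵒᵖ ⥤ AddCommGrpCat.{w}) {X : NoethSch k} (s : F.obj (op X)) :
    rst F (𝟙 X) s = s := by
  simp [rst]

lemma rst_app {F G : (NoethSch k)ᵒᵖ ⥤ AddCommGrpCat.{w}} (φ : F ⟶ G) {X Y : NoethSch k}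
    (f : X ⟶ Y) (s : F.obj (op Y)) :
    (φ.app (op X)).hom (rst F f s) = rst G f ((φ.app (op Y)).hom s) :=
  congr($(φ.naturality f.op) s)

/-! ### Separatedness and gluing of sections -/

section Sheaf

variable (F : Sheaf (zariskiTopology k) AddCommGrpCat.{u + 1})

lemma eq_of_locally_eq {X : NoethSch k} {s t : F.obj.obj (op X)}
    (h : ∀ x : X.sch, ∃ U : X.sch.Opens, x ∈ U ∧ rst F.obj (resι X U) s = rst F.obj (resι X U) t) :
    s = t := by
  let R : Sieve X := {
    arrows := fun T f => rst F.obj f s = rst F.obj f t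
    downward_closed := by
      intro Y Z f hf g
      rw [← rst_comp, hf, rst_comp] }
  have hR : R ∈ zariskiTopology k X := mem_of_exists_res h
  have hF := ((isSheaf_iff_isSheaf_of_type _ _).mp
    ((Presheaf.isSheaf_iff_isSheaf_forget _ _ (forget AddCommGrpCat.{u+1})).mp F.property))
  exact (hF R hR).isSeparatedFor.ext (fun Y f hf => hf)

lemma exists_glue_two {X : NoethSch k} (W W' : X.sch.Opens)
    (s : F.obj.obj (op (res X W))) (s' : F.obj.obj (op (res X W')))
    (hs : rst F.obj (resLE X (inf_le_left : W ⊓ W' ≤ W)) s =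
      rst F.obj (resLE X (inf_le_right : W ⊓ W' ≤ W')) s') :
    ∃ t : F.obj.obj (op (res X (W ⊔ W'))), rst F.obj (resLE X (le_sup_left : W ≤ W ⊔ W')) t = s ∧
      rst F.obj (resLE X (le_sup_right : W' ≤ W ⊔ W')) t = s' := by
  let R : Sieve (res X (W ⊔ W')) := Sieve.generate (Presieve.ofArrows
    (fun i : Bool => res X (cond i W W'))
    (fun i => resLE X (show cond i W W' ≤ W ⊔ W' from by
      cases i; exacts [le_sup_right, le_sup_left])))
  have hF := ((isSheaf_iff_isSheaf_of_type _ _).mp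
    ((Presheaf.isSheaf_iff_isSheaf_forget _ _ (forget AddCommGrpCat.{u+1})).mp F.property))
  have hR : R ∈ zariskiTopology k (res X (W ⊔ W')) := by
    rintro ⟨x, hx⟩
    obtain ⟨i, hi⟩ : ∃ i, x ∈ cond i W W' := by
      rcases hx with hx | hx
      · exact ⟨true, hx⟩
      · exact ⟨false, hx⟩
    refine ⟨_, _, Sieve.le_generate _ _ _ (Presieve.ofArrows.mk i), ?_, ⟨x, hi⟩, ?_⟩
    · exact isOpenImmersion_resLE_id _ _
    · exact Subtype.ext (Scheme.Hom.coe_resLE_apply (𝟙 X.sch) _ _)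
  have := (Presieve.isSheafFor_iff_generate _).mpr (hF R hR)
  obtain ⟨t, ht, -⟩ := (Presieve.isSheafFor_arrows_iff _ _).mp this
    (fun i => Bool.rec s' s i) (by
    intro i j T gi gj e
    change rst F.obj gi _ = rst F.obj gj _
    have e' : gi ≫ resι X _ = gj ≫ resι X _ := by
      have := congrArg (· ≫ resι X _) e
      simpa only [Category.assoc, resLE_resι] using this
    -- Two maps with the same composite to `X` factor through `W ⊓ W'`, where `hs` compares the
    -- sections.
    have key : ∀ (g : T ⟶ res X W) (g' : T ⟶ res X W'), g ≫ resι X W = g' ≫ resι X W' →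
        rst F.obj g s = rst F.obj g' s' := by
      intro g g' e
      have h1 : mor (g ≫ resι X W) ⁻¹ᵁ (W ⊓ W') = ⊤ :=
        preimage_inf_eq_top (mor g) (mor g') (congrArg mor e)
      have e1 : g = toRes (g ≫ resι X W) (W ⊓ W') h1 ≫ resLE X inf_le_left := by
        rw [← cancel_mono (resι X W), Category.assoc, resLE_resι, toRes_resι]
      have e2 : g' = toRes (g ≫ resι X W) (W ⊓ W') h1 ≫ resLE X inf_le_right := by
        rw [← cancel_mono (resι X W'), Category.assoc, resLE_resι, toRes_resι, e]
      rw [e1, e2, ← rst_comp, ← rst_comp, hs]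
    cases i <;> cases j
    · rw [(cancel_mono _).mp e']
    · exact (key _ _ e'.symm).symm
    · exact key _ _ e'
    · rw [(cancel_mono _).mp e'])
  exact ⟨t, ht true, ht false⟩

end Sheaf

/-! ### Sections as morphisms from free sheaves -/

/-- The presheaf of free abelian groups on the morphisms to `X`. -/
abbrev freePresheaf (X : NoethSch k) : (NoethSch k)ᵒᵖ ⥤ AddCommGrpCat.{u + 1} :=
  (uliftYoneda.{u + 1} ⋙ (Functor.whiskeringRight _ _ _).obj AddCommGrpCat.free).obj X

/-- The tautological section of the free sheaf on `X`. -/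
def tautSection (X : NoethSch k) : ((freeSheaf k).obj X).obj.obj (op X) :=
  ((toSheafify (zariskiTopology k) (freePresheaf X)).app (op X)).hom
    (FreeAbelianGroup.of (ULift.up (𝟙 X)))

/-- The section that corresponds to a morphism from a free sheaf. -/
def sectionOf {X : NoethSch k} {F : Sheaf (zariskiTopology k) AddCommGrpCat.{u + 1}}
    (f : (freeSheaf k).obj X ⟶ F) : F.obj.obj (op X) :=
  (f.hom.app (op X)).hom (tautSection X)

section

variable {X Y : NoethSch k} {F G : Sheaf (zariskiTopology k) AddCommGrpCat.{u + 1}}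

lemma sectionOf_comp (f : (freeSheaf k).obj X ⟶ F) (g : F ⟶ G) :
    sectionOf (f ≫ g) = (g.hom.app (op X)).hom (sectionOf f) := rfl

lemma freeSheaf_map_tautSection (φ : X ⟶ Y) :
    ((((freeSheaf k).map φ).hom).app (op X)).hom (tautSection X) =
      rst ((freeSheaf k).obj Y).obj φ (tautSection Y) := by
  have h1 : toSheafify (zariskiTopology k) (freePresheaf X) ≫ ((freeSheaf k).map φ).hom =
      (uliftYoneda.{u + 1} ⋙ (Functor.whiskeringRight _ _ _).obj AddCommGrpCat.free).map φ ≫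
        toSheafify (zariskiTopology k) (freePresheaf Y) :=
    (toSheafify_naturality (zariskiTopology k) _).symm
  have h2 := congr(($h1).app (op X) (FreeAbelianGroup.of (ULift.up (𝟙 X))))
  refine h2.trans ?_
  refine Eq.trans ?_ (rst_app (toSheafify (zariskiTopology k) (freePresheaf Y)) φ
    (FreeAbelianGroup.of (ULift.up (𝟙 Y))))
  refine congrArg ((toSheafify (zariskiTopology k) (freePresheaf Y)).app (op X)).hom ?_
  change FreeAbelianGroup.map _ (FreeAbelianGroup.of _) =
    FreeAbelianGroup.map _ (FreeAbelianGroup.of _)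
  refine (FreeAbelianGroup.map_of_apply _).trans (Eq.trans ?_
    (FreeAbelianGroup.map_of_apply _).symm)
  refine congrArg FreeAbelianGroup.of (ULift.ext _ _ ?_)
  change 𝟙 X ≫ φ = φ ≫ 𝟙 Y
  simp

lemma sectionOf_map (φ : X ⟶ Y) (f : (freeSheaf k).obj Y ⟶ F) :
    sectionOf ((freeSheaf k).map φ ≫ f) = rst F.obj φ (sectionOf f) := by
  refine Eq.trans ?_ (rst_app f.hom φ (tautSection Y))
  exact congrArg (f.hom.app (op X)).hom (freeSheaf_map_tautSection φ)

variable (X F) in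
-- The composite of three adjunction bijections: sheafification, free abelian groups, and Yoneda. It
-- turns sections into morphisms, to which exactness and injectivity in the category of sheaves
-- apply.
lemma sectionOf_bijective : Function.Bijective
    (sectionOf : ((freeSheaf k).obj X ⟶ F) → F.obj.obj (op X)) := by
  have h : (sectionOf : ((freeSheaf k).obj X ⟶ F) → F.obj.obj (op X)) =
      uliftYonedaEquiv.{u + 1} (F := F.obj ⋙ forget AddCommGrpCat.{u + 1}) ∘
        ((AddCommGrpCat.adj.whiskerRight (NoethSch k)ᵒᵖ).homEquiv (uliftYoneda.{u + 1}.obj X)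
          F.obj) ∘
        ((sheafificationAdjunction (zariskiTopology k) AddCommGrpCat.{u + 1}).homEquiv
          (freePresheaf X) F) := by
    ext f
    rfl
  rw [h]
  exact (Equiv.bijective _).comp ((Equiv.bijective _).comp (Equiv.bijective _))

end

/-! ### Surjectivity of restriction and exactness on sections -/

lemma mono_freeSheaf_map {X Y : NoethSch k} (f : X ⟶ Y) [Mono f] : Mono ((freeSheaf k).map f) := by
  have h : ∀ T : (NoethSch k)ᵒᵖ, Mono ((uliftYoneda.{u + 1}.map f).app T) := fun T => by
    rw [mono_iff_injective]
    rintro ⟨a⟩ ⟨b⟩ h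
    exact ULift.ext _ _ ((cancel_mono f).mp (congrArg ULift.down h))
  have : Mono ((uliftYoneda.{u + 1} ⋙ (Functor.whiskeringRight _ _ _).obj
      AddCommGrpCat.free.{u + 1}).map f) := by
    rw [NatTrans.mono_iff_mono_app]
    intro T
    have := h T
    exact Functor.map_mono AddCommGrpCat.free.{u + 1} ((uliftYoneda.{u + 1}.map f).app T)
  exact Functor.map_mono (presheafToSheaf (zariskiTopology k) AddCommGrpCat.{u + 1}) _

/-- The free sheaf on `U` is a subsheaf of the free sheaf on `U'`, and a morphism from it to an
injective sheaf extends. -/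
lemma injective_resLE_surjective (J : Sheaf (zariskiTopology k) AddCommGrpCat.{u + 1})
    [Injective J] {X : NoethSch k} {U U' : X.sch.Opens} (h : U ≤ U') :
    Function.Surjective (rst J.obj (resLE X h)) := by
  intro s
  obtain ⟨f, rfl⟩ := (sectionOf_bijective (res X U) J).2 s
  have : Mono (resLE X h) := mono_of_mono_fac (resLE_resι X h)
  have := mono_freeSheaf_map (resLE X h)
  exact ⟨sectionOf (Injective.factorThru f ((freeSheaf k).map (resLE X h))), by
    rw [← sectionOf_map, Injective.comp_factorThru]⟩

/-- A sequence of sheaves is exact if and only if it is exact locally on sections; this is the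
direct implication. -/
lemma exists_local_lift_of_exact
    {S : ShortComplex (Sheaf (zariskiTopology k) AddCommGrpCat.{u + 1})} (hS : S.Exact)
    {X : NoethSch k} (z : S.X₂.obj.obj (op X)) (hz : (S.g.hom.app (op X)).hom z = 0) (x : X.sch) :
    ∃ U : X.sch.Opens, x ∈ U ∧ ∃ w : S.X₁.obj.obj (op (res X U)),
      (S.f.hom.app (op (res X U))).hom w = rst S.X₂.obj (resι X U) z := by
  obtain ⟨ζ, rfl⟩ := (sectionOf_bijective X S.X₂).2 z
  have h0 : ζ ≫ S.g = 0 := (sectionOf_bijective X S.X₃).1 hz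
  -- Exactness makes the map to the cycles an epimorphism of sheaves, hence locally surjective. The
  -- section itself lifts to the cycles, being a morphism from a free sheaf.
  have := hS.epi_toCycles
  have hl : Sheaf.IsLocallySurjective S.toCycles :=
    (Sheaf.isLocallySurjective_iff_epi' _ _).mpr inferInstance
  obtain ⟨U, hx, w, hw⟩ := exists_res_of_mem
    (hl.imageSieve_mem (sectionOf (S.liftCycles ζ h0))) x
  refine ⟨U, hx, w, ?_⟩
  rw [← S.toCycles_i, ← S.liftCycles_i ζ h0, sectionOf_comp]
  exact (congrArg (S.iCycles.hom.app (op (res X U))).hom hw).trans (rst_app S.iCycles.hom _ _)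

lemma mono_app_injective {F G : Sheaf (zariskiTopology k) AddCommGrpCat.{u + 1}} (f : F ⟶ G)
    [Mono f] (X : NoethSch k) : Function.Injective (f.hom.app (op X)).hom := by
  intro s t h
  obtain ⟨s, rfl⟩ := (sectionOf_bijective X F).2 s
  obtain ⟨t, rfl⟩ := (sectionOf_bijective X F).2 t
  rw [(cancel_mono f).mp ((sectionOf_bijective X G).1 h : s ≫ f = t ≫ f)]

lemma exists_lift_of_exact_of_mono
    {S : ShortComplex (Sheaf (zariskiTopology k) AddCommGrpCat.{u + 1})} (hS : S.Exact) [Mono S.f]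
    {X : NoethSch k} (z : S.X₂.obj.obj (op X)) (hz : (S.g.hom.app (op X)).hom z = 0) :
    ∃ w : S.X₁.obj.obj (op X), (S.f.hom.app (op X)).hom w = z := by
  obtain ⟨ζ, rfl⟩ := (sectionOf_bijective X S.X₂).2 z
  have h0 : ζ ≫ S.g = 0 := (sectionOf_bijective X S.X₃).1 hz
  exact ⟨sectionOf (hS.lift ζ h0), by rw [← sectionOf_comp, hS.lift_f]⟩

/-! ### Cohomology classes and cocycles -/

section Resolution

variable {F : Sheaf (zariskiTopology k) AddCommGrpCat.{u + 1}} (R : InjectiveResolution F)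

/-- The terms of an injective resolution, in degrees shifted by three, so that the terms of
degree `-3`, `-2` and `-1` are available. -/
def shiftedTerm : ℕ → Sheaf (zariskiTopology k) AddCommGrpCat.{u + 1}
  | 0 => 0
  | 1 => 0
  | 2 => 0
  | n + 3 => R.cocomplex.X n

/-- The differentials of an injective resolution, in degrees shifted by three. -/
def shiftedDiff : ∀ n, shiftedTerm R n ⟶ shiftedTerm R (n + 1)
  | 0 => 0
  | 1 => 0
  | 2 => 0
  | n + 3 => R.cocomplex.d n (n + 1)

lemma shiftedDiff_comp (n : ℕ) : shiftedDiff R n ≫ shiftedDiff R (n + 1) = 0 := by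
  match n with
  | 0 => exact zero_comp
  | 1 => exact zero_comp
  | 2 => exact zero_comp
  | n + 3 => exact R.cocomplex.d_comp_d _ _ _

instance injective_shiftedTerm (n : ℕ) : Injective (shiftedTerm R n) := by
  match n with
  | 0 => exact (inferInstance : Injective (0 : Sheaf (zariskiTopology k) AddCommGrpCat.{u + 1}))
  | 1 => exact (inferInstance : Injective (0 : Sheaf (zariskiTopology k) AddCommGrpCat.{u + 1}))
  | 2 => exact (inferInstance : Injective (0 : Sheaf (zariskiTopology k) AddCommGrpCat.{u + 1}))
  | n + 3 => exact R.injective n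

/-- Sections of the terms of an injective resolution, in degrees shifted by three. -/
abbrev Cochains (n : ℕ) : (NoethSch k)ᵒᵖ ⥤ AddCommGrpCat.{u + 1} := (shiftedTerm R n).obj

/-- The differential on sections. -/
def dif (n : ℕ) (X : NoethSch k) :
    (Cochains R n).obj (op X) →+ (Cochains R (n + 1)).obj (op X) :=
  ((shiftedDiff R n).hom.app (op X)).hom

lemma dif_dif (n : ℕ) (X : NoethSch k) (s : (Cochains R n).obj (op X)) :
    dif R (n + 1) X (dif R n X s) = 0 :=
  congr(($(shiftedDiff_comp R n)).hom.app (op X) s)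

lemma dif_rst (n : ℕ) {X Y : NoethSch k} (f : X ⟶ Y) (s : (Cochains R n).obj (op Y)) :
    dif R n X (rst _ f s) = rst _ f (dif R n Y s) :=
  rst_app _ _ _

lemma subsingleton_of_isZero {G : Sheaf (zariskiTopology k) AddCommGrpCat.{u + 1}} (h : IsZero G)
    (X : NoethSch k) : Subsingleton (G.obj.obj (op X)) := by
  refine ⟨fun s t => ?_⟩
  obtain ⟨s, rfl⟩ := (sectionOf_bijective X G).2 s
  obtain ⟨t, rfl⟩ := (sectionOf_bijective X G).2 t
  rw [h.eq_of_tgt s t]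

/-- Vanishing in these negative degrees supplies base cases: there are no nonzero coboundaries in
degree zero, and the induction on mapping cones starts with trivial groups. -/
instance subsingleton_cochains_one (X : NoethSch k) :
    Subsingleton ((Cochains R 1).obj (op X)) := subsingleton_of_isZero (isZero_zero _) X

instance subsingleton_cochains_two (X : NoethSch k) :
    Subsingleton ((Cochains R 2).obj (op X)) := subsingleton_of_isZero (isZero_zero _) X

lemma exists_local_dif_eq (n : ℕ) {X : NoethSch k} (z : (Cochains R (n + 4)).obj (op X))
    (hz : dif R (n + 4) X z = 0) (x : X.sch) :
    ∃ U : X.sch.Opens, x ∈ U ∧ ∃ w, dif R (n + 3) (res X U) w = rst _ (resι X U) z :=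
  exists_local_lift_of_exact (R.exact_succ n) z hz x

/-- The augmentation of the resolution on sections. -/
def aug (X : NoethSch k) : F.obj.obj (op X) →+ (Cochains R 3).obj (op X) :=
  ((R.ι.f 0).hom.app (op X)).hom

lemma aug_rst {X Y : NoethSch k} (f : X ⟶ Y) (s : F.obj.obj (op Y)) :
    aug R X (rst _ f s) = rst (Cochains R 3) f (aug R Y s) :=
  rst_app (R.ι.f 0).hom f s

lemma aug_injective (X : NoethSch k) : Function.Injective (aug R X) :=
  mono_app_injective (R.ι.f 0) X

lemma dif_aug (X : NoethSch k) (s : F.obj.obj (op X)) : dif R 3 X (aug R X s) = 0 :=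
  congr(($(R.ι_f_zero_comp_complex_d)).hom.app (op X) s)

lemma exists_aug_eq {X : NoethSch k} (z : (Cochains R 3).obj (op X)) (hz : dif R 3 X z = 0) :
    ∃ s, aug R X s = z :=
  exists_lift_of_exact_of_mono (S := ShortComplex.mk _ _ R.ι_f_zero_comp_complex_d) R.exact₀ z hz

lemma cochains_surjective (n : ℕ) {X : NoethSch k} {U U' : X.sch.Opens} (h : U ≤ U') :
    Function.Surjective (rst (Cochains R n) (resLE X h)) :=
  injective_resLE_surjective (shiftedTerm R n) h

end Resolution

/-! ### Cocycles that represent a cohomology class -/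

section Classes

variable {V : (NoethSch k)ᵒᵖ ⥤ AddCommGrpCat.{u + 1}} (R : InjectiveResolution (assocSheaf V))

/-- `z` is a cocycle that represents the cohomology class `α`. -/
def Represents {n : ℕ} {X : NoethSch k} (z : (Cochains R (n + 3)).obj (op X))
    (α : (zariskiCohomology V n).obj (op X)) : Prop :=
  ∃ (f : (freeSheaf k).obj X ⟶ R.cocomplex.X n) (hf : f ≫ R.cocomplex.d n (n + 1) = 0),
    sectionOf f = z ∧ R.extMk f (n + 1) rfl hf = α

variable {n : ℕ} {X Y : NoethSch k}

lemma exists_represents (α : (zariskiCohomology V n).obj (op X)) : ∃ z, Represents R z α := by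
  obtain ⟨f, hf, h⟩ := R.extMk_surjective α (n + 1) rfl
  exact ⟨_, f, hf, rfl, h⟩

lemma exists_represented (z : (Cochains R (n + 3)).obj (op X)) (hz : dif R (n + 3) X z = 0) :
    ∃ α, Represents R z α := by
  obtain ⟨f, rfl⟩ := (sectionOf_bijective X (R.cocomplex.X n)).2 z
  exact ⟨_, f, (sectionOf_bijective X (R.cocomplex.X (n + 1))).1 hz, rfl, rfl⟩

variable {R}

lemma Represents.dif_eq_zero {z : (Cochains R (n + 3)).obj (op X)}
    {α : (zariskiCohomology V n).obj (op X)} (h : Represents R z α) : dif R (n + 3) X z = 0 := by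
  obtain ⟨f, hf, rfl, -⟩ := h
  change sectionOf (f ≫ R.cocomplex.d n (n + 1)) = 0
  rw [hf]
  rfl

lemma Represents.add {z z' : (Cochains R (n + 3)).obj (op X)}
    {α α' : (zariskiCohomology V n).obj (op X)} (h : Represents R z α) (h' : Represents R z' α') :
    Represents R (z + z') (α + α') := by
  obtain ⟨f, hf, rfl, rfl⟩ := h
  obtain ⟨f', hf', rfl, rfl⟩ := h'
  exact ⟨f + f', by simp [hf, hf'], rfl, (R.add_extMk f f' _ rfl hf hf').symm⟩

lemma Represents.neg {z : (Cochains R (n + 3)).obj (op X)}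
    {α : (zariskiCohomology V n).obj (op X)} (h : Represents R z α) :
    Represents R (-z) (-α) := by
  obtain ⟨f, hf, rfl, rfl⟩ := h
  exact ⟨-f, by simp [hf], rfl, (R.neg_extMk f _ rfl hf).symm⟩

lemma Represents.rst {z : (Cochains R (n + 3)).obj (op X)}
    {α : (zariskiCohomology V n).obj (op X)} (h : Represents R z α) (f : Y ⟶ X) :
    Represents R (rst _ f z) (SuffRigid.rst (zariskiCohomology V n) f α) := by
  obtain ⟨g, hg, rfl, rfl⟩ := h
  exact ⟨(freeSheaf k).map f ≫ g, by simp [hg], sectionOf_map f g,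
    (R.mk₀_comp_extMk g _ rfl hg _).symm⟩

/-- If the class is zero, `f` is a coboundary of a cochain into the term of degree `-1`, which is
zero. -/
lemma eq_zero_of_extMk_eq_zero {C : Type*} [Category* C] [Abelian C] [HasExt.{w} C] {A B : C}
    (R : InjectiveResolution B) (f : A ⟶ R.cocomplex.X 0) (hf : f ≫ R.cocomplex.d 0 1 = 0)
    (h : R.extMk f 1 rfl hf = 0) : f = 0 := by
  rw [← R.extEquivCohomologyClass.apply_eq_iff_eq,
    R.extEquivCohomologyClass_extMk, R.extEquivCohomologyClass_zero,
    CochainComplex.HomComplex.CohomologyClass.mk_eq_zero_iff,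
    CochainComplex.HomComplex.Cocycle.fromSingleMk_mem_coboundaries_iff _ _ _ _ _ (-1)
      (by simp)] at h
  obtain ⟨g, hg⟩ := h
  have : g = 0 := (R.cochainComplex.isZero_of_isStrictlyGE 0 (-1) (by lia)).eq_of_tgt _ _
  rw [this, zero_comp] at hg
  rw [← cancel_mono (R.cochainComplexXIso 0 0 rfl).inv, zero_comp]
  exact hg.symm

/-- In positive degree an Ext class into an injective resolution vanishes exactly when its cocycle
factors through the preceding differential. In degree zero `w` lies in a zero group and the
statement keeps its form. -/
lemma represents_zero_iff {z : (Cochains R (n + 3)).obj (op X)} :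
    Represents R z 0 ↔ ∃ w, dif R (n + 2) X w = z := by
  constructor
  · rintro ⟨f, hf, rfl, h⟩
    match n with
    | 0 => exact ⟨0, by rw [map_zero, eq_zero_of_extMk_eq_zero R f hf h]; rfl⟩
    | n + 1 =>
      obtain ⟨g, rfl⟩ := (R.extMk_eq_zero_iff f _ rfl hf n rfl).mp h
      exact ⟨sectionOf g, rfl⟩
  · rintro ⟨w, rfl⟩
    match n with
    | 0 =>
      have hw : w = 0 := (subsingleton_cochains_two R X).elim w 0
      refine ⟨0, zero_comp, ?_, R.extMk_zero _ rfl⟩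
      rw [hw, map_zero]; rfl
    | n + 1 =>
      obtain ⟨g, rfl⟩ := (sectionOf_bijective X (R.cocomplex.X n)).2 w
      exact ⟨g ≫ R.cocomplex.d n (n + 1), by simp, rfl,
        (R.extMk_eq_zero_iff _ _ rfl _ n rfl).mpr ⟨g, rfl⟩⟩

lemma Represents.unique {z : (Cochains R (n + 3)).obj (op X)}
    {α α' : (zariskiCohomology V n).obj (op X)} (h : Represents R z α) (h' : Represents R z α') :
    α = α' := by
  obtain ⟨f, hf, e, rfl⟩ := h
  obtain ⟨f', hf', e', rfl⟩ := h'
  obtain rfl := (sectionOf_bijective X (R.cocomplex.X n)).1 (e.trans e'.symm)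
  rfl

lemma Represents.eq_iff {z z' : (Cochains R (n + 3)).obj (op X)}
    {α α' : (zariskiCohomology V n).obj (op X)} (h : Represents R z α) (h' : Represents R z' α') :
    α = α' ↔ ∃ w, dif R (n + 2) X w = z - z' := by
  rw [← represents_zero_iff, sub_eq_add_neg, ← sub_eq_zero, sub_eq_add_neg]
  have := h.add h'.neg
  exact ⟨fun e => e ▸ this, fun e => this.unique e⟩

end Classes

/-! ### Comparison of cohomology along a cone over a cofiltered system -/

lemma rst_rst_eq (F : (NoethSch k)ᵒᵖ ⥤ AddCommGrpCat.{w}) {X Y Y' Z : NoethSch k} {f : X ⟶ Y}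
    {g : Y ⟶ Z} {f' : X ⟶ Y'} {g' : Y' ⟶ Z} (h : f ≫ g = f' ≫ g') (s : F.obj (op Z)) :
    rst F f (rst F g s) = rst F f' (rst F g' s) := by
  rw [rst_comp, rst_comp, h]

lemma eq_of_locally_eq_res (F : Sheaf (zariskiTopology k) AddCommGrpCat.{u + 1}) {X : NoethSch k}
    {U : X.sch.Opens} {s t : F.obj.obj (op (res X U))}
    (h : ∀ x ∈ U, ∃ (W : X.sch.Opens) (hW : W ≤ U), x ∈ W ∧
      rst F.obj (resLE X hW) s = rst F.obj (resLE X hW) t) : s = t := by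
  refine eq_of_locally_eq F fun x => ?_
  obtain ⟨W, hW, hx, e⟩ := h x.1 x.2
  refine ⟨mor (resι X U) ⁻¹ᵁ W, hx, ?_⟩
  have hg : resι (res X U) (mor (resι X U) ⁻¹ᵁ W) =
      resMap (resι X U) (mor (resι X U) ⁻¹ᵁ W) W le_rfl ≫ resLE X hW := by
    rw [← cancel_mono (resι X U), Category.assoc, resLE_resι, resMap_resι]
  rw [hg, ← rst_comp, ← rst_comp, e]

/-- Local statements over `res X A` produce open subsets of an open subscheme; this replaces them by
open subsets of `X`. -/
lemma exists_factorization_resLE {X : NoethSch k} {A : X.sch.Opens} (U : (res X A).sch.Opens)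
    {x : X.sch} (hx : x ∈ A) (hxU : (⟨x, hx⟩ : A) ∈ U) :
    ∃ (U' : X.sch.Opens) (hU' : U' ≤ A) (g : res X U' ⟶ res (res X A) U), x ∈ U' ∧
      g ≫ resι _ U = resLE X hU' := by
  have hU : A.ι ''ᵁ U ≤ A := fun _ ⟨y, _, e⟩ => e ▸ y.2
  let g : res X (A.ι ''ᵁ U) ⟶ res X A := resLE X hU
  have hg : mor g ⁻¹ᵁ U = ⊤ := by
    refine top_le_iff.mp fun y _ => ?_
    obtain ⟨y, ⟨y', hy', rfl⟩⟩ := y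
    have : mor g ⟨A.ι y', ⟨y', hy', rfl⟩⟩ = y' :=
      Subtype.ext (Scheme.Hom.coe_resLE_apply (𝟙 X.sch) _ _)
    exact Set.mem_of_eq_of_mem (s := (U : Set (res X A).sch)) this hy'
  exact ⟨A.ι ''ᵁ U, hU, toRes g U hg, ⟨_, hxU, rfl⟩, toRes_resι _ _ _⟩

lemma eq_of_eq_sup (F : Sheaf (zariskiTopology k) AddCommGrpCat.{u + 1}) {X : NoethSch k}
    {W W' : X.sch.Opens} {s t : F.obj.obj (op (res X (W ⊔ W')))}
    (h : rst F.obj (resLE X le_sup_left) s = rst F.obj (resLE X le_sup_left) t)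
    (h' : rst F.obj (resLE X le_sup_right) s = rst F.obj (resLE X le_sup_right) t) : s = t := by
  refine eq_of_locally_eq_res F ?_
  rintro x (hx | hx)
  · exact ⟨W, _, hx, h⟩
  · exact ⟨W', _, hx, h'⟩

section Comparison

variable {F : Sheaf (zariskiTopology k) AddCommGrpCat.{u + 1}} (R : InjectiveResolution F)
variable {I : Type*} [Category* I] {D : I ⥤ NoethSch k} (c : Cone D)

/-- The projections of a cone. -/
abbrev proj (i : I) : c.pt ⟶ D.obj i := c.π.app i

@[simp]
lemma proj_map {i j : I} (f : j ⟶ i) : proj c j ≫ D.map f = proj c i := c.w f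

lemma proj_preimage {i j : I} (f : j ⟶ i) (A : (D.obj i).sch.Opens) :
    mor (proj c j) ⁻¹ᵁ mor (D.map f) ⁻¹ᵁ A = mor (proj c i) ⁻¹ᵁ A := by
  rw [← proj_map c f]; rfl

/-- A cocycle `(a, b)` of the mapping cone of `colim R(D i) → R(c.pt)` over the open subset `V`
is a coboundary over the open subset `V'`, where the required cochains come from level `j`. -/
def SolvableAt {m : ℕ} {i : I} {A : (D.obj i).sch.Opens} {V : c.pt.sch.Opens}
    (a : (Cochains R (m + 2)).obj (op (res (D.obj i) A)))
    (b : (Cochains R (m + 1)).obj (op (res c.pt V)))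
    {V' : c.pt.sch.Opens} (hV' : V' ≤ V) {j : I} (f : j ⟶ i) : Prop :=
  ∃ (W : (D.obj j).sch.Opens) (hW : W ≤ mor (D.map f) ⁻¹ᵁ A) (hWV : V' = mor (proj c j) ⁻¹ᵁ W)
    (a' : (Cochains R (m + 1)).obj (op (res (D.obj j) W)))
    (b' : (Cochains R m).obj (op (res c.pt V'))),
    dif R (m + 1) _ a' = rst _ (resMap (D.map f) W A hW) a ∧
    rst _ (resLE c.pt hV') b = rst _ (resMap (proj c j) V' W hWV.le) a' - dif R m _ b'

lemma SolvableAt.comp {m : ℕ} {i : I} {A : (D.obj i).sch.Opens} {V : c.pt.sch.Opens}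
    {a : (Cochains R (m + 2)).obj (op (res (D.obj i) A))}
    {b : (Cochains R (m + 1)).obj (op (res c.pt V))}
    {V' : c.pt.sch.Opens} {hV' : V' ≤ V} {j : I} {f : j ⟶ i}
    (h : SolvableAt R c a b hV' f) {l : I} (g : l ⟶ j) : SolvableAt R c a b hV' (g ≫ f) := by
  obtain ⟨W, hW, hWV, a', b', h1, h2⟩ := h
  have hW' : mor (D.map g) ⁻¹ᵁ W ≤ mor (D.map (g ≫ f)) ⁻¹ᵁ A := by
    rw [D.map_comp]; exact (mor (D.map g)).preimage_mono hW
  refine ⟨mor (D.map g) ⁻¹ᵁ W, hW', hWV.trans (proj_preimage c g W).symm,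
    rst _ (resMap (D.map g) _ W le_rfl) a', b', ?_, ?_⟩
  · rw [dif_rst, h1]
    simp only [rst_comp, resMap_comp, Functor.map_comp]
  · rw [h2]
    simp only [rst_comp, resMap_comp, proj_map]

/-- Every cocycle `(a, b)` of the mapping cone of `colim R(D i) → R(c.pt)`, with `a` of (shifted)
degree `m + 2`, is a coboundary. -/
def ConeExact (m : ℕ) : Prop :=
  ∀ (i : I) (A : (D.obj i).sch.Opens) (V : c.pt.sch.Opens) (hV : V = mor (proj c i) ⁻¹ᵁ A)
    (a : (Cochains R (m + 2)).obj (op (res (D.obj i) A)))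
    (b : (Cochains R (m + 1)).obj (op (res c.pt V))), dif R (m + 2) _ a = 0 →
    rst _ (resMap (proj c i) V A hV.le) a = dif R (m + 1) _ b →
    ∃ (j : I) (f : j ⟶ i) (B : (D.obj j).sch.Opens) (hB : B = mor (D.map f) ⁻¹ᵁ A)
      (hBV : V = mor (proj c j) ⁻¹ᵁ B)
      (a' : (Cochains R (m + 1)).obj (op (res (D.obj j) B)))
      (b' : (Cochains R m).obj (op (res c.pt V))),
      dif R (m + 1) _ a' = rst _ (resMap (D.map f) B A hB.le) a ∧
      b = rst _ (resMap (proj c j) V B hBV.le) a' - dif R m _ b'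

/-- Mayer–Vietoris. On `N ⊓ N'` two solutions differ by a cocycle of the mapping cone of one degree
lower. By `hm` it is a coboundary at a later level, and correcting one solution by that coboundary
lets the two be glued. -/
lemma SolvableAt.sup {m : ℕ} (hm : ConeExact R c m) {i : I}
    {A : (D.obj i).sch.Opens} {V : c.pt.sch.Opens}
    {a : (Cochains R (m + 3)).obj (op (res (D.obj i) A))}
    {b : (Cochains R (m + 2)).obj (op (res c.pt V))}
    {N N' : c.pt.sch.Opens} {hN : N ≤ V} {hN' : N' ≤ V}
    {j : I} {f : j ⟶ i} (h : SolvableAt R c (m := m + 1) a b hN f)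
    (h' : SolvableAt R c (m := m + 1) a b hN' f) :
    ∃ (l : I) (g : l ⟶ i), SolvableAt R c (m := m + 1) a b (sup_le hN hN') g := by
  obtain ⟨W, hW, hWN, a₁, b₁, h1, h2⟩ := h
  obtain ⟨W', hW', hWN', a₂, b₂, h1', h2'⟩ := h'
  have e1 := congrArg (rst _ (resLE c.pt (inf_le_left : N ⊓ N' ≤ N))) h2
  have e2 := congrArg (rst _ (resLE c.pt (inf_le_right : N ⊓ N' ≤ N'))) h2'
  simp only [map_sub, rst_comp, resLE_comp, resLE_resMap, ← dif_rst] at e1 e2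
  obtain ⟨l, g, M₀, hM₀, hMN₀, a₃, b₃, h3, h4⟩ := hm j (W ⊓ W') (N ⊓ N') (by rw [hWN, hWN']; rfl)
    (rst _ (resLE _ inf_le_left) a₁ - rst _ (resLE _ inf_le_right) a₂)
    (rst _ (resLE _ (inf_le_left : N ⊓ N' ≤ N)) b₁ -
      rst _ (resLE _ (inf_le_right : N ⊓ N' ≤ N')) b₂)
    (by
      rw [map_sub, dif_rst, dif_rst, h1, h1', sub_eq_zero]
      simp only [rst_comp, resLE_resMap])
    (by
      simp only [map_sub, rst_comp, resMap_resLE]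
      rw [e1] at e2
      exact sub_eq_sub_iff_sub_eq_sub.mp e2)
  have hlN : N = mor (proj c l) ⁻¹ᵁ (mor (D.map g) ⁻¹ᵁ W) := hWN.trans (proj_preimage c g W).symm
  have hlN' : N' = mor (proj c l) ⁻¹ᵁ (mor (D.map g) ⁻¹ᵁ W') :=
    hWN'.trans (proj_preimage c g W').symm
  obtain ⟨M, hM⟩ : ∃ M, M = mor (D.map g) ⁻¹ᵁ W := ⟨_, rfl⟩
  obtain ⟨M', hM'⟩ : ∃ M', M' = mor (D.map g) ⁻¹ᵁ W' := ⟨_, rfl⟩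
  rw [← hM] at hlN
  rw [← hM'] at hlN'
  obtain rfl : M₀ = M ⊓ M' := by rw [hM₀, hM, hM']; rfl
  -- The correcting cochains live on the intersections only; restriction of injective sheaves is
  -- surjective, so they extend to `M` and `N`.
  obtain ⟨a₄, rfl⟩ := cochains_surjective R (m + 1) (inf_le_left : M ⊓ M' ≤ M) a₃
  obtain ⟨b₄, rfl⟩ := cochains_surjective R m (inf_le_left : N ⊓ N' ≤ N) b₃
  obtain ⟨a', ha', ha''⟩ := exists_glue_two (shiftedTerm R (m + 2)) M M'
    (rst _ (resMap (D.map g) M W hM.le) a₁ - dif R (m + 1) _ a₄)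
    (rst _ (resMap (D.map g) M' W' hM'.le) a₂) (by
      simp only [map_sub, rst_comp, resLE_resMap, resMap_resLE, ← dif_rst] at h3 ⊢
      rw [h3]; abel)
  obtain ⟨b', hb', hb''⟩ := exists_glue_two (shiftedTerm R (m + 1)) N N'
    (b₁ - rst _ (resMap (proj c l) N M hlN.le) a₄ + dif R m _ b₄) b₂ (by
      simp only [map_sub, map_add, rst_comp, resLE_resMap, resMap_resLE, ← dif_rst]
        at h4 ⊢
      rw [sub_eq_iff_eq_add] at h4
      rw [h4]; abel)
  have hMf : M ⊔ M' ≤ mor (D.map (g ≫ f)) ⁻¹ᵁ A := by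
    rw [D.map_comp, hM, hM']
    exact sup_le ((mor (D.map g)).preimage_mono hW) ((mor (D.map g)).preimage_mono hW')
  refine ⟨l, g ≫ f, M ⊔ M', hMf, by rw [hlN, hlN']; rfl, a', b', ?_, ?_⟩
  · apply eq_of_eq_sup
    · rw [← dif_rst, ha', map_sub, dif_dif, dif_rst, h1]
      simp only [rst_comp, resLE_resMap, resMap_comp, Functor.map_comp, sub_zero]
    · rw [← dif_rst, ha'', dif_rst, h1']
      simp only [rst_comp, resLE_resMap, resMap_comp, Functor.map_comp]
  · have k1 : rst _ (resMap (proj c l) N (M ⊔ M') (hlN.le.trans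
        ((mor (proj c l)).preimage_mono le_sup_left))) a' =
        rst _ (resMap (proj c l) N M hlN.le) (rst _ (resLE _ le_sup_left) a') := by
      rw [rst_comp, resMap_resLE]
    have k2 : rst _ (resMap (proj c l) N' (M ⊔ M') (hlN'.le.trans
        ((mor (proj c l)).preimage_mono le_sup_right))) a' =
        rst _ (resMap (proj c l) N' M' hlN'.le) (rst _ (resLE _ le_sup_right) a') := by
      rw [rst_comp, resMap_resLE]
    apply eq_of_eq_sup
    · rw [map_sub, ← dif_rst, hb', rst_comp, rst_comp, resLE_comp, resLE_resMap, k1, ha', h2]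
      simp only [map_sub, map_add, dif_dif, ← dif_rst, rst_comp, resMap_comp, proj_map]
      abel
    · rw [map_sub, ← dif_rst, hb'', rst_comp, rst_comp, resLE_comp, resLE_resMap, k2, ha'', h2']
      simp only [rst_comp, resMap_comp, proj_map]

lemma subsingleton_sections_bot (G : Sheaf (zariskiTopology k) AddCommGrpCat.{u + 1})
    (X : NoethSch k) : Subsingleton (G.obj.obj (op (res X ⊥))) :=
  ⟨fun _ _ => eq_of_locally_eq_res G fun _ hx => hx.elim⟩

/-- `ConeExact` may be checked locally on `c.pt`. -/
theorem coneExact_of_locally [IsCofiltered I]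
    (hle : ∀ (i : I) (A B : (D.obj i).sch.Opens),
      mor (proj c i) ⁻¹ᵁ A ≤ mor (proj c i) ⁻¹ᵁ B →
        ∃ (j : I) (f : j ⟶ i), mor (D.map f) ⁻¹ᵁ A ≤ mor (D.map f) ⁻¹ᵁ B)
    (hloc : ∀ (m : ℕ) (i : I) (A : (D.obj i).sch.Opens) (V : c.pt.sch.Opens)
      (hV : V = mor (proj c i) ⁻¹ᵁ A)
      (a : (Cochains R (m + 3)).obj (op (res (D.obj i) A)))
      (b : (Cochains R (m + 2)).obj (op (res c.pt V))), dif R (m + 3) _ a = 0 →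
      rst _ (resMap (proj c i) V A hV.le) a = dif R (m + 2) _ b → ∀ x ∈ V,
      ∃ (N : c.pt.sch.Opens) (_ : x ∈ N) (hN : N ≤ V) (j : I) (f : j ⟶ i),
        SolvableAt R c (m := m + 1) a b hN f)
    (m : ℕ) : ConeExact R c m := by
  induction m with
  | zero =>
    -- Both required equations hold in shifted degrees two and one, where all groups vanish.
    intro i A V hV a b _ _
    refine ⟨i, 𝟙 i, A, by rw [D.map_id]; rfl, hV, 0, 0, ?_, ?_⟩
    · exact (subsingleton_cochains_two R _).elim _ _
    · exact (subsingleton_cochains_one R _).elim _ _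
  | succ m ih =>
    intro i A V hV a b ha hab
    have key : ∃ (N : c.pt.sch.Opens) (_ : (V : Set c.pt.sch) ⊆ N) (hN : N ≤ V) (j : I)
        (f : j ⟶ i), SolvableAt R c (m := m + 1) a b hN f := by
      -- Open subsets of the noetherian scheme `c.pt` are quasi-compact, so finitely many local
      -- solutions suffice. They are merged in pairs by `SolvableAt.sup`, after passing to a common
      -- level.
      refine IsCompact.induction_on (p := fun s => ∃ (N : c.pt.sch.Opens) (_ : s ⊆ N) (hN : N ≤ V)
        (j : I) (f : j ⟶ i), SolvableAt R c (m := m + 1) a b hN f)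
        (TopologicalSpace.NoetherianSpace.isCompact (V : Set c.pt.sch)) ?_ ?_ ?_ ?_
      · exact ⟨⊥, Set.empty_subset _, bot_le, i, 𝟙 i, ⊥, bot_le, rfl, 0, 0,
          (subsingleton_sections_bot _ _).elim _ _, (subsingleton_sections_bot _ _).elim _ _⟩
      · rintro s t hst ⟨N, htN, h⟩
        exact ⟨N, hst.trans htN, h⟩
      · rintro s t ⟨N, hs, hN, j, f, h⟩ ⟨N', ht, hN', j', f', h'⟩
        obtain ⟨l, g, g', e⟩ := IsCofiltered.cospan f f'
        have h'' := h'.comp R c g'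
        rw [← e] at h''
        obtain ⟨l, g, h⟩ := SolvableAt.sup R c ih (h.comp R c g) h''
        exact ⟨N ⊔ N', Set.union_subset_union hs ht, _, l, g, h⟩
      · intro x hx
        obtain ⟨N, hxN, h⟩ := hloc m i A V hV a b ha hab x hx
        exact ⟨N, mem_nhdsWithin_of_mem_nhds (N.isOpen.mem_nhds hxN), N, subset_rfl, h⟩
    obtain ⟨N, hVN, hNV, j, f, W, hW, hWN, a', b', h1, h2⟩ := key
    obtain rfl : N = V := le_antisymm hNV hVN
    -- So far `W` agrees with the preimage of `A` only after pullback to the cone point; by `hle`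
    -- the two agree at a later level.
    obtain ⟨l, g, hg⟩ := hle j (mor (D.map f) ⁻¹ᵁ A) W (by rw [proj_preimage, ← hV, ← hWN])
    refine ⟨l, g ≫ f, mor (D.map g) ⁻¹ᵁ W, ?_, hWN.trans (proj_preimage c g W).symm,
      rst _ (resMap (D.map g) _ W le_rfl) a', b', ?_, ?_⟩
    · rw [D.map_comp]
      exact le_antisymm ((mor (D.map g)).preimage_mono hW) hg
    · rw [dif_rst, h1]
      simp only [rst_comp, resMap_comp, Functor.map_comp]
    · rw [resLE_refl, rst_id] at h2
      simp only [h2, rst_comp, resMap_comp, proj_map]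

lemma exists_local_dif_eq_res (n : ℕ) {X : NoethSch k} {A : X.sch.Opens}
    (z : (Cochains R (n + 4)).obj (op (res X A))) (hz : dif R (n + 4) _ z = 0) {x : X.sch}
    (hx : x ∈ A) : ∃ (U : X.sch.Opens) (hU : U ≤ A), x ∈ U ∧
      ∃ w, dif R (n + 3) (res X U) w = rst _ (resLE X hU) z := by
  obtain ⟨U, hxU, w, hw⟩ := exists_local_dif_eq R n z hz ⟨x, hx⟩
  obtain ⟨U', hU', g, hxU', hg⟩ := exists_factorization_resLE U hx hxU
  exact ⟨U', hU', hxU', rst _ g w, by rw [dif_rst, hw, rst_comp, hg]⟩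

/-- A criterion for `colim R(D i) → R(c.pt)` to be a quasi-isomorphism. -/
theorem coneExact [IsCofiltered I]
    (hle : ∀ (i : I) (A B : (D.obj i).sch.Opens),
      mor (proj c i) ⁻¹ᵁ A ≤ mor (proj c i) ⁻¹ᵁ B →
        ∃ (j : I) (f : j ⟶ i), mor (D.map f) ⁻¹ᵁ A ≤ mor (D.map f) ⁻¹ᵁ B)
    (hinj : ∀ (i : I) (A : (D.obj i).sch.Opens) (V : c.pt.sch.Opens)
      (hV : V = mor (proj c i) ⁻¹ᵁ A) (s : F.obj.obj (op (res (D.obj i) A))),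
      rst _ (resMap (proj c i) V A hV.le) s = 0 → ∀ x ∈ V,
      ∃ (j : I) (f : j ⟶ i) (W : (D.obj j).sch.Opens) (hW : W ≤ mor (D.map f) ⁻¹ᵁ A),
        mor (proj c j) x ∈ W ∧ rst _ (resMap (D.map f) W A hW) s = 0)
    (hsurj : ∀ (m : ℕ) (i : I) (A : (D.obj i).sch.Opens) (V : c.pt.sch.Opens)
      (_ : V = mor (proj c i) ⁻¹ᵁ A) (b : (Cochains R (m + 3)).obj (op (res c.pt V))),
      dif R (m + 3) _ b = 0 → ∀ x ∈ V,
      ∃ (j : I) (f : j ⟶ i) (W : (D.obj j).sch.Opens) (_ : W ≤ mor (D.map f) ⁻¹ᵁ A)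
        (N : c.pt.sch.Opens) (hN : N = mor (proj c j) ⁻¹ᵁ W) (_ : x ∈ N) (hNV : N ≤ V)
        (a' : (Cochains R (m + 3)).obj (op (res (D.obj j) W)))
        (b' : (Cochains R (m + 2)).obj (op (res c.pt N))), dif R (m + 3) _ a' = 0 ∧
        rst _ (resLE c.pt hNV) b = rst _ (resMap (proj c j) N W hN.le) a' - dif R (m + 2) _ b')
    (m : ℕ) : ConeExact R c m := by
  refine coneExact_of_locally R c hle (fun m i A V hV a b ha hab x hx => ?_) m
  match m with
  | 0 =>
    -- Here `a` is a section of `F`, and `b` lies in a zero group, so `a` dies on the cone point and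
    -- `hinj` applies.
    obtain ⟨s, rfl⟩ := exists_aug_eq R a ha
    rw [(subsingleton_cochains_two R _).elim b 0, map_zero, ← aug_rst] at hab
    obtain ⟨j, f, W, hW, hxW, hs⟩ :=
      hinj i A V hV s (aug_injective R _ (hab.trans (map_zero _).symm)) x hx
    have hN : mor (proj c j) ⁻¹ᵁ W ≤ V := by
      rw [hV, ← proj_preimage c f A]; exact (mor (proj c j)).preimage_mono hW
    refine ⟨_, hxW, hN, j, f, W, hW, rfl, 0, 0, ?_, (subsingleton_cochains_two R _).elim _ _⟩
    rw [map_zero, ← aug_rst, hs, map_zero]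
  | m + 1 =>
    -- Locally `a` is the coboundary of some `a₀`. Subtracting the pullback of `a₀` from `b` leaves
    -- a cocycle on the cone point, which `hsurj` handles.
    obtain ⟨U, hU, hxU, a₀, ha₀⟩ := exists_local_dif_eq_res R m a ha
      (show mor (proj c i) x ∈ A by rw [hV] at hx; exact hx)
    have hUV : mor (proj c i) ⁻¹ᵁ U ≤ V := by
      rw [hV]; exact (mor (proj c i)).preimage_mono hU
    obtain ⟨U', hU'⟩ : ∃ U', U' = mor (proj c i) ⁻¹ᵁ U := ⟨_, rfl⟩
    rw [← hU'] at hUV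
    obtain ⟨j, f, W, hW, N, hN, hxN, hNU, a', b', h1, h2⟩ := hsurj m i U U' hU'
      (rst _ (resLE _ hUV) b - rst _ (resMap (proj c i) U' U hU'.le) a₀) (by
        rw [map_sub, dif_rst, dif_rst, ha₀, ← hab]
        simp only [rst_comp, resLE_resMap, resMap_resLE, sub_self]) x (hU' ▸ hxU)
    have hW' : W ≤ mor (D.map f) ⁻¹ᵁ A := hW.trans ((mor (D.map f)).preimage_mono hU)
    refine ⟨N, hxN, hNU.trans hUV, j, f, W, hW', hN,
      rst _ (resMap (D.map f) W U hW) a₀ + a', b', ?_, ?_⟩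
    · rw [map_add, h1, dif_rst, ha₀, add_zero]
      simp only [rst_comp, resMap_resLE]
    · rw [map_sub, sub_eq_iff_eq_add] at h2
      simp only [rst_comp, resLE_comp, resLE_resMap] at h2
      rw [h2, map_add]
      simp only [rst_comp, resMap_comp, proj_map]
      abel

end Comparison

/-! ### From mapping cones to cohomology classes -/

section ComparisonCohomology

variable {V : (NoethSch k)ᵒᵖ ⥤ AddCommGrpCat.{u + 1}} {R : InjectiveResolution (assocSheaf V)}
variable {I : Type*} [Category* I] {D : I ⥤ NoethSch k} {c : Cone D}

lemma ConeExact.exists_of_top {m : ℕ} (h : ConeExact R c m) {i : I}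
    (a : (Cochains R (m + 2)).obj (op (D.obj i))) (b : (Cochains R (m + 1)).obj (op c.pt))
    (ha : dif R (m + 2) _ a = 0) (hab : rst _ (proj c i) a = dif R (m + 1) _ b) :
    ∃ (j : I) (f : j ⟶ i) (a' : (Cochains R (m + 1)).obj (op (D.obj j)))
      (b' : (Cochains R m).obj (op c.pt)), dif R (m + 1) _ a' = rst _ (D.map f) a ∧
      b = rst _ (proj c j) a' - dif R m _ b' := by
  obtain ⟨j, f, B, hB, hBV, a', b', h1, h2⟩ := h i ⊤ ⊤ rfl (rst _ (resι _ ⊤) a)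
    (rst _ (resι _ ⊤) b) (by rw [dif_rst, ha, map_zero])
    (by rw [dif_rst, ← hab, rst_comp, resMap_resι, rst_comp])
  obtain rfl : B = ⊤ := hB
  refine ⟨j, f, rst _ (toResTop _) a', rst _ (toResTop _) b', ?_, ?_⟩
  · rw [dif_rst, h1, rst_comp, rst_comp, Category.assoc, resMap_resι, toResTop_resι_assoc]
  · have h3 := congrArg (rst _ (toResTop _)) h2
    rw [map_sub, rst_comp, rst_comp, toResTop_resι, rst_id] at h3
    rw [dif_rst, h3, rst_comp]
    congr 3
    rw [← cancel_mono (resι _ _)]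
    simp only [Category.assoc, resMap_resι, toResTop_resι_assoc, toResTop_resι, Category.comp_id]

/-- If `z` represents `α` and `w` bounds its pullback, then `(z, w)` is a cocycle of the mapping
cone. That it is a coboundary makes `z` a coboundary at some level. -/
lemma exists_rst_eq_zero_of_coneExact (h : ∀ m, ConeExact R c m) {n : ℕ} {i : I}
    (α : (zariskiCohomology V n).obj (op (D.obj i)))
    (hα : rst (zariskiCohomology V n) (proj c i) α = 0) :
    ∃ (j : I) (f : j ⟶ i), rst (zariskiCohomology V n) (D.map f) α = 0 := by
  obtain ⟨z, hz⟩ := exists_represents R α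
  obtain ⟨w, hw⟩ := represents_zero_iff.mp (hα ▸ hz.rst (proj c i))
  obtain ⟨j, f, a', -, h1, -⟩ := (h (n + 1)).exists_of_top z w hz.dif_eq_zero hw.symm
  exact ⟨j, f, (hz.rst (D.map f)).unique (represents_zero_iff.mpr ⟨a', h1⟩)⟩

/-- A cocycle `z` on the cone point gives the cocycle `(0, z)` of the mapping cone. Writing it as a
coboundary presents `z` as the pullback of a cocycle, up to a coboundary. -/
lemma exists_rst_eq_of_coneExact [Nonempty I] (h : ∀ m, ConeExact R c m) {n : ℕ}
    (β : (zariskiCohomology V n).obj (op c.pt)) :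
    ∃ (i : I) (α : _), rst (zariskiCohomology V n) (proj c i) α = β := by
  obtain ⟨z, hz⟩ := exists_represents R β
  obtain ⟨i⟩ := ‹Nonempty I›
  obtain ⟨j, f, a', b', h1, h2⟩ := (h (n + 2)).exists_of_top (i := i) 0 z (map_zero _)
    (by rw [map_zero]; exact hz.dif_eq_zero.symm)
  rw [map_zero] at h1
  obtain ⟨α, hα⟩ := exists_represented R a' h1
  refine ⟨j, α, ((hα.rst (proj c j)).eq_iff hz).mpr ⟨b', ?_⟩⟩
  exact (sub_eq_of_eq_add (sub_eq_iff_eq_add'.mp (h2.symm ▸ rfl))).symm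

end ComparisonCohomology

/-! ### Sections of the associated sheaf -/

section Local

variable {V : (NoethSch k)ᵒᵖ ⥤ AddCommGrpCat.{u + 1}}

/-- The map from a presheaf to its associated sheaf on sections. -/
def assoc (V : (NoethSch k)ᵒᵖ ⥤ AddCommGrpCat.{u + 1}) (X : NoethSch k) :
    V.obj (op X) →+ (assocSheaf V).obj.obj (op X) :=
  ((toAssocSheaf V).app (op X)).hom

lemma assoc_rst {X Y : NoethSch k} (f : X ⟶ Y) (s : V.obj (op Y)) :
    assoc V X (rst V f s) = rst (assocSheaf V).obj f (assoc V Y s) :=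
  rst_app (toAssocSheaf V) f s

lemma exists_local_assoc_eq {X : NoethSch k} {A : X.sch.Opens}
    (s : (assocSheaf V).obj.obj (op (res X A))) {x : X.sch} (hx : x ∈ A) :
    ∃ (U : X.sch.Opens) (hU : U ≤ A), x ∈ U ∧
      ∃ v, assoc V (res X U) v = rst _ (resLE X hU) s := by
  have h : Presheaf.IsLocallySurjective (zariskiTopology k) (toSheafify (zariskiTopology k) V) :=
    inferInstance
  obtain ⟨U, hxU, v, hv⟩ := exists_res_of_mem (h.imageSieve_mem s) ⟨x, hx⟩
  obtain ⟨U', hU', g, hxU', hg⟩ := exists_factorization_resLE U hx hxU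
  refine ⟨U', hU', hxU', rst _ g v, ?_⟩
  rw [assoc_rst]
  refine (congrArg _ hv).trans ?_
  exact (rst_comp _ _ _ _).trans (by rw [hg])

lemma exists_local_eq_zero {X : NoethSch k} {A : X.sch.Opens} (v : V.obj (op (res X A)))
    (hv : assoc V _ v = 0) {x : X.sch} (hx : x ∈ A) :
    ∃ (U : X.sch.Opens) (hU : U ≤ A), x ∈ U ∧ rst V (resLE X hU) v = 0 := by
  have h : Presheaf.IsLocallyInjective (zariskiTopology k) (toSheafify (zariskiTopology k) V) :=
    inferInstance
  obtain ⟨U, hxU, hU⟩ := exists_res_of_mem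
    (h.equalizerSieve_mem v 0 (hv.trans (map_zero _).symm)) ⟨x, hx⟩
  obtain ⟨U', hU', g, hxU', hg⟩ := exists_factorization_resLE U hx hxU
  refine ⟨U', hU', hxU', ?_⟩
  have : rst V (resι _ U) v = 0 := Eq.trans hU (map_zero (rst V (resι _ U)))
  rw [← hg, ← rst_comp, this, map_zero]

end Local

/-! ### Filtered colimits of abelian groups -/

section Colimit

instance : PreservesFilteredColimitsOfSize.{u, u} (forget AddCommGrpCat.{u + 1}) :=
  preservesFilteredColimitsOfSize_shrink.{u, u + 1, u, u + 1} _

variable {I : Type u} [SmallCategory I] [IsCofiltered I] {D : I ⥤ NoethSch k} {c : Cone D}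
  {V : (NoethSch k)ᵒᵖ ⥤ AddCommGrpCat.{u + 1}}

lemma exists_rst_eq_of_isColimit (h : IsColimit (V.mapCocone c.op)) (v : V.obj (op c.pt)) :
    ∃ (i : I) (v' : V.obj (op (D.obj i))), rst V (proj c i) v' = v := by
  obtain ⟨i, v', hv'⟩ := Concrete.isColimit_exists_rep _ h v
  exact ⟨i.unop, v', hv'⟩

lemma exists_rst_eq_zero_of_isColimit (h : IsColimit (V.mapCocone c.op)) {i : I}
    (v : V.obj (op (D.obj i))) (hv : rst V (proj c i) v = 0) :
    ∃ (j : I) (f : j ⟶ i), rst V (D.map f) v = 0 := by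
  obtain ⟨j, f, g, e⟩ := Concrete.isColimit_exists_of_rep_eq (D.op ⋙ V) h (i := op i) (j := op i)
    v 0 (hv.trans (map_zero (rst V (proj c i))).symm)
  refine ⟨j.unop, f.unop, ?_⟩
  exact Eq.trans e (map_zero (rst V (D.map g.unop)))

/-- Filtered colimits of groups may be tested on the underlying sets; elements of different levels
are compared through their difference at a common level. -/
lemma nonempty_isColimit_of_exists
    (hsurj : ∀ v : V.obj (op c.pt), ∃ (i : I) (v' : V.obj (op (D.obj i))),
      rst V (proj c i) v' = v)
    (hinj : ∀ (i : I) (v : V.obj (op (D.obj i))), rst V (proj c i) v = 0 →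
      ∃ (j : I) (f : j ⟶ i), rst V (D.map f) v = 0) :
    Nonempty (IsColimit (V.mapCocone c.op)) := by
  have : HasColimitsOfSize.{u, u} AddCommGrpCat.{u + 1} :=
    hasColimitsOfSizeShrink.{u, u, u + 1, u + 1} _
  have : ReflectsColimit (D.op ⋙ V) (forget AddCommGrpCat.{u + 1}) :=
    reflectsColimit_of_reflectsIsomorphisms _ _
  refine ⟨isColimitOfReflects (forget AddCommGrpCat.{u + 1}) ?_⟩
  refine Types.FilteredColimit.isColimitOf _ _ ?_ ?_
  · intro v
    obtain ⟨i, v', h⟩ := hsurj v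
    exact ⟨op i, v', h.symm⟩
  · rintro ⟨i⟩ ⟨j⟩ v v' h
    obtain ⟨l, f, f', -⟩ := IsCofilteredOrEmpty.cone_objs i j
    obtain ⟨l', g, hg⟩ := hinj l (rst V (D.map f) v - rst V (D.map f') v') (by
      rw [map_sub, rst_comp, rst_comp, proj_map, proj_map, sub_eq_zero]
      exact h)
    refine ⟨op l', (g ≫ f).op, (g ≫ f').op, ?_⟩
    rw [map_sub, rst_comp, rst_comp, ← D.map_comp, ← D.map_comp, sub_eq_zero] at hg
    exact hg

end Colimit

/-! ### Continuity -/

section Continuity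

variable {I : Type u} [SmallCategory I] [IsCofiltered I] {D : I ⥤ NoethSch k} {c : Cone D}

/-- The preimages of an open subscheme of a member of a projective system. -/
def opensSystem (D : I ⥤ NoethSch k) (i : I) (W : (D.obj i).sch.Opens) : Over i ⥤ NoethSch k where
  obj j := res (D.obj j.left) (mor (D.map j.hom) ⁻¹ᵁ W)
  map {j l} f := resMap (D.map f.left) _ _ (by
    rw [← Over.w f, D.map_comp]; exact le_rfl)
  map_id j := by
    rw [← cancel_mono (resι _ _)]
    simp only [resMap_resι, Over.id_left, D.map_id, Category.id_comp, Category.comp_id]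
  map_comp f g := by
    simp only [resMap_comp, Over.comp_left, D.map_comp]

/-- The cone over the system of preimages of an open subscheme. -/
def opensSystemCone (c : Cone D) (i : I) (W : (D.obj i).sch.Opens) : Cone (opensSystem D i W) where
  pt := res c.pt (mor (proj c i) ⁻¹ᵁ W)
  π.app j := resMap (proj c j.left) _ _ (proj_preimage c j.hom W).ge
  π.naturality j l f := by
    dsimp only [opensSystem, Functor.const_obj_map, Functor.const_obj_obj]
    rw [resMap_comp, Category.id_comp]
    simp only [proj_map]

variable (hD : ∀ {i j : I} (a : i ⟶ j), IsAffineHom (mor (D.map a)))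
  (hc : IsLimit ((toScheme k).mapCone c))

include hD hc

/-- The preimages of `W` again form a system with affine transition morphisms, and its limit is the
preimage of `W` in `c.pt`. Hence continuity of `V` is available over all open subsets of finite
level. -/
lemma isColimit_of_isLimit {V : (NoethSch k)ᵒᵖ ⥤ AddCommGrpCat.{u + 1}}
    (hV : IsSufficientlyRigid V) (i : I) (W : (D.obj i).sch.Opens) :
    Nonempty (IsColimit (V.mapCocone (opensSystemCone c i W).op)) := by
  have : ∀ {i j : I} (f : i ⟶ j), IsAffineHom ((D ⋙ toScheme k).map f) := hD
  refine hV.continuity (Over i) (opensSystem D i W) (opensSystemCone c i W) ?_ ?_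
  · intro j l f
    exact inferInstanceAs (IsAffineHom ((opensDiagram (D ⋙ toScheme k) i W).map f))
  · exact ⟨isLimitOpensCone (D ⋙ toScheme k) ((toScheme k).mapCone c) hc i W⟩

lemma exists_rst_resMap_eq_zero {V : (NoethSch k)ᵒᵖ ⥤ AddCommGrpCat.{u + 1}}
    (hV : IsSufficientlyRigid V) {i : I} {W : (D.obj i).sch.Opens} (v : V.obj (op (res _ W)))
    (hv : rst V (resMap (proj c i) _ W le_rfl) v = 0) :
    ∃ (j : I) (f : j ⟶ i), rst V (resMap (D.map f) _ W le_rfl) v = 0 := by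
  obtain ⟨hcol⟩ := isColimit_of_isLimit hD hc hV i W
  have h1 : mor (D.map (𝟙 i)) ⁻¹ᵁ W ≤ W := by rw [D.map_id]; exact le_rfl
  obtain ⟨j, f, hf⟩ := exists_rst_eq_zero_of_isColimit hcol (i := Over.mk (𝟙 i))
    (rst V (resLE _ h1) v) (by
      refine (rst_comp _ _ _ _).trans (Eq.trans (congrArg (fun g => rst V g v) ?_) hv)
      exact resMap_resLE _ _ _ _)
  refine ⟨j.left, j.hom, Eq.trans ?_ hf⟩
  refine Eq.trans (congrArg (fun g => rst V g v) ?_) (rst_comp _ _ _ _).symm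
  refine Eq.trans ?_ (resMap_resLE _ _ _ _).symm
  refine resMap_congr (congrArg D.map ?_) _ _ _
  exact (Over.w f).symm.trans (Category.comp_id _)

lemma exists_rst_resMap_eq {V : (NoethSch k)ᵒᵖ ⥤ AddCommGrpCat.{u + 1}}
    (hV : IsSufficientlyRigid V) {i : I} {W : (D.obj i).sch.Opens}
    (v : V.obj (op (res _ (mor (proj c i) ⁻¹ᵁ W)))) :
    ∃ (j : I) (f : j ⟶ i) (v' : V.obj (op (res _ (mor (D.map f) ⁻¹ᵁ W)))),
      rst V (resMap (proj c j) _ _ (proj_preimage c f W).ge) v' = v := by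
  obtain ⟨hcol⟩ := isColimit_of_isLimit hD hc hV i W
  obtain ⟨j, v', hv'⟩ := exists_rst_eq_of_isColimit hcol v
  exact ⟨j.left, j.hom, v', hv'⟩

/-- Open subsets of finite level form a basis of the limit. Locally, sections of `𝒱` are elements of
`V` and their vanishing is vanishing in `V`, so continuity of `V` over such open subsets settles
degree zero; cocycles of higher degree are locally coboundaries. -/
theorem coneExact_of_isLimit {V : (NoethSch k)ᵒᵖ ⥤ AddCommGrpCat.{u + 1}}
    (hV : IsSufficientlyRigid V) (R : InjectiveResolution (assocSheaf V)) (m : ℕ) :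
    ConeExact R c m := by
  have hD' : ∀ {i j : I} (f : i ⟶ j), IsAffineHom ((D ⋙ toScheme k).map f) := hD
  have basis : ∀ (i : I) (A : (D.obj i).sch.Opens) (N : c.pt.sch.Opens)
      (_ : N ≤ mor (proj c i) ⁻¹ᵁ A) (x : c.pt.sch) (_ : x ∈ N),
      ∃ (j : I) (f : j ⟶ i) (W : (D.obj j).sch.Opens) (_ : W ≤ mor (D.map f) ⁻¹ᵁ A),
        mor (proj c j) ⁻¹ᵁ W ≤ N ∧ x ∈ mor (proj c j) ⁻¹ᵁ W := by
    intro i A N hNA x hx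
    obtain ⟨j, W, -, hW⟩ := exists_preimage_eq (D ⋙ toScheme k) ((toScheme k).mapCone c) hc N
      (TopologicalSpace.NoetherianSpace.isCompact (N : Set c.pt.sch))
    obtain ⟨l, f, g, -⟩ := IsCofilteredOrEmpty.cone_objs i j
    have e : mor (proj c l) ⁻¹ᵁ mor (D.map g) ⁻¹ᵁ W = N := (proj_preimage c g W).trans hW
    have hA := proj_preimage c f A
    refine ⟨l, f, mor (D.map g) ⁻¹ᵁ W ⊓ mor (D.map f) ⁻¹ᵁ A, inf_le_right, ?_, ?_, ?_⟩
    · exact ((mor (proj c l)).preimage_mono inf_le_left).trans e.le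
    · exact (e.symm ▸ hx : x ∈ mor (proj c l) ⁻¹ᵁ mor (D.map g) ⁻¹ᵁ W)
    · exact (hA.symm ▸ hNA hx : x ∈ mor (proj c l) ⁻¹ᵁ mor (D.map f) ⁻¹ᵁ A)
  refine coneExact R c (fun i A B h => ?_) ?_ ?_ m
  · exact exists_map_preimage_le_map_preimage (D ⋙ toScheme k) ((toScheme k).mapCone c) hc
      (TopologicalSpace.NoetherianSpace.isCompact (A : Set (D.obj i).sch)) h
  · intro i A N hN s hs x hx
    -- Represent `s` near the image of `x` by an element `v` of `V`. Its pullback to the limit dies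
    -- near `x`, so continuity kills a restriction of `v` at some level.
    obtain ⟨U, hU, hxU, v, hv⟩ := exists_local_assoc_eq s
      (show mor (proj c i) x ∈ A by rw [hN] at hx; exact hx)
    obtain ⟨U', hU'⟩ : ∃ U', U' = mor (proj c i) ⁻¹ᵁ U := ⟨_, rfl⟩
    have hU'N : U' ≤ N := by
      rw [hU', hN]; exact (mor (proj c i)).preimage_mono hU
    obtain ⟨M, hMU, hxM, hM⟩ := exists_local_eq_zero (rst V (resMap (proj c i) U' U hU'.le) v) (by
      rw [assoc_rst, hv]
      have := congrArg (rst _ (resLE _ hU'N)) hs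
      rw [map_zero] at this
      rw [← this]
      simp only [rst_comp, resMap_resLE, resLE_resMap]) (show x ∈ U' by rw [hU']; exact hxU)
    obtain ⟨j, f, W, hW, hWM, hxW⟩ := basis i U M (hMU.trans hU'.le) x hxM
    obtain ⟨l, g, hg⟩ := exists_rst_resMap_eq_zero hD hc hV (rst V (resMap (D.map f) W U hW) v) (by
        have := congrArg (rst V (resLE _ hWM)) hM
        rw [map_zero] at this
        rw [← this]
        simp only [rst_comp, resLE_resMap, resMap_comp, proj_map])
    have hWA : mor (D.map g) ⁻¹ᵁ W ≤ mor (D.map (g ≫ f)) ⁻¹ᵁ A := by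
      rw [D.map_comp]
      exact (mor (D.map g)).preimage_mono (hW.trans ((mor (D.map f)).preimage_mono hU))
    refine ⟨l, g ≫ f, mor (D.map g) ⁻¹ᵁ W, hWA, ?_, ?_⟩
    · exact (proj_preimage c g W).ge hxW
    · have := congrArg (assoc V _) hg
      rw [map_zero, assoc_rst, assoc_rst, hv] at this
      rw [← this]
      simp only [rst_comp, resMap_comp, resMap_resLE, Functor.map_comp]
  · intro m i A N hN b hb x hx
    match m with
    | 0 =>
      obtain ⟨t, rfl⟩ := exists_aug_eq R b hb
      obtain ⟨M, hMN, hxM, v, hv⟩ := exists_local_assoc_eq t hx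
      obtain ⟨j, f, W, hW, hWM, hxW⟩ := basis i A M (hMN.trans hN.le) x hxM
      obtain ⟨l, g, v', hv'⟩ := exists_rst_resMap_eq hD hc hV (rst V (resLE _ hWM) v)
      have hWA : mor (D.map g) ⁻¹ᵁ W ≤ mor (D.map (g ≫ f)) ⁻¹ᵁ A := by
        rw [D.map_comp]; exact (mor (D.map g)).preimage_mono hW
      refine ⟨l, g ≫ f, mor (D.map g) ⁻¹ᵁ W, hWA, mor (proj c j) ⁻¹ᵁ W,
        (proj_preimage c g W).symm, hxW, hWM.trans hMN, aug R _ (assoc V _ v'), 0,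
        dif_aug R _ _, ?_⟩
      rw [map_zero, sub_zero, ← aug_rst, ← aug_rst, ← assoc_rst, hv', assoc_rst, hv, rst_comp,
        resLE_comp]
    | m + 1 =>
      -- In positive degree the cocycle is already a coboundary near `x`, so zero can be taken at
      -- the finite level.
      obtain ⟨M, hMN, hxM, w, hw⟩ := exists_local_dif_eq_res R m b hb hx
      obtain ⟨j, f, W, hW, hWM, hxW⟩ := basis i A M (hMN.trans hN.le) x hxM
      refine ⟨j, f, W, hW, mor (proj c j) ⁻¹ᵁ W, rfl, hxW, hWM.trans hMN, 0,
        -rst _ (resLE _ hWM) w, map_zero _, ?_⟩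
      rw [map_zero, map_neg, dif_rst, hw, rst_comp, resLE_comp, zero_sub, neg_neg]

/-- Zariski cohomology is compatible with filtered projective limits of schemes. -/
theorem isColimit_zariskiCohomology {V : (NoethSch k)ᵒᵖ ⥤ AddCommGrpCat.{u + 1}}
    (hV : IsSufficientlyRigid V) (n : ℕ) :
    Nonempty (IsColimit ((zariskiCohomology V n).mapCocone c.op)) := by
  obtain ⟨R⟩ := HasInjectiveResolution.out (Z := assocSheaf V)
  have h := coneExact_of_isLimit hD hc hV R
  have : Nonempty I := IsCofiltered.nonempty
  exact nonempty_isColimit_of_exists (exists_rst_eq_of_coneExact h)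
    fun i => exists_rst_eq_zero_of_coneExact h

/-- The sections of the associated sheaf are compatible with filtered projective limits of
schemes. -/
theorem isColimit_assocSheaf {V : (NoethSch k)ᵒᵖ ⥤ AddCommGrpCat.{u + 1}}
    (hV : IsSufficientlyRigid V) :
    Nonempty (IsColimit ((assocSheaf V).obj.mapCocone c.op)) := by
  obtain ⟨R⟩ := HasInjectiveResolution.out (Z := assocSheaf V)
  have h := coneExact_of_isLimit hD hc hV R
  obtain ⟨i⟩ : Nonempty I := IsCofiltered.nonempty
  refine nonempty_isColimit_of_exists (fun t => ?_) fun i s hs => ?_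
  · obtain ⟨j, f, a', b', h1, h2⟩ := (h 2).exists_of_top (i := i) 0 (aug R _ t) (map_zero _)
      (by rw [map_zero]; exact (dif_aug R _ t).symm)
    rw [map_zero] at h1
    obtain ⟨s, rfl⟩ := exists_aug_eq R a' h1
    refine ⟨j, s, aug_injective R _ ?_⟩
    rw [aug_rst, h2, (subsingleton_cochains_two R _).elim b' 0, map_zero, sub_zero]
  · obtain ⟨j, f, a', b', h1, h2⟩ := (h 1).exists_of_top (aug R _ s) 0 (dif_aug R _ s)
      (by rw [map_zero, ← aug_rst, hs, map_zero])
    refine ⟨j, f, aug_injective R _ ?_⟩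
    rw [aug_rst, map_zero]
    refine h1.symm.trans ?_
    rw [(subsingleton_cochains_two R _).elim a' 0, map_zero]

end Continuity

/-! ### Localization of a morphism at a point of its target -/

section ProLocal

/-- The basic open neighbourhoods of a point in an affine open subscheme. -/
def basicNhds {Y : Scheme.{u}} (y : Y) (U₀ : Y.Opens) : Set Y.Opens :=
  {W | y ∈ W ∧ ∃ s : Γ(Y, U₀), W = Y.basicOpen s}

lemma self_mem_basicNhds {Y : Scheme.{u}} {y : Y} {U₀ : Y.Opens} (hy : y ∈ U₀) :
    U₀ ∈ basicNhds y U₀ :=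
  ⟨hy, 1, (Scheme.basicOpen_of_isUnit _ isUnit_one).symm⟩

lemma inf_mem_basicNhds {Y : Scheme.{u}} {y : Y} {U₀ W W' : Y.Opens} (h : W ∈ basicNhds y U₀)
    (h' : W' ∈ basicNhds y U₀) : W ⊓ W' ∈ basicNhds y U₀ := by
  obtain ⟨hy, s, rfl⟩ := h
  obtain ⟨hy', s', rfl⟩ := h'
  exact ⟨⟨hy, hy'⟩, s * s', (Scheme.basicOpen_mul _ _ _).symm⟩

lemma isAffineOpen_of_mem_basicNhds {Y : Scheme.{u}} {y : Y} {U₀ W : Y.Opens}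
    (h₀ : IsAffineOpen U₀) (h : W ∈ basicNhds y U₀) : IsAffineOpen W := by
  obtain ⟨hy, s, rfl⟩ := h
  exact h₀.basicOpen s

lemma exists_mem_basicNhds_le {Y : Scheme.{u}} {y : Y} {U₀ : Y.Opens}
    (h₀ : IsAffineOpen U₀) (hy : y ∈ U₀) {U : Y.Opens} (hU : y ∈ U) :
    ∃ W ∈ basicNhds y U₀, W ≤ U := by
  obtain ⟨s, h1, h2⟩ := h₀.exists_basicOpen_le ⟨y, hU⟩ hy
  exact ⟨_, ⟨h2, s, rfl⟩, h1⟩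

/-- `g : P ⟶ Z` is the limit of the preimages under `f : Z ⟶ Y` of the open subschemes that
belong to `𝓑`. -/
structure IsProLocal {P Z Y : Scheme.{u}} (f : Z ⟶ Y) (𝓑 : Set Y.Opens) (g : P ⟶ Z) : Prop where
  preimage_eq_top : ∀ W ∈ 𝓑, g ⁻¹ᵁ f ⁻¹ᵁ W = ⊤
  existsUnique : ∀ {T : Scheme.{u}} (h : T ⟶ Z), (∀ W ∈ 𝓑, h ⁻¹ᵁ f ⁻¹ᵁ W = ⊤) →
    ∃! l : T ⟶ P, l ≫ g = h

/-- This passes from the localization of a scheme at a point to the localized affine line over it.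
-/
lemma IsProLocal.of_isPullback {P Z Y P' : Scheme.{u}} {f : Z ⟶ Y} {𝓑 : Set Y.Opens} {g : P ⟶ Y}
    (hg : IsProLocal (𝟙 Y) 𝓑 g) {g' : P' ⟶ Z} {f' : P' ⟶ P} (H : IsPullback g' f' f g) :
    IsProLocal f 𝓑 g' where
  preimage_eq_top W hW := by
    rw [← Scheme.Hom.comp_preimage, H.w, Scheme.Hom.comp_preimage]
    have : g ⁻¹ᵁ W = ⊤ := hg.preimage_eq_top W hW
    rw [this]; rfl
  existsUnique {T} h hh := by
    obtain ⟨l, hl, hl'⟩ := hg.existsUnique (h ≫ f) hh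
    refine ⟨H.lift h l hl.symm, H.lift_fst _ _ _, fun l' e => H.hom_ext ?_ ?_⟩
    · rw [e, H.lift_fst]
    · rw [H.lift_snd]
      refine hl' _ ?_
      change (l' ≫ f') ≫ g = h ≫ f
      rw [Category.assoc, ← H.w, ← e, Category.assoc]

/-- The functions on an affine open subscheme that do not vanish at a point. -/
def nonvanishing {Y : Scheme.{u}} (y : Y) (U₀ : Y.Opens) (hy : y ∈ U₀) : Submonoid Γ(Y, U₀) where
  carrier := {s | y ∈ Y.basicOpen s}
  one_mem' := by
    change y ∈ Y.basicOpen _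
    rw [Scheme.basicOpen_of_isUnit _ isUnit_one]; exact hy
  mul_mem' {a b} ha hb := by
    change y ∈ Y.basicOpen _
    rw [Scheme.basicOpen_mul]; exact ⟨ha, hb⟩

lemma nonvanishing_eq {Y : Scheme.{u}} (y : Y) (U₀ : Y.Opens) (h₀ : IsAffineOpen U₀)
    (hy : y ∈ U₀) : nonvanishing y U₀ hy = (h₀.primeIdealOf ⟨y, hy⟩).asIdeal.primeCompl := by
  ext s
  change y ∈ Y.basicOpen s ↔ _
  have h := h₀.fromSpec_preimage_basicOpen s
  have h1 : h₀.primeIdealOf ⟨y, hy⟩ ∈ h₀.fromSpec ⁻¹ᵁ Y.basicOpen s ↔ y ∈ Y.basicOpen s := by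
    change h₀.fromSpec (h₀.primeIdealOf ⟨y, hy⟩) ∈ Y.basicOpen s ↔ _
    rw [h₀.fromSpec_primeIdealOf ⟨y, hy⟩]
  rw [← h1, h]
  rfl

lemma isUnit_of_basicOpen_eq_top {T : Scheme.{u}} (s : Γ(T, ⊤)) (h : T.basicOpen s = ⊤) :
    IsUnit s := by
  refine (T.toRingedSpace.isUnit_of_isUnit_germ ⊤ s fun x hx => ?_)
  have hx' : x ∈ T.basicOpen s := h.ge hx
  exact (T.mem_basicOpen s x hx).mp hx'

lemma preimage_basicOpen_SpecMap {R S : CommRingCat.{u}} (φ : R ⟶ S) (r : R) :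
    Spec.map φ ⁻¹ᵁ PrimeSpectrum.basicOpen r = PrimeSpectrum.basicOpen (φ.hom r) := rfl

/-- A morphism to the affine scheme `f ⁻¹ᵁ U₀` is a ring map to global functions. It factors through
the localization exactly when the functions from `Y` that do not vanish at `y` become units, that
is, when its image lies in the preimages of their basic open subsets. -/
lemma isProLocal_of_isLocalization {Z Y : Scheme.{u}} (f : Z ⟶ Y) (y : Y) (U₀ : Y.Opens)
    (hy : y ∈ U₀) (hV : IsAffineOpen (f ⁻¹ᵁ U₀)) (A : Type u) [CommRing A]
    [Algebra Γ(Z, f ⁻¹ᵁ U₀) A]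
    [IsLocalization ((nonvanishing y U₀ hy).map (f.app U₀).hom) A] :
    IsProLocal f (basicNhds y U₀) (Spec.map (CommRingCat.ofHom (algebraMap Γ(Z, f ⁻¹ᵁ U₀) A)) ≫
      hV.fromSpec) where
  preimage_eq_top W hW := by
    obtain ⟨hW, s, rfl⟩ := hW
    rw [Scheme.preimage_basicOpen, Scheme.Hom.comp_preimage, hV.fromSpec_preimage_basicOpen]
    have hu : IsUnit (algebraMap Γ(Z, f ⁻¹ᵁ U₀) A (f.app U₀ s)) :=
      IsLocalization.map_units A (⟨_, s, hW, rfl⟩ : (nonvanishing y U₀ hy).map (f.app U₀).hom)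
    refine (preimage_basicOpen_SpecMap _ _).trans ?_
    exact top_le_iff.mp fun x _ hx => x.2.ne_top (Ideal.eq_top_of_isUnit_mem _ hx hu)
  existsUnique {T} h hh := by
    have h1 : Set.range h ⊆ Set.range hV.fromSpec := by
      rw [hV.range_fromSpec]
      rintro _ ⟨t, rfl⟩
      have : t ∈ h ⁻¹ᵁ f ⁻¹ᵁ U₀ := by
        rw [hh U₀ (self_mem_basicNhds hy)]; trivial
      exact this
    let h' := IsOpenImmersion.lift hV.fromSpec h h1
    have hh' : h' ≫ hV.fromSpec = h := IsOpenImmersion.lift_fac _ _ _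
    let φ : Γ(Z, f ⁻¹ᵁ U₀) ⟶ Γ(T, ⊤) := (Scheme.ΓSpecIso _).inv ≫ h'.appTop
    have hφ : T.toSpecΓ ≫ Spec.map φ = h' := by
      rw [Spec.map_comp, ← Scheme.toSpecΓ_naturality_assoc, toSpecΓ_SpecMap_ΓSpecIso_inv,
        Category.comp_id]
    have hu : ∀ m : (nonvanishing y U₀ hy).map (f.app U₀).hom, IsUnit (φ.hom m) := by
      rintro ⟨_, s, hs, rfl⟩
      refine isUnit_of_basicOpen_eq_top (φ.hom ((f.app U₀).hom s)) ?_
      rw [← Scheme.toSpecΓ_preimage_basicOpen]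
      have e : (T.toSpecΓ ≫ Spec.map φ) ⁻¹ᵁ hV.fromSpec ⁻¹ᵁ Z.basicOpen (f.app U₀ s) = ⊤ := by
        rw [hφ, ← Scheme.Hom.comp_preimage, hh', ← Scheme.preimage_basicOpen]
        exact hh _ ⟨hs, s, rfl⟩
      rw [hV.fromSpec_preimage_basicOpen] at e
      exact e
    let ψ : A →+* Γ(T, ⊤) := IsLocalization.lift hu
    have hψ : ψ.comp (algebraMap Γ(Z, f ⁻¹ᵁ U₀) A) = φ.hom := IsLocalization.lift_comp hu
    refine ⟨T.toSpecΓ ≫ Spec.map (CommRingCat.ofHom ψ), ?_, fun l hl => ?_⟩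
    · beta_reduce
      rw [Category.assoc, ← Spec.map_comp_assoc, ← hh', ← hφ, Category.assoc]
      congr 3
      exact CommRingCat.hom_ext hψ
    -- A localization is an epimorphism of rings, so its spectrum is a monomorphism and the
    -- factorization is unique.
    · have : Epi (CommRingCat.ofHom (algebraMap Γ(Z, f ⁻¹ᵁ U₀) A)) :=
        IsLocalization.epi ((nonvanishing y U₀ hy).map (f.app U₀).hom) A
      have : Mono (Spec.map (CommRingCat.ofHom (algebraMap Γ(Z, f ⁻¹ᵁ U₀) A))) :=
        inferInstanceAs (Mono (Scheme.Spec.map (CommRingCat.ofHom (algebraMap _ A)).op))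
      rw [← cancel_mono (Spec.map (CommRingCat.ofHom (algebraMap Γ(Z, f ⁻¹ᵁ U₀) A))),
        ← cancel_mono hV.fromSpec, Category.assoc, hl, Category.assoc, Category.assoc,
        ← Spec.map_comp_assoc, ← hh', ← hφ, Category.assoc]
      congr 3
      exact CommRingCat.hom_ext hψ.symm

lemma IsProLocal.existsUnique_lift {P Z Y : Scheme.{u}} {f : Z ⟶ Y} {y : Y} {U₀ : Y.Opens}
    {g : P ⟶ Z} (hg : IsProLocal f (basicNhds y U₀) g) (hy : y ∈ U₀) {T : Scheme.{u}}
    (t : ∀ W : basicNhds y U₀, T ⟶ (f ⁻¹ᵁ W.1 : Z.Opens))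
    (ht : ∀ W, t W ≫ (f ⁻¹ᵁ W.1).ι = t ⟨U₀, self_mem_basicNhds hy⟩ ≫ (f ⁻¹ᵁ U₀).ι) :
    ∃! l : T ⟶ P, l ≫ g = t ⟨U₀, self_mem_basicNhds hy⟩ ≫ (f ⁻¹ᵁ U₀).ι := by
  refine hg.existsUnique _ fun W hW => ?_
  rw [← ht ⟨W, hW⟩, Scheme.Hom.comp_preimage, Scheme.Opens.ι_preimage_self]
  rfl

end ProLocal

/-! ### The system of neighbourhoods of a point and germs along its limit -/

section LocalSystem

variable {Z Y P : NoethSch k} (f : Z ⟶ Y) (y : Y.sch) (U₀ : Y.sch.Opens)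

/-- The preimages of the basic open neighbourhoods of a point. -/
def localSystem : basicNhds y U₀ ⥤ NoethSch k where
  obj W := res Z (mor f ⁻¹ᵁ W.1)
  map h := resLE Z ((mor f).preimage_mono (leOfHom h))
  map_id _ := resLE_refl Z _
  map_comp _ _ := (resLE_comp Z _ _).symm

lemma isCofiltered_basicNhds {y : Y.sch} {U₀ : Y.sch.Opens} (hy : y ∈ U₀) :
    IsCofiltered (basicNhds y U₀) := by
  have : Nonempty (basicNhds y U₀) := ⟨⟨U₀, self_mem_basicNhds hy⟩⟩
  have : IsCodirectedOrder (basicNhds y U₀) :=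
    ⟨fun W W' => ⟨⟨W.1 ⊓ W'.1, inf_mem_basicNhds W.2 W'.2⟩, inf_le_left (a := W.1),
      inf_le_right (a := W.1)⟩⟩
  infer_instance

lemma isAffineHom_of_isAffineOpen {X : Scheme.{u}} {U U' : X.Opens} (hU : IsAffineOpen U)
    (hU' : IsAffineOpen U') (φ : (U : Scheme.{u}) ⟶ U') : IsAffineHom φ := by
  have : IsAffine U := hU
  have : IsAffine U' := hU'
  infer_instance

lemma isAffineHom_localSystem_map [IsAffineHom (mor f)] (h₀ : IsAffineOpen U₀)
    {W W' : basicNhds y U₀} (h : W ⟶ W') : IsAffineHom (mor ((localSystem f y U₀).map h)) :=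
  isAffineHom_of_isAffineOpen ((isAffineOpen_of_mem_basicNhds h₀ W.2).preimage (mor f))
    ((isAffineOpen_of_mem_basicNhds h₀ W'.2).preimage (mor f)) _

variable {f y U₀} {g : P ⟶ Z} (hg : IsProLocal (mor f) (basicNhds y U₀) (mor g))

/-- The cone over the preimages of the basic open neighbourhoods of a point. -/
def localCone : Cone (localSystem f y U₀) where
  pt := P
  π.app W := toRes g _ (hg.preimage_eq_top W.1 W.2)
  π.naturality W W' h := by
    dsimp only [localSystem, Functor.const_obj_map, Functor.const_obj_obj]
    rw [← cancel_mono (resι _ _)]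
    simp only [Category.assoc, resLE_resι, toRes_resι, Category.id_comp]

/-- `U₀` is the largest member of the system, so a cone amounts to its component there, composed to
`Z`; this map lands in all the other preimages. -/
lemma nonempty_isLimit_localCone (hy : y ∈ U₀) :
    Nonempty (IsLimit ((toScheme k).mapCone (localCone hg))) := by
  have hle : ∀ W : basicNhds y U₀, W ≤ ⟨U₀, self_mem_basicNhds hy⟩ := by
    rintro ⟨_, _, s, rfl⟩
    exact Scheme.basicOpen_le _ _
  have hι : ∀ (s : Cone (localSystem f y U₀ ⋙ toScheme k)) (W : basicNhds y U₀),
      s.π.app W ≫ (mor f ⁻¹ᵁ W.1).ι =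
        s.π.app ⟨U₀, self_mem_basicNhds hy⟩ ≫ (mor f ⁻¹ᵁ U₀).ι := by
    intro s W
    rw [← s.w (homOfLE (hle W))]
    refine Eq.trans ?_ (Category.assoc _ _ _).symm
    exact congrArg (s.π.app W ≫ ·) (congrArg mor (resLE_resι Z _)).symm
  have hex : ∀ s : Cone (localSystem f y U₀ ⋙ toScheme k), ∃! l : s.pt ⟶ P.sch,
      l ≫ mor g = s.π.app ⟨U₀, self_mem_basicNhds hy⟩ ≫ (mor f ⁻¹ᵁ U₀).ι :=
    fun s => hg.existsUnique_lift hy s.π.app (hι s)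
  have hπ : ∀ W : basicNhds y U₀, mor ((localCone hg).π.app W) ≫ (mor f ⁻¹ᵁ W.1).ι = mor g :=
    fun W => congrArg mor (toRes_resι g _ (hg.preimage_eq_top W.1 W.2))
  refine ⟨{ lift s := (hex s).choose
            fac s W := ?_
            uniq s m hm := ?_ }⟩
  · refine (cancel_mono (mor f ⁻¹ᵁ W.1).ι).mp ((Eq.trans ?_ (hex s).choose_spec.1).trans
      (hι s W).symm)
    refine (Category.assoc _ _ _).trans ?_
    exact congrArg ((hex s).choose ≫ ·) (hπ W)
  · refine (hex s).choose_spec.2 m ?_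
    rw [← hm]
    refine Eq.trans ?_ (Category.assoc _ _ _).symm
    exact congrArg (m ≫ ·) (hπ _).symm

variable (hy : y ∈ U₀)

include hy

/-- Together with `exists_rst_eq_zero_of_isProLocal`: when `G` is continuous along the local cone,
its sections over `P` are the germs at `y` of its direct image. -/
lemma exists_rst_eq_of_isProLocal {G : (NoethSch k)ᵒᵖ ⥤ AddCommGrpCat.{u + 1}}
    (hG : Nonempty (IsColimit (G.mapCocone (localCone hg).op))) (v : G.obj (op P)) :
    ∃ (U : Y.sch.Opens) (_ : y ∈ U) (hU : mor g ⁻¹ᵁ mor f ⁻¹ᵁ U = ⊤)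
      (v' : G.obj (op (res Z (mor f ⁻¹ᵁ U)))), rst G (toRes g _ hU) v' = v := by
  have := isCofiltered_basicNhds hy
  obtain ⟨W, v', hv'⟩ := exists_rst_eq_of_isColimit hG.some v
  exact ⟨W.1, W.2.1, hg.preimage_eq_top W.1 W.2, v', hv'⟩

variable (h₀ : IsAffineOpen U₀)

include h₀

lemma exists_rst_eq_zero_of_isProLocal {G : (NoethSch k)ᵒᵖ ⥤ AddCommGrpCat.{u + 1}}
    (hG : Nonempty (IsColimit (G.mapCocone (localCone hg).op))) {U : Y.sch.Opens} (hyU : y ∈ U)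
    (v : G.obj (op (res Z (mor f ⁻¹ᵁ U)))) (hU : mor g ⁻¹ᵁ mor f ⁻¹ᵁ U = ⊤)
    (hv : rst G (toRes g _ hU) v = 0) :
    ∃ (U' : Y.sch.Opens) (h : U' ≤ U), y ∈ U' ∧
      rst G (resLE Z ((mor f).preimage_mono h)) v = 0 := by
  have := isCofiltered_basicNhds hy
  obtain ⟨W, hW, hWU⟩ := exists_mem_basicNhds_le h₀ hy hyU
  obtain ⟨W', h, hW'⟩ := exists_rst_eq_zero_of_isColimit hG.some (i := ⟨W, hW⟩)
    (rst G (resLE Z ((mor f).preimage_mono hWU)) v) (by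
      refine (rst_comp _ _ _ _).trans (Eq.trans (congrArg (fun l => rst G l v) ?_) hv)
      change toRes g _ (hg.preimage_eq_top W hW) ≫ _ = _
      rw [← cancel_mono (resι _ _), Category.assoc, resLE_resι, toRes_resι, toRes_resι])
  refine ⟨W'.1, (show W'.1 ≤ W from leOfHom h).trans hWU, W'.2.1, Eq.trans ?_ hW'⟩
  refine Eq.trans ?_ (rst_comp _ _ _ _).symm
  exact congrArg (fun l => rst G l v) (resLE_comp _ _ _).symm

include hg in
lemma preimage_eq_top_of_isProLocal {U : Y.sch.Opens} (hyU : y ∈ U) :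
    mor g ⁻¹ᵁ mor f ⁻¹ᵁ U = ⊤ := by
  obtain ⟨W, hW, hWU⟩ := exists_mem_basicNhds_le h₀ hy hyU
  exact top_le_iff.mp ((hg.preimage_eq_top W hW).ge.trans
    ((mor g).preimage_mono ((mor f).preimage_mono hWU)))

variable [IsAffineHom (mor f)] {V : (NoethSch k)ᵒᵖ ⥤ AddCommGrpCat.{u + 1}}
  (hV : IsSufficientlyRigid V)

include hV

lemma isColimit_localCone : Nonempty (IsColimit (V.mapCocone (localCone hg).op)) := by
  have := isCofiltered_basicNhds hy
  exact hV.continuity _ _ _ (isAffineHom_localSystem_map f y U₀ h₀)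
    (nonempty_isLimit_localCone hg hy)

lemma isColimit_localCone_assocSheaf :
    Nonempty (IsColimit ((assocSheaf V).obj.mapCocone (localCone hg).op)) := by
  have := isCofiltered_basicNhds hy
  exact isColimit_assocSheaf (isAffineHom_localSystem_map f y U₀ h₀)
    (nonempty_isLimit_localCone hg hy).some hV

lemma isColimit_localCone_zariskiCohomology (n : ℕ) :
    Nonempty (IsColimit ((zariskiCohomology V n).mapCocone (localCone hg).op)) := by
  have := isCofiltered_basicNhds hy
  exact isColimit_zariskiCohomology (isAffineHom_localSystem_map f y U₀ h₀)
    (nonempty_isLimit_localCone hg hy).some hV n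

include hg in
/-- Vanishing of cohomology on the localization at a point implies local vanishing of higher direct
images. -/
lemma exists_dif_eq_of_isProLocal (R : InjectiveResolution (assocSheaf V)) {n : ℕ}
    (hP : IsZero ((zariskiCohomology V (n + 1)).obj (op P))) {U : Y.sch.Opens} (hyU : y ∈ U)
    (b : (Cochains R (n + 4)).obj (op (res Z (mor f ⁻¹ᵁ U)))) (hb : dif R (n + 4) _ b = 0) :
    ∃ (U' : Y.sch.Opens) (h : U' ≤ U), y ∈ U' ∧
      ∃ w, dif R (n + 3) (res Z (mor f ⁻¹ᵁ U')) w =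
        rst _ (resLE Z ((mor f).preimage_mono h)) b := by
  obtain ⟨α, hα⟩ := exists_represented R b hb
  obtain ⟨U', h, hyU', hα'⟩ := exists_rst_eq_zero_of_isProLocal hg hy h₀
    (isColimit_localCone_zariskiCohomology hg hy h₀ hV (n + 1)) hyU α
    (preimage_eq_top_of_isProLocal hg hy h₀ hyU)
    ((AddCommGrpCat.subsingleton_of_isZero hP).elim _ _)
  exact ⟨U', h, hyU', represents_zero_iff.mp (hα' ▸ hα.rst _)⟩

end LocalSystem

/-! ### Local rings of smooth schemes -/

/-- By integrality all maximal ideals lie over the maximal ideal of `O`, and a finite algebra has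
finitely many primes over it. -/
lemma finite_maximalSpectrum_of_finite (O A : Type*) [CommRing O] [CommRing A] [Algebra O A]
    [IsLocalRing O] [Module.Finite O A] : Finite (MaximalSpectrum A) := by
  have h := Algebra.QuasiFinite.finite_primesOver (S := A) (IsLocalRing.maximalIdeal O)
  refine Finite.of_injective (β := h.toFinset) (fun m => ⟨m.asIdeal, ?_⟩) fun m m' e => ?_
  · have := m.isMaximal
    have h1 := Ideal.isMaximal_comap_of_isIntegral_of_isMaximal (R := O) m.asIdeal
    rw [Set.Finite.mem_toFinset]
    exact ⟨inferInstance, ⟨(IsLocalRing.eq_maximalIdeal h1).symm⟩⟩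
  · exact MaximalSpectrum.ext (congrArg Subtype.val e)

/-- `A` is the localization of `B` over the local ring of `C` at `p`, and it is finite over that
ring. -/
lemma finite_maximalSpectrum_of_isLocalization {C B : Type u} [CommRing C] [CommRing B]
    (φ : C →+* B) (hφ : φ.Finite) (p : Ideal C) [p.IsPrime] (A : Type u) [CommRing A] [Algebra B A]
    [IsLocalization (p.primeCompl.map φ) A] : Finite (MaximalSpectrum A) := by
  algebraize [φ]
  let O := Localization.AtPrime p
  have h : IsLocalization (Algebra.algebraMapSubmonoid B p.primeCompl) A :=
    inferInstanceAs (IsLocalization (p.primeCompl.map φ) A)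
  let : Algebra C A := ((algebraMap B A).comp φ).toAlgebra
  have : IsScalarTower C B A := IsScalarTower.of_algebraMap_eq fun _ => rfl
  let : Algebra O A := localizationAlgebra p.primeCompl B
  have : IsScalarTower C O A :=
    IsScalarTower.of_algebraMap_eq fun x => (IsLocalization.map_eq _ x).symm
  have : Module.Finite O A := Module.Finite.of_isLocalization C B p.primeCompl
  exact finite_maximalSpectrum_of_finite O A

/-- The functions on the preimage of an affine neighbourhood form a smooth algebra over a field.
Inverting those from `Y` that do not vanish at `y` gives a ring to which the hypotheses of the
theorem can apply. -/
lemma exists_localization {Z Y : NoethSch k} (f : Z ⟶ Y) [IsAffineHom (mor f)]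
    (hZ : IsSmoothOverExtension Z) (y : Y.sch) :
    ∃ (U₀ : Y.sch.Opens) (hy : y ∈ U₀) (_ : IsAffineOpen U₀) (A : Type u) (_ : CommRing A)
      (_ : Algebra k A) (_ : IsNoetherianRing A) (_ : Algebra Γ(Z.sch, mor f ⁻¹ᵁ U₀) A)
      (_ : IsLocalization ((nonvanishing y U₀ hy).map ((mor f).app U₀).hom) A)
      (g : specObj k A ⟶ Z), IsLocalizationOfSmooth k A ∧
        IsProLocal (mor f) (basicNhds y U₀) (mor g) := by
  obtain ⟨U₀, h₀, hy, -⟩ := exists_isAffineOpen_mem_and_subset (x := y) (U := ⊤) trivial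
  have hV : IsAffineOpen (mor f ⁻¹ᵁ U₀) := h₀.preimage (mor f)
  obtain ⟨L, _, _, s, hs, hsm⟩ := hZ
  let M := (nonvanishing y U₀ hy).map ((mor f).app U₀).hom
  let A := Localization M
  let θ : CommRingCat.of L ⟶ Γ(Z.sch, mor f ⁻¹ᵁ U₀) := Spec.preimage (hV.fromSpec ≫ s)
  have hθ : Spec.map θ = hV.fromSpec ≫ s := Spec.map_preimage _
  have hθs : θ.hom.Smooth := by
    rw [← HasRingHomProperty.Spec_iff (P := @Smooth), hθ]
    infer_instance
  let : Algebra k A := (((algebraMap Γ(Z.sch, mor f ⁻¹ᵁ U₀) A).comp θ.hom).comp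
    (algebraMap k L)).toAlgebra
  have hA : IsLocalizationOfSmooth k A :=
    ⟨L, inferInstance, inferInstance, Γ(Z.sch, mor f ⁻¹ᵁ U₀), inferInstance, θ.hom.toAlgebra,
      inferInstance, M, hθs, inferInstance, rfl⟩
  have := hA.isNoetherianRing
  refine ⟨U₀, hy, h₀, A, inferInstance, inferInstance, this, inferInstance,
    inferInstance, mkHom (Spec.map (CommRingCat.ofHom (algebraMap Γ(Z.sch, mor f ⁻¹ᵁ U₀) A)) ≫
      hV.fromSpec) ?_, hA, isProLocal_of_isLocalization (mor f) y U₀ hy hV A⟩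
  change (Spec.map (CommRingCat.ofHom (algebraMap Γ(Z.sch, mor f ⁻¹ᵁ U₀) A)) ≫
      hV.fromSpec) ≫ Z.str = Spec.map (CommRingCat.ofHom (algebraMap k A))
  rw [← hs, Category.assoc, ← Category.assoc hV.fromSpec, ← hθ, ← Spec.map_comp, ← Spec.map_comp]
  rfl

/-- The map on sections of an identity morphism is supplied together with a proof that it equals the
identity, hence the variable `φ`. -/
lemma isLocalRing_of_eq_id {C : Type u} [CommRing C] {φ : C →+* C} (hφ : φ = RingHom.id C)
    (p : Ideal C) [p.IsPrime] (A : Type u) [CommRing A] [Algebra C A]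
    [hA : IsLocalization (p.primeCompl.map φ) A] : IsLocalRing A := by
  subst hφ
  have e : p.primeCompl.map (RingHom.id C) = p.primeCompl := Submonoid.map_id _
  rw [e] at hA
  exact IsLocalization.AtPrime.isLocalRing A p

lemma isLocalRing_of_isLocalization_nonvanishing {Y : NoethSch k} {y : Y.sch} {U₀ : Y.sch.Opens}
    (hy : y ∈ U₀) (h₀ : IsAffineOpen U₀) (A : Type u) [CommRing A]
    [iA : Algebra Γ(Y.sch, mor (𝟙 Y) ⁻¹ᵁ U₀) A]
    [hA : IsLocalization ((nonvanishing y U₀ hy).map ((mor (𝟙 Y)).app U₀).hom) A] :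
    IsLocalRing A := by
  rw [nonvanishing_eq y U₀ h₀] at hA
  exact @isLocalRing_of_eq_id Γ(Y.sch, U₀) _ ((mor (𝟙 Y)).app U₀).hom
    (congrArg CommRingCat.Hom.hom (Scheme.Hom.id_app (X := Y.sch) U₀))
    (h₀.primeIdealOf ⟨y, hy⟩).asIdeal _ A _ iA hA

lemma toRes_comp_resMap {T T' X Y : NoethSch k} {l : T ⟶ X} {f : X ⟶ Y} {m : T ⟶ T'}
    {g : T' ⟶ Y} (e : l ≫ f = m ≫ g) (U : X.sch.Opens) (W : Y.sch.Opens) (h : U ≤ mor f ⁻¹ᵁ W)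
    (hl : mor l ⁻¹ᵁ U = ⊤) (hg : mor g ⁻¹ᵁ W = ⊤) :
    toRes l U hl ≫ resMap f U W h = m ≫ toRes g W hg := by
  rw [← cancel_mono (resι _ _), Category.assoc, resMap_resι, ← Category.assoc, toRes_resι, e,
    Category.assoc, toRes_resι]

/-- The affine line over `Spec A` is `Spec A[T]`, and affine lines commute with base change. -/
lemma isPullback_specMap_polynomial {X : NoethSch k} (A : Type u) [CommRing A] [Algebra k A]
    [IsNoetherianRing A] (g : specObj k A ⟶ X) :
    ∃ g' : specObj k (Polynomial A) ⟶ affineLine X,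
      IsPullback (mor g') (mor (specMap (Polynomial.CAlgHom (R := k) (A := A))))
        (mor (affineLineProj X)) (mor g) := by
  let e : Spec (CommRingCat.of (Polynomial A)) ≅ 𝔸(PUnit.{u + 1}; Spec (CommRingCat.of A)) :=
    Scheme.Spec.mapIso
      (MvPolynomial.uniqueAlgEquiv A PUnit.{u + 1}).toRingEquiv.toCommRingCatIso.op ≪≫
      (AffineSpace.SpecIso PUnit.{u + 1} (CommRingCat.of A)).symm
  have he : e.hom ≫ (𝔸(PUnit.{u + 1}; Spec (CommRingCat.of A)) ↘ Spec (CommRingCat.of A)) =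
      Spec.map (CommRingCat.ofHom (Polynomial.C (R := A))) := by
    dsimp only [e, Iso.trans_hom, Iso.symm_hom]
    rw [Category.assoc, AffineSpace.SpecIso_inv_over]
    refine (Spec.map_comp _ _).symm.trans (congrArg Spec.map (CommRingCat.hom_ext ?_))
    exact RingHom.ext fun a => (MvPolynomial.uniqueAlgEquiv A PUnit.{u + 1}).commutes a
  have H := AffineSpace.isPullback_map (n := PUnit.{u + 1}) (mor g)
  have H' : IsPullback (e.hom ≫ AffineSpace.map PUnit.{u + 1} (mor g))
      (mor (specMap (Polynomial.CAlgHom (R := k) (A := A))))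
        (mor (affineLineProj X)) (mor g) := by
    refine IsPullback.of_iso H e.symm (Iso.refl _) (Iso.refl _) (Iso.refl _) ?_ ?_ ?_ ?_
    · exact (Category.comp_id _).trans (e.inv_hom_id_assoc _).symm
    · refine (Category.comp_id _).trans ?_
      exact (Iso.eq_inv_comp e).mpr he
    · exact (Category.comp_id _).trans (Category.id_comp _).symm
    · exact (Category.comp_id _).trans (Category.id_comp _).symm
  refine ⟨mkHom _ ?_, H'⟩
  exact (Category.assoc _ _ _).symm.trans ((congrArg (· ≫ X.str) H'.w).trans
    ((Category.assoc _ _ _).trans ((congrArg (_ ≫ ·) (mor_str g)).trans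
      (mor_str (specMap (Polynomial.CAlgHom (R := k) (A := A)))))))

/-! ### Direct images along admissible morphisms and affine lines -/

section DirectImages

variable {V : (NoethSch k)ᵒᵖ ⥤ AddCommGrpCat.{u + 1}} (hV : IsSufficientlyRigid V)

include hV

/-! ### Stalks of direct images along admissible morphisms -/

section Admissible

variable (semilocal : ∀ (A : Type u) [CommRing A] [Algebra k A] [IsNoetherianRing A],
      IsLocalizationOfSmooth k A → Finite (MaximalSpectrum A) →
        IsIso ((toAssocSheaf V).app (op (specObj k A))) ∧
        ∀ i : ℕ, 0 < i → IsZero ((zariskiCohomology V i).obj (op (specObj k A))))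
  {X Y : NoethSch k} {π : X ⟶ Y} (hπ : Admissible π)

omit hV in
lemma Admissible.isSmoothOverExtension (hπ : Admissible π) : IsSmoothOverExtension X := by
  obtain ⟨-, -, L, _, _, s, hs, -, h⟩ := hπ
  refine ⟨L, inferInstance, inferInstance, mor π ≫ s, ?_, h⟩
  rw [IsStructureOver, Category.assoc, hs, mor_str]

omit hV in
lemma Admissible.exists_localization (hπ : Admissible π) (y : Y.sch) :
    ∃ (U₀ : Y.sch.Opens) (_ : y ∈ U₀) (_ : IsAffineOpen U₀) (A : Type u) (_ : CommRing A)
      (_ : Algebra k A) (_ : IsNoetherianRing A) (g : specObj k A ⟶ X),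
      IsLocalizationOfSmooth k A ∧ Finite (MaximalSpectrum A) ∧
        IsProLocal (mor π) (basicNhds y U₀) (mor g) := by
  have := hπ.1
  obtain ⟨U₀, hy, h₀, A, _, _, _, _, hloc, g, hA, hg⟩ :=
    SuffRigid.exists_localization π hπ.isSmoothOverExtension y
  rw [nonvanishing_eq y U₀ h₀] at hloc
  exact ⟨U₀, hy, h₀, A, _, _, _, g, hA, finite_maximalSpectrum_of_isLocalization _
    ((mor π).finite_app U₀ h₀) (h₀.primeIdealOf ⟨y, hy⟩).asIdeal A, hg⟩

include semilocal hπ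

lemma exists_dif_eq_of_admissible (R : InjectiveResolution (assocSheaf V)) {n : ℕ}
    {U : Y.sch.Opens} (b : (Cochains R (n + 4)).obj (op (res X (mor π ⁻¹ᵁ U))))
    (hb : dif R (n + 4) _ b = 0) {y : Y.sch} (hyU : y ∈ U) :
    ∃ (U' : Y.sch.Opens) (h : U' ≤ U), y ∈ U' ∧
      ∃ w, dif R (n + 3) (res X (mor π ⁻¹ᵁ U')) w =
        rst _ (resLE X ((mor π).preimage_mono h)) b := by
  have := hπ.1
  obtain ⟨U₀, hy, h₀, A, _, _, _, g, hA, hfin, hg⟩ := hπ.exists_localization y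
  exact exists_dif_eq_of_isProLocal hg hy h₀ hV R ((semilocal A hA hfin).2 _ n.succ_pos) hyU b hb

/-- On the semi-local localization `V` injects into `𝒱`, so `v` vanishes there; continuity of `V`
spreads this to a neighbourhood of `y`. -/
lemma exists_eq_zero_of_admissible {U : Y.sch.Opens} (v : V.obj (op (res X (mor π ⁻¹ᵁ U))))
    (hv : assoc V _ v = 0) {y : Y.sch} (hyU : y ∈ U) :
    ∃ (U' : Y.sch.Opens) (h : U' ≤ U), y ∈ U' ∧
      rst V (resLE X ((mor π).preimage_mono h)) v = 0 := by
  have := hπ.1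
  obtain ⟨U₀, hy, h₀, A, _, _, _, g, hA, hfin, hg⟩ := hπ.exists_localization y
  have := (semilocal A hA hfin).1
  refine exists_rst_eq_zero_of_isProLocal hg hy h₀ (isColimit_localCone hg hy h₀ hV) hyU v
    (preimage_eq_top_of_isProLocal hg hy h₀ hyU) ?_
  have h := (ConcreteCategory.isIso_iff_bijective _).mp (semilocal A hA hfin).1
  refine h.1 (Eq.trans ?_ (map_zero (assoc V (specObj k A))).symm)
  refine (assoc_rst _ _).trans ?_
  rw [hv, map_zero]

/-- On the semi-local localization `t` comes from `V`, and continuity of `V` extends the preimage to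
a neighbourhood of `y`. By continuity of `𝒱` its image agrees with `t` on a smaller neighbourhood.
-/
lemma exists_assoc_eq_of_admissible {U : Y.sch.Opens}
    (t : (assocSheaf V).obj.obj (op (res X (mor π ⁻¹ᵁ U)))) {y : Y.sch} (hyU : y ∈ U) :
    ∃ (U' : Y.sch.Opens) (h : U' ≤ U), y ∈ U' ∧
      ∃ v, assoc V (res X (mor π ⁻¹ᵁ U')) v = rst _ (resLE X ((mor π).preimage_mono h)) t := by
  have := hπ.1
  obtain ⟨U₀, hy, h₀, A, _, _, _, g, hA, hfin, hg⟩ := hπ.exists_localization y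
  have h := (ConcreteCategory.isIso_iff_bijective _).mp (semilocal A hA hfin).1
  have htop := preimage_eq_top_of_isProLocal hg hy h₀ hyU
  obtain ⟨v, hv⟩ := h.2 (rst _ (toRes g _ htop) t)
  obtain ⟨U₁, hyU₁, hU₁, v', rfl⟩ :=
    exists_rst_eq_of_isProLocal hg hy (isColimit_localCone hg hy h₀ hV) v
  have hyU₂ : y ∈ U ⊓ U₁ := ⟨hyU, hyU₁⟩
  obtain ⟨U', hU', hyU', e⟩ := exists_rst_eq_zero_of_isProLocal hg hy h₀
    (isColimit_localCone_assocSheaf hg hy h₀ hV) hyU₂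
    (rst _ (resLE X ((mor π).preimage_mono inf_le_right)) (assoc V _ v') -
      rst _ (resLE X ((mor π).preimage_mono inf_le_left)) t)
    (preimage_eq_top_of_isProLocal hg hy h₀ hyU₂) (by
      have h1 : ∀ {W W' : X.sch.Opens} (h : W ≤ W') (hW hW'),
          toRes g W hW ≫ resLE X h = toRes g W' hW' := by
        intro W W' h hW hW'
        rw [← cancel_mono (resι _ _), Category.assoc, resLE_resι, toRes_resι, toRes_resι]
      rw [map_sub, rst_comp, rst_comp, h1 _ _ hU₁, h1 _ _ htop, sub_eq_zero, ← hv, ← assoc_rst]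
      rfl)
  refine ⟨U', hU'.trans inf_le_left, hyU',
    rst _ (resLE X ((mor π).preimage_mono (hU'.trans inf_le_right))) v', ?_⟩
  rw [map_sub, rst_comp, rst_comp, resLE_comp, resLE_comp, sub_eq_zero] at e
  rw [assoc_rst, e]

end Admissible

/-! ### Stalks of direct images along affine lines -/

section AffineLine

variable (homotopy : ∀ (A : Type u) [CommRing A] [Algebra k A] [IsNoetherianRing A],
      IsLocalizationOfSmooth k A → IsLocalRing A →
        IsIso ((assocSheaf V).obj.map (specMap (Polynomial.CAlgHom (R := k) (A := A))).op) ∧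
        ∀ i : ℕ, 0 < i → IsZero ((zariskiCohomology V i).obj (op (specObj k (Polynomial A)))))
  {X : NoethSch k} (hX : IsSmoothOverExtension X)

omit hV in
lemma isAffineHom_affineLineProj (X : NoethSch k) : IsAffineHom (mor (affineLineProj X)) :=
  inferInstanceAs (IsAffineHom (𝔸(PUnit.{u + 1}; X.sch) ↘ X.sch))

omit hV in
include hX in
lemma exists_localization_affineLine (x : X.sch) :
    ∃ (U₀ : X.sch.Opens) (_ : x ∈ U₀) (_ : IsAffineOpen U₀) (A : Type u) (_ : CommRing A)
      (_ : Algebra k A) (_ : IsNoetherianRing A) (g : specObj k A ⟶ X)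
      (g' : specObj k (Polynomial A) ⟶ affineLine X),
      IsLocalizationOfSmooth k A ∧ IsLocalRing A ∧
        IsProLocal (mor (𝟙 X)) (basicNhds x U₀) (mor g) ∧
        IsProLocal (mor (affineLineProj X)) (basicNhds x U₀) (mor g') ∧
        g' ≫ affineLineProj X = specMap (Polynomial.CAlgHom (R := k) (A := A)) ≫ g := by
  have : IsAffineHom (mor (𝟙 X)) := inferInstanceAs (IsAffineHom (𝟙 X.sch))
  obtain ⟨U₀, hy, h₀, A, _, _, _, _, hloc, g, hA, hg⟩ := exists_localization (𝟙 X) hX x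
  obtain ⟨g', hg'⟩ := isPullback_specMap_polynomial A g
  exact ⟨U₀, hy, h₀, A, _, _, _, g, g', hA, isLocalRing_of_isLocalization_nonvanishing hy h₀ A, hg,
    IsProLocal.of_isPullback hg hg', isPullback_w hg'⟩

include homotopy hX

lemma exists_dif_eq_of_affineLine (R : InjectiveResolution (assocSheaf V)) {n : ℕ}
    {U : X.sch.Opens}
    (b : (Cochains R (n + 4)).obj (op (res (affineLine X) (mor (affineLineProj X) ⁻¹ᵁ U))))
    (hb : dif R (n + 4) _ b = 0) {x : X.sch} (hxU : x ∈ U) :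
    ∃ (U' : X.sch.Opens) (h : U' ≤ U), x ∈ U' ∧
      ∃ w, dif R (n + 3) (res (affineLine X) (mor (affineLineProj X) ⁻¹ᵁ U')) w =
        rst _ (resLE (affineLine X) ((mor (affineLineProj X)).preimage_mono h)) b := by
  have := isAffineHom_affineLineProj X
  obtain ⟨U₀, hy, h₀, A, _, _, _, g, g', hA, hA', hg, hg', -⟩ := exists_localization_affineLine hX x
  exact exists_dif_eq_of_isProLocal hg' hy h₀ hV R ((homotopy A hA hA').2 _ n.succ_pos) hxU b hb

/-- Over the local ring `A` at `x`, the section `t` is the pullback of a section over `Spec A`.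
Continuity of `𝒱` on `X` spreads that section out, and continuity on the affine line makes its
pullback agree with `t` over a smaller neighbourhood. -/
lemma exists_rst_eq_of_affineLine {U : X.sch.Opens} (t : (assocSheaf V).obj.obj
      (op (res (affineLine X) (mor (affineLineProj X) ⁻¹ᵁ U)))) {x : X.sch} (hxU : x ∈ U) :
    ∃ (U' : X.sch.Opens) (h : U' ≤ U), x ∈ U' ∧
      ∃ s, rst _ (resMap (affineLineProj X) _ U' le_rfl) s =
        rst _ (resLE (affineLine X) ((mor (affineLineProj X)).preimage_mono h)) t := by
  have := isAffineHom_affineLineProj X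
  have : IsAffineHom (mor (𝟙 X)) := inferInstanceAs (IsAffineHom (𝟙 X.sch))
  obtain ⟨U₀, hy, h₀, A, _, _, _, g, g', hA, hA', hg, hg', e⟩ := exists_localization_affineLine hX x
  have h := (ConcreteCategory.isIso_iff_bijective _).mp (homotopy A hA hA').1
  have htop := preimage_eq_top_of_isProLocal hg' hy h₀ hxU
  obtain ⟨s, hs⟩ := h.2 (rst _ (toRes g' _ htop) t)
  obtain ⟨U₁, hxU₁, hU₁, s, rfl⟩ :=
    exists_rst_eq_of_isProLocal hg hy (isColimit_localCone_assocSheaf hg hy h₀ hV) s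
  change (assocSheaf V).obj.obj (op (res X U₁)) at s
  have hxU₂ : x ∈ U ⊓ U₁ := ⟨hxU, hxU₁⟩
  obtain ⟨U', hU', hxU', e⟩ := exists_rst_eq_zero_of_isProLocal hg' hy h₀
    (isColimit_localCone_assocSheaf hg' hy h₀ hV) hxU₂
    (rst _ (resMap (affineLineProj X) _ U₁
        ((mor (affineLineProj X)).preimage_mono inf_le_right)) s -
      rst _ (resLE (affineLine X) ((mor (affineLineProj X)).preimage_mono inf_le_left)) t)
    (preimage_eq_top_of_isProLocal hg' hy h₀ hxU₂) (by
      rw [map_sub, rst_comp, rst_comp, sub_eq_zero]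
      refine Eq.trans ?_ (hs.trans ?_)
      · refine Eq.trans ?_ (rst_comp _ _ _ _).symm
        exact congrArg (fun l => rst (assocSheaf V).obj l s)
          (toRes_comp_resMap e _ U₁ _ (preimage_eq_top_of_isProLocal hg' hy h₀ hxU₂) hU₁)
      · refine congrArg (fun l => rst _ l t) ?_
        rw [← cancel_mono (resι _ _), Category.assoc, resLE_resι, toRes_resι, toRes_resι])
  refine ⟨U', hU'.trans inf_le_left, hxU', rst _ (resLE X (hU'.trans inf_le_right)) s, ?_⟩
  rw [map_sub, rst_comp, rst_comp, resLE_comp, sub_eq_zero] at e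
  rw [← e, rst_comp, resLE_resMap, resMap_resLE]

end AffineLine

end DirectImages

/-! ### Homotopy invariance -/

section Homotopy

/-- A morphism as a cone over a constant system. -/
def constCone {X Y : NoethSch k} (f : X ⟶ Y) : Cone (Functor.fromPUnit.{0} Y) where
  pt := X
  π.app _ := f
  π.naturality _ _ _ := (Category.id_comp f).trans (Category.comp_id f).symm

/-- For a constant system there is no later level to pass to: surjectivity of `f` lets inclusions of
preimages descend, and injectivity on sections of `F` is required outright. -/
lemma coneExact_constCone {F : Sheaf (zariskiTopology k) AddCommGrpCat.{u + 1}}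
    (R : InjectiveResolution F) {X Y : NoethSch k} {f : X ⟶ Y}
    (hf : Function.Surjective (mor f))
    (hinj : ∀ (A : Y.sch.Opens) (s : F.obj.obj (op (res Y A))),
      rst _ (resMap f _ A le_rfl) s = 0 → s = 0)
    (hsurj : ∀ (m : ℕ) (A : Y.sch.Opens)
      (b : (Cochains R (m + 3)).obj (op (res X (mor f ⁻¹ᵁ A)))), dif R (m + 3) _ b = 0 → ∀ y ∈ A,
      ∃ (U : Y.sch.Opens) (hU : U ≤ A) (_ : y ∈ U)
        (a' : (Cochains R (m + 3)).obj (op (res Y U)))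
        (b' : (Cochains R (m + 2)).obj (op (res X (mor f ⁻¹ᵁ U)))), dif R (m + 3) _ a' = 0 ∧
        rst _ (resLE X ((mor f).preimage_mono hU)) b =
          rst _ (resMap f _ U le_rfl) a' - dif R (m + 2) _ b') (m : ℕ) :
    ConeExact R (constCone f) m := by
  refine coneExact R (constCone f) (fun i A B h => ⟨i, 𝟙 i, fun x hx => ?_⟩) ?_ ?_ m
  · obtain ⟨z, rfl⟩ := hf x
    exact h hx
  · intro i A N hN s hs x hx
    subst hN
    refine ⟨i, 𝟙 i, A, le_rfl, hx, ?_⟩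
    exact (congrArg _ (hinj A s hs)).trans (map_zero _)
  · intro m i A N hN b hb x hx
    subst hN
    obtain ⟨U, hU, hxU, a', b', h1, h2⟩ := hsurj m A b hb _ hx
    exact ⟨i, 𝟙 i, U, hU, _, rfl, hxU, (mor f).preimage_mono hU, a', b', h1, h2⟩

lemma surjective_affineLineProj (X : NoethSch k) :
    Function.Surjective (mor (affineLineProj X)) :=
  (inferInstance : Surjective (𝔸(PUnit.{u + 1}; X.sch) ↘ X.sch)).surj

/-- The zero section of the affine line. -/
def zeroSection (X : NoethSch k) : X ⟶ affineLine X :=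
  mkHom (AffineSpace.homOfVector (𝟙 X.sch) fun _ => 0)
    ((Category.assoc _ _ _).symm.trans ((congrArg (· ≫ X.str)
      (AffineSpace.homOfVector_over (𝟙 X.sch) _)).trans (Category.id_comp _)))

lemma zeroSection_affineLineProj (X : NoethSch k) : zeroSection X ≫ affineLineProj X = 𝟙 X :=
  mor_injective (AffineSpace.homOfVector_over (𝟙 X.sch) _)

variable {V : (NoethSch k)ᵒᵖ ⥤ AddCommGrpCat.{u + 1}} (hV : IsSufficientlyRigid V)
  (homotopy : ∀ (A : Type u) [CommRing A] [Algebra k A] [IsNoetherianRing A],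
      IsLocalizationOfSmooth k A → IsLocalRing A →
        IsIso ((assocSheaf V).obj.map (specMap (Polynomial.CAlgHom (R := k) (A := A))).op) ∧
        ∀ i : ℕ, 0 < i → IsZero ((zariskiCohomology V i).obj (op (specObj k (Polynomial A)))))
  {X : NoethSch k} (hX : IsSmoothOverExtension X)

include hV homotopy hX

/-- Sections of `𝒱` inject because the zero section splits the projection. Surjectivity on sections
and vanishing of higher direct images come from the local rings of `X`. -/
lemma coneExact_affineLine (R : InjectiveResolution (assocSheaf V)) (m : ℕ) :
    ConeExact R (constCone (affineLineProj X)) m := by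
  refine coneExact_constCone R (surjective_affineLineProj X) ?_ ?_ m
  · intro A s hs
    have hA : A ≤ mor (zeroSection X) ⁻¹ᵁ mor (affineLineProj X) ⁻¹ᵁ A := by
      change A ≤ mor (zeroSection X ≫ affineLineProj X) ⁻¹ᵁ A
      rw [zeroSection_affineLineProj]
      exact le_rfl
    have h := congrArg (rst (assocSheaf V).obj (resMap (zeroSection X) A _ hA)) hs
    rw [map_zero, rst_comp, resMap_comp] at h
    refine Eq.trans ?_ h
    rw [resMap_congr (zeroSection_affineLineProj X), resMap_id, rst_id]
  · intro m A b hb x hx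
    match m with
    | 0 =>
      obtain ⟨t, rfl⟩ := exists_aug_eq R b hb
      obtain ⟨U, hU, hxU, s, hs⟩ := exists_rst_eq_of_affineLine hV homotopy hX t hx
      refine ⟨U, hU, hxU, aug R _ s, 0, dif_aug R _ _, ?_⟩
      rw [map_zero, sub_zero, ← aug_rst, ← hs, aug_rst]
    | m + 1 =>
      obtain ⟨U, hU, hxU, w, hw⟩ := exists_dif_eq_of_affineLine hV homotopy hX R b hb hx
      refine ⟨U, hU, hxU, 0, -w, map_zero _, ?_⟩
      rw [map_zero, map_neg, zero_sub, neg_neg, ← hw]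

/-- Homotopy invariance of Zariski cohomology. -/
theorem isIso_zariskiCohomology_map_affineLineProj (n : ℕ) :
    IsIso ((zariskiCohomology V n).map (affineLineProj X).op) := by
  obtain ⟨R⟩ := HasInjectiveResolution.out (Z := assocSheaf V)
  have h := coneExact_affineLine hV homotopy hX R
  rw [ConcreteCategory.isIso_iff_bijective]
  constructor
  · refine (injective_iff_map_eq_zero (rst (zariskiCohomology V n) (affineLineProj X))).mpr ?_
    intro α hα
    obtain ⟨j, f, hf⟩ := exists_rst_eq_zero_of_coneExact h (i := ⟨⟨⟩⟩) α hα
    exact (rst_id _ α).symm.trans hf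
  · intro β
    obtain ⟨i, α, hα⟩ := exists_rst_eq_of_coneExact h β
    exact ⟨α, hα⟩

end Homotopy

/-! ### Injectivity of direct images -/

section Stalk

variable {P : Type u} [Preorder P]

/-- The inclusion of a subset of a preordered set, as a functor. -/
def inclFunctor (N : Set P) : N ⥤ P where
  obj U := U.1
  map h := homOfLE (leOfHom h)

/-- The colimit of the sections of a presheaf on a preordered set over a subset. -/
def stalkAt (A : Pᵒᵖ ⥤ AddCommGrpCat.{u + 1}) (N : Set P) : AddCommGrpCat.{u + 1} :=
  haveI : HasColimitsOfSize.{u, u} AddCommGrpCat.{u + 1} :=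
    hasColimitsOfSizeShrink.{u, u, u + 1, u + 1} _
  colimit ((inclFunctor N).op ⋙ A)

/-- The germ of a section. -/
def germAt (A : Pᵒᵖ ⥤ AddCommGrpCat.{u + 1}) {N : Set P} {U : P} (hU : U ∈ N) :
    A.obj (op U) →+ stalkAt A N :=
  haveI : HasColimitsOfSize.{u, u} AddCommGrpCat.{u + 1} :=
    hasColimitsOfSizeShrink.{u, u, u + 1, u + 1} _
  (colimit.ι ((inclFunctor N).op ⋙ A) (op ⟨U, hU⟩)).hom

variable {A B C : Pᵒᵖ ⥤ AddCommGrpCat.{u + 1}} {N N' N'' : Set P}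

lemma germAt_map {U U' : P} (hU : U ∈ N) (hU' : U' ∈ N) (h : U ≤ U') (a : A.obj (op U')) :
    germAt A hU ((A.map (homOfLE h).op).hom a) = germAt A hU' a := by
  have : HasColimitsOfSize.{u, u} AddCommGrpCat.{u + 1} :=
    hasColimitsOfSizeShrink.{u, u, u + 1, u + 1} _
  exact congr($(colimit.w ((inclFunctor N).op ⋙ A)
    (show op (⟨U', hU'⟩ : N) ⟶ op ⟨U, hU⟩ from (homOfLE h).op)) a)

/-- Maps from stalks. -/
def stalkDesc {M : AddCommGrpCat.{u + 1}} (φ : ∀ U ∈ N, A.obj (op U) →+ M)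
    (hφ : ∀ (U U' : P) (hU : U ∈ N) (hU' : U' ∈ N) (h : U ≤ U') (a : A.obj (op U')),
      φ U hU ((A.map (homOfLE h).op).hom a) = φ U' hU' a) : stalkAt A N →+ M :=
  haveI : HasColimitsOfSize.{u, u} AddCommGrpCat.{u + 1} :=
    hasColimitsOfSizeShrink.{u, u, u + 1, u + 1} _
  (colimit.desc ((inclFunctor N).op ⋙ A)
    { pt := M
      ι.app U := AddCommGrpCat.ofHom (φ U.unop.1 U.unop.2)
      ι.naturality U U' h := by
        ext a
        exact hφ _ _ U'.unop.2 U.unop.2 (leOfHom h.unop) a }).hom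

lemma stalkDesc_germAt {M : AddCommGrpCat.{u + 1}} (φ : ∀ U ∈ N, A.obj (op U) →+ M)
    (hφ : ∀ (U U' : P) (hU : U ∈ N) (hU' : U' ∈ N) (h : U ≤ U') (a : A.obj (op U')),
      φ U hU ((A.map (homOfLE h).op).hom a) = φ U' hU' a) {U : P} (hU : U ∈ N)
    (a : A.obj (op U)) : stalkDesc φ hφ (germAt A hU a) = φ U hU a := by
  have : HasColimitsOfSize.{u, u} AddCommGrpCat.{u + 1} :=
    hasColimitsOfSizeShrink.{u, u, u + 1, u + 1} _
  exact DFunLike.congr_fun (congrArg AddCommGrpCat.Hom.hom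
    (colimit.ι_desc (F := (inclFunctor N).op ⋙ A) _ (op (⟨U, hU⟩ : N)))) a

lemma stalk_hom_ext {M : AddCommGrpCat.{u + 1}} {φ ψ : stalkAt A N →+ M}
    (h : ∀ (U : P) (hU : U ∈ N) (a : A.obj (op U)), φ (germAt A hU a) = ψ (germAt A hU a)) :
    φ = ψ := by
  have : HasColimitsOfSize.{u, u} AddCommGrpCat.{u + 1} :=
    hasColimitsOfSizeShrink.{u, u, u + 1, u + 1} _
  have : AddCommGrpCat.ofHom φ = AddCommGrpCat.ofHom ψ :=
    colimit.hom_ext fun U => by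
      ext a
      exact h _ U.unop.2 a
  exact AddCommGrpCat.ofHom_injective this

/-- Stalks are functorial in the subset. -/
def stalkMap (h : N ⊆ N') : stalkAt A N →+ stalkAt A N' :=
  stalkDesc (fun _ hU => germAt A (h hU)) fun _ _ _ _ hle a => germAt_map _ _ hle a

lemma stalkMap_germAt (h : N ⊆ N') {U : P} (hU : U ∈ N) (a : A.obj (op U)) :
    stalkMap h (germAt A hU a) = germAt A (h hU) a :=
  stalkDesc_germAt _ _ hU a

/-- Stalks are functorial in the presheaf. -/
def stalkFunct (i : A ⟶ B) (N : Set P) : stalkAt A N →+ stalkAt B N :=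
  stalkDesc (fun _ hU => (germAt B hU).comp (i.app _).hom) fun U U' hU hU' hle a => by
    rw [AddMonoidHom.comp_apply, AddMonoidHom.comp_apply, ← germAt_map hU hU' hle]
    exact congrArg _ congr($(i.naturality (homOfLE hle).op) a)

lemma stalkFunct_germAt (i : A ⟶ B) {U : P} (hU : U ∈ N) (a : A.obj (op U)) :
    stalkFunct i N (germAt A hU a) = germAt B hU ((i.app (op U)).hom a) :=
  stalkDesc_germAt _ _ hU a

/-- Exactness of filtered colimits: a germ that dies in `B` dies over a smaller member of `N`, where
`i` is injective. -/
lemma stalkFunct_injective (i : A ⟶ B) (hi : ∀ U, Function.Injective (i.app U).hom)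
    (hN : ∃ U, U ∈ N) (hN' : ∀ U ∈ N, ∀ U' ∈ N, ∃ U'' ∈ N, U'' ≤ U ∧ U'' ≤ U') :
    Function.Injective (stalkFunct i N) := by
  have : HasColimitsOfSize.{u, u} AddCommGrpCat.{u + 1} :=
    hasColimitsOfSizeShrink.{u, u, u + 1, u + 1} _
  have : Nonempty N := ⟨⟨_, hN.choose_spec⟩⟩
  have : IsCodirectedOrder N := ⟨fun a b => by
    obtain ⟨c, hc, h1, h2⟩ := hN' _ a.2 _ b.2
    exact ⟨⟨c, hc⟩, h1, h2⟩⟩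
  refine (injective_iff_map_eq_zero _).mpr fun x hx => ?_
  obtain ⟨U, a, rfl⟩ := Concrete.isColimit_exists_rep _
    (colimit.isColimit ((inclFunctor N).op ⋙ A)) x
  have h1 : germAt B U.unop.2 ((i.app (op U.unop.1)).hom a) = 0 :=
    (stalkFunct_germAt i U.unop.2 a).symm.trans hx
  obtain ⟨U', f, g, e⟩ := Concrete.isColimit_exists_of_rep_eq _
    (colimit.isColimit ((inclFunctor N).op ⋙ B)) (i := U) (j := U) _ 0
    (h1.trans (map_zero (germAt B U.unop.2)).symm)
  have hU : U'.unop.1 ≤ U.unop.1 := leOfHom f.unop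
  have h2 : (B.map (homOfLE hU).op).hom ((i.app (op U.unop.1)).hom a) = 0 :=
    Eq.trans e (map_zero (B.map (homOfLE hU).op).hom)
  have h3 : (A.map (homOfLE hU).op).hom a = 0 := by
    apply hi
    rw [map_zero, ← h2]
    exact congr($(i.naturality (homOfLE hU).op) a)
  have h4 := germAt_map (A := A) U'.unop.2 U.unop.2 hU a
  rw [h3, map_zero] at h4
  exact h4.symm

end Stalk

/-! ### Direct images and their exact left adjoint -/

section DirectImage

/-- The direct image of a presheaf under a morphism, on the open subsets of the target. -/
def directImage (F : (NoethSch k)ᵒᵖ ⥤ AddCommGrpCat.{u + 1}) {Z Y : NoethSch k} (f : Z ⟶ Y) :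
    Y.sch.Opensᵒᵖ ⥤ AddCommGrpCat.{u + 1} where
  obj U := F.obj (op (res Z (mor f ⁻¹ᵁ U.unop)))
  map h := F.map (resLE Z ((mor f).preimage_mono (leOfHom h.unop))).op
  map_id U := by
    refine Eq.trans ?_ (F.map_id _)
    exact congrArg (fun l => F.map (Quiver.Hom.op l)) (resLE_refl Z (le_refl (mor f ⁻¹ᵁ U.unop)))
  map_comp {U U' U''} h h' := by
    rw [← F.map_comp, ← op_comp]
    exact congrArg (fun l => F.map (Quiver.Hom.op l)) (resLE_comp Z _ _).symm

/-- The map of direct images that is induced by a map of presheaves. -/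
def directImageMap {F G : (NoethSch k)ᵒᵖ ⥤ AddCommGrpCat.{u + 1}} (α : F ⟶ G) {Z Y : NoethSch k}
    (f : Z ⟶ Y) : directImage F f ⟶ directImage G f where
  app U := α.app (op (res Z (mor f ⁻¹ᵁ U.unop)))
  naturality _ _ h := α.naturality (resLE Z ((mor f).preimage_mono (leOfHom h.unop))).op

variable {Z Y : NoethSch k} (f : Z ⟶ Y) (A B : Y.sch.Opensᵒᵖ ⥤ AddCommGrpCat.{u + 1})

/-- The open subsets of the target that contain the image of a scheme over the source. -/
def nhdsOfImage {T : NoethSch k} (l : T ⟶ Z) : Set Y.sch.Opens :=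
  {U | mor l ⁻¹ᵁ mor f ⁻¹ᵁ U = ⊤}

lemma nhdsOfImage_mono {T T' : NoethSch k} (r : T' ⟶ T) (l : T ⟶ Z) :
    nhdsOfImage f l ⊆ nhdsOfImage f (r ≫ l) := by
  intro U hU
  have hU' : mor l ⁻¹ᵁ mor f ⁻¹ᵁ U = ⊤ := hU
  change mor r ⁻¹ᵁ mor l ⁻¹ᵁ mor f ⁻¹ᵁ U = ⊤
  rw [hU']
  rfl

open scoped DirectSum

open Classical in
/-- The section over `T` that is defined by a morphism `l : T ⟶ Z` and a section `a` on a
neighbourhood `U` of the image of `T`. -/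
def pullbackSection {T : NoethSch k} (l : T ⟶ Z) {U : Y.sch.Opens} (hU : U ∈ nhdsOfImage f l) :
    A.obj (op U) →+ ⨁ l : T ⟶ Z, stalkAt A (nhdsOfImage f l) :=
  (DirectSum.of (fun l : T ⟶ Z => stalkAt A (nhdsOfImage f l)) l).comp (germAt A hU)

open Classical in
lemma extendByZero_hom_ext {T : NoethSch k} {M : AddCommGrpCat.{u + 1}}
    {φ ψ : (⨁ l : T ⟶ Z, stalkAt A (nhdsOfImage f l)) →+ M}
    (h : ∀ (l : T ⟶ Z) (U : Y.sch.Opens) (hU : U ∈ nhdsOfImage f l) (a : A.obj (op U)),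
      φ (pullbackSection f A l hU a) = ψ (pullbackSection f A l hU a)) : φ = ψ :=
  DirectSum.addHom_ext' fun l => stalk_hom_ext fun U hU a => h l U hU a

open Classical in
/-- Restriction for the inverse image of a presheaf, extended by zero. -/
def extendByZeroMap {T T' : NoethSch k} (r : T' ⟶ T) :
    (⨁ l : T ⟶ Z, stalkAt A (nhdsOfImage f l)) →+ ⨁ l : T' ⟶ Z, stalkAt A (nhdsOfImage f l) :=
  DirectSum.toAddMonoid fun l =>
    (DirectSum.of (fun l : T' ⟶ Z => stalkAt A (nhdsOfImage f l)) (r ≫ l)).comp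
      (stalkMap (nhdsOfImage_mono f r l))

lemma extendByZeroMap_pullbackSection {T T' : NoethSch k} (r : T' ⟶ T) (l : T ⟶ Z)
    {U : Y.sch.Opens} (hU : U ∈ nhdsOfImage f l) (a : A.obj (op U)) :
    extendByZeroMap f A r (pullbackSection f A l hU a) =
      pullbackSection f A (r ≫ l) (nhdsOfImage_mono f r l hU) a := by
  classical
  refine (DirectSum.toAddMonoid_of _ l _).trans ?_
  exact congrArg (DirectSum.of (fun l : T' ⟶ Z => stalkAt A (nhdsOfImage f l)) (r ≫ l))
    (stalkMap_germAt _ hU a)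

lemma pullbackSection_congr {T : NoethSch k} {l l' : T ⟶ Z} (e : l = l') {U : Y.sch.Opens}
    (hU : U ∈ nhdsOfImage f l) (hU' : U ∈ nhdsOfImage f l') (a : A.obj (op U)) :
    pullbackSection f A l hU a = pullbackSection f A l' hU' a := by
  subst e; rfl

lemma pullbackSection_map {T : NoethSch k} (l : T ⟶ Z) {U U' : Y.sch.Opens}
    (hU : U ∈ nhdsOfImage f l) (hU' : U' ∈ nhdsOfImage f l) (h : U ≤ U') (a : A.obj (op U')) :
    pullbackSection f A l hU ((A.map (homOfLE h).op).hom a) = pullbackSection f A l hU' a := by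
  classical
  exact congrArg (DirectSum.of (fun l : T ⟶ Z => stalkAt A (nhdsOfImage f l)) l)
    (germAt_map hU hU' h a)

/-- The inverse image of a presheaf, extended by zero. -/
def extendByZero : (NoethSch k)ᵒᵖ ⥤ AddCommGrpCat.{u + 1} where
  -- This is the left Kan extension along `U ↦ f⁻¹ U`: a map from `T` to `f⁻¹ U` is a map `l : T ⟶
  -- Z` with `U` in `nhdsOfImage f l`, and for fixed `l` these `U` form a filtered system.
  obj T := AddCommGrpCat.of (⨁ l : T.unop ⟶ Z, stalkAt A (nhdsOfImage f l))
  map r := AddCommGrpCat.ofHom (extendByZeroMap f A r.unop)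
  map_id T := by
    refine AddCommGrpCat.hom_ext (extendByZero_hom_ext f A fun l U hU a => ?_)
    refine (extendByZeroMap_pullbackSection f A _ l hU a).trans ?_
    exact pullbackSection_congr f A (Category.id_comp l) _ _ _
  map_comp {T T' T''} r r' := by
    refine AddCommGrpCat.hom_ext (extendByZero_hom_ext f A fun l U hU a => ?_)
    refine (extendByZeroMap_pullbackSection f A _ l hU a).trans (Eq.symm ?_)
    refine (congrArg (extendByZeroMap f A r'.unop)
      (extendByZeroMap_pullbackSection f A r.unop l hU a)).trans ?_
    refine (extendByZeroMap_pullbackSection f A _ _ _ a).trans ?_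
    exact pullbackSection_congr f A (Category.assoc _ _ _).symm _ _ _

variable {A B}

open Classical in
/-- The map of inverse images that is induced by a map of presheaves, on sections. -/
def extendByZeroApp (i : A ⟶ B) (T : NoethSch k) :
    (⨁ l : T ⟶ Z, stalkAt A (nhdsOfImage f l)) →+ ⨁ l : T ⟶ Z, stalkAt B (nhdsOfImage f l) :=
  DirectSum.map fun l => stalkFunct i (nhdsOfImage f l)

lemma extendByZeroApp_pullbackSection (i : A ⟶ B) {T : NoethSch k} (l : T ⟶ Z)
    {U : Y.sch.Opens} (hU : U ∈ nhdsOfImage f l) (a : A.obj (op U)) :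
    extendByZeroApp f i T (pullbackSection f A l hU a) =
      pullbackSection f B l hU ((i.app (op U)).hom a) := by
  classical
  refine (DirectSum.map_of _ l _).trans ?_
  exact congrArg (DirectSum.of (fun l : T ⟶ Z => stalkAt B (nhdsOfImage f l)) l)
    (stalkFunct_germAt i hU a)

/-- The map of inverse images that is induced by a map of presheaves. -/
def extendByZeroFunct (i : A ⟶ B) : extendByZero f A ⟶ extendByZero f B where
  app T := AddCommGrpCat.ofHom (extendByZeroApp f i T.unop)
  naturality T T' r := by
    refine AddCommGrpCat.hom_ext (extendByZero_hom_ext f A fun l U hU a => ?_)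
    refine (congrArg (extendByZeroApp f i T'.unop)
      (extendByZeroMap_pullbackSection f A r.unop l hU a)).trans ?_
    refine (extendByZeroApp_pullbackSection f i _ _ a).trans (Eq.symm ?_)
    refine (congrArg (extendByZeroMap f B r.unop)
      (extendByZeroApp_pullbackSection f i l hU a)).trans ?_
    exact extendByZeroMap_pullbackSection f B r.unop l hU _

lemma extendByZeroApp_injective (i : A ⟶ B) (hi : ∀ U, Function.Injective (i.app U).hom)
    (T : NoethSch k) : Function.Injective (extendByZeroApp f i T) := by
  classical
  refine (DirectSum.map_injective _).mpr fun l => stalkFunct_injective i hi ⟨⊤, rfl⟩ ?_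
  refine fun U hU U' hU' => ⟨U ⊓ U', ?_, inf_le_left, inf_le_right⟩
  have h : mor l ⁻¹ᵁ mor f ⁻¹ᵁ U = ⊤ := hU
  have h' : mor l ⁻¹ᵁ mor f ⁻¹ᵁ U' = ⊤ := hU'
  change mor l ⁻¹ᵁ mor f ⁻¹ᵁ (U ⊓ U') = ⊤
  rw [Scheme.Hom.preimage_inf, Scheme.Hom.preimage_inf, h, h', inf_top_eq]

variable {J : (NoethSch k)ᵒᵖ ⥤ AddCommGrpCat.{u + 1}}

lemma toRes_resLE {T X : NoethSch k} (l : T ⟶ X) {U U' : X.sch.Opens} (h : U ≤ U')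
    (hU : mor l ⁻¹ᵁ U = ⊤) (hU' : mor l ⁻¹ᵁ U' = ⊤) :
    toRes l U hU ≫ resLE X h = toRes l U' hU' := by
  rw [← cancel_mono (resι _ _), Category.assoc, resLE_resι, toRes_resι, toRes_resι]

lemma comp_toRes {T T' X : NoethSch k} (r : T' ⟶ T) (l : T ⟶ X) (U : X.sch.Opens)
    (hU : mor l ⁻¹ᵁ U = ⊤) (hU' : mor (r ≫ l) ⁻¹ᵁ U = ⊤) :
    r ≫ toRes l U hU = toRes (r ≫ l) U hU' := by
  rw [← cancel_mono (resι _ _), Category.assoc, toRes_resι, toRes_resι]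

open Classical in
/-- The map from the inverse image that corresponds to a map to a direct image, on sections. -/
def extendByZeroDescApp (φ : A ⟶ directImage J f) (T : NoethSch k) :
    (⨁ l : T ⟶ Z, stalkAt A (nhdsOfImage f l)) →+ J.obj (op T) :=
  DirectSum.toAddMonoid fun l => stalkDesc (M := J.obj (op T))
    (fun U hU => (rst J (toRes l (mor f ⁻¹ᵁ U) hU)).comp (φ.app (op U)).hom) (by
      intro U U' hU hU' h a
      refine Eq.trans ?_ (congrArg (fun g => rst J g ((φ.app (op U')).hom a))
        (toRes_resLE l ((mor f).preimage_mono h) hU hU'))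
      refine Eq.trans ?_ (rst_comp J _ _ _)
      exact congrArg (rst J (toRes l (mor f ⁻¹ᵁ U) hU)) congr($(φ.naturality (homOfLE h).op) a))

lemma extendByZeroDescApp_pullbackSection (φ : A ⟶ directImage J f) {T : NoethSch k} (l : T ⟶ Z)
    {U : Y.sch.Opens} (hU : U ∈ nhdsOfImage f l) (a : A.obj (op U)) :
    extendByZeroDescApp f φ T (pullbackSection f A l hU a) =
      rst J (toRes l (mor f ⁻¹ᵁ U) hU) ((φ.app (op U)).hom a) := by
  classical
  refine (DirectSum.toAddMonoid_of _ l _).trans ?_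
  exact stalkDesc_germAt (M := J.obj (op T)) _ _ hU a

/-- The map from the inverse image that corresponds to a map to a direct image. -/
def extendByZeroDesc (φ : A ⟶ directImage J f) : extendByZero f A ⟶ J where
  app T := AddCommGrpCat.ofHom (extendByZeroDescApp f φ T.unop)
  naturality T T' r := by
    refine AddCommGrpCat.hom_ext (extendByZero_hom_ext f A fun l U hU a => ?_)
    refine (congrArg (extendByZeroDescApp f φ T'.unop)
      (extendByZeroMap_pullbackSection f A r.unop l hU a)).trans ?_
    refine (extendByZeroDescApp_pullbackSection f φ _ _ a).trans (Eq.symm ?_)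
    refine (congrArg (rst J r.unop) (extendByZeroDescApp_pullbackSection f φ l hU a)).trans ?_
    refine (rst_comp J _ _ _).trans ?_
    exact congrArg (fun g => rst J g ((φ.app (op U)).hom a)) (comp_toRes _ _ _ _ _)

/-- The map to the direct image of the inverse image. -/
def toExtendByZero (A : Y.sch.Opensᵒᵖ ⥤ AddCommGrpCat.{u + 1}) :
    A ⟶ directImage (extendByZero f A) f where
  app U := AddCommGrpCat.ofHom (pullbackSection f A (resι Z (mor f ⁻¹ᵁ U.unop))
    (by exact (Scheme.Opens.ι_preimage_self _)))
  naturality U U' h := by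
    ext a
    refine Eq.trans ?_ (extendByZeroMap_pullbackSection f A _ _ _ a).symm
    refine Eq.trans (pullbackSection_map f A _ _ ?_ (leOfHom h.unop) a) ?_
    · exact top_le_iff.mp ((Scheme.Opens.ι_preimage_self (mor f ⁻¹ᵁ U'.unop)).ge.trans
        ((mor (resι Z (mor f ⁻¹ᵁ U'.unop))).preimage_mono
          ((mor f).preimage_mono (leOfHom h.unop))))
    · exact pullbackSection_congr f A (resLE_resι _ _).symm _ _ _

/-- Direct images of injective sheaves have the extension property of injective objects. -/
lemma exists_comp_eq_of_injective (J : Sheaf (zariskiTopology k) AddCommGrpCat.{u + 1})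
    [Injective J] (i : A ⟶ B) (hi : ∀ U, Function.Injective (i.app U).hom)
    (φ : A ⟶ directImage J.obj f) : ∃ ψ, i ≫ ψ = φ := by
  -- Sheafification preserves monomorphisms, so an injective sheaf is injective as a presheaf.
  have : Injective J.obj := Injective.injective_of_adjoint
    (sheafificationAdjunction (zariskiTopology k) AddCommGrpCat.{u + 1}) J
  have : Mono (extendByZeroFunct f i) := by
    have : ∀ T, Mono ((extendByZeroFunct f i).app T) := fun T =>
      (AddCommGrpCat.mono_iff_injective _).mpr (extendByZeroApp_injective f i hi T.unop)
    exact NatTrans.mono_of_mono_app _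
  let ψ := Injective.factorThru (extendByZeroDesc f φ) (extendByZeroFunct f i)
  have hψ : extendByZeroFunct f i ≫ ψ = extendByZeroDesc f φ := Injective.comp_factorThru _ _
  refine ⟨toExtendByZero f B ≫ directImageMap ψ f, ?_⟩
  ext U a
  have hU' : U.unop ∈ nhdsOfImage f (resι Z (mor f ⁻¹ᵁ U.unop)) :=
    Scheme.Opens.ι_preimage_self _
  refine (congrArg (ψ.app _).hom
    (extendByZeroApp_pullbackSection f i (resι Z (mor f ⁻¹ᵁ U.unop)) hU' a)).symm.trans ?_
  refine (DFunLike.congr_fun (congrArg (fun l => (l.app (op (res Z (mor f ⁻¹ᵁ U.unop)))).hom) hψ)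
    (pullbackSection f A (resι Z (mor f ⁻¹ᵁ U.unop)) hU' a)).trans ?_
  refine (extendByZeroDescApp_pullbackSection f φ _ _ a).trans ?_
  refine Eq.trans (congrArg (fun g => rst J.obj g ((φ.app U).hom a)) ?_) (rst_id J.obj _)
  exact (cancel_mono (resι _ _)).mp ((toRes_resι _ _ hU').trans (Category.id_comp _).symm)

/-- A map to the direct image of an injective sheaf that vanishes on the kernel of a map of
presheaves extends along this map. -/
lemma exists_comp_eq_of_injective_of_ker
    (J : Sheaf (zariskiTopology k) AddCommGrpCat.{u + 1}) [Injective J] (h : A ⟶ B)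
    (φ : A ⟶ directImage J.obj f)
    (hφ : ∀ U (a : A.obj U), (h.app U).hom a = 0 → (φ.app U).hom a = 0) : ∃ ψ, h ≫ ψ = φ := by
  have h0 : kernel.ι h ≫ φ = 0 := by
    ext U a
    exact hφ U _ congr(($(kernel.condition h)).app U a)
  have hi : ∀ U, Function.Injective ((Abelian.factorThruCoimage h).app U).hom := fun U =>
    (AddCommGrpCat.mono_iff_injective _).mp inferInstance
  -- Modulo the kernel of `h`, the map `h` becomes injective and `φ` is still defined.
  obtain ⟨ψ, hψ⟩ := exists_comp_eq_of_injective f J (Abelian.factorThruCoimage h) hi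
    (cokernel.desc (kernel.ι h) φ h0)
  refine ⟨ψ, ?_⟩
  rw [← Abelian.coimage.fac h, Category.assoc, hψ]
  exact cokernel.π_desc _ _ _

end DirectImage

/-! ### Lifting maps of presheaves to resolutions -/

section Lifts

variable {V : (NoethSch k)ᵒᵖ ⥤ AddCommGrpCat.{u + 1}} (R : InjectiveResolution (assocSheaf V))

/-- The terms of the complex of presheaves `V → I⁰ → I¹ → ⋯`, where `I` is an injective resolution
of the sheaf associated with `V`. -/
def augTerm : ℕ → ((NoethSch k)ᵒᵖ ⥤ AddCommGrpCat.{u + 1})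
  | 0 => V
  | n + 1 => Cochains R (n + 3)

/-- The differentials of the complex of presheaves `V → I⁰ → I¹ → ⋯`. -/
def augDiff : ∀ n, augTerm R n ⟶ augTerm R (n + 1)
  | 0 => toAssocSheaf V ≫ (R.ι.f 0).hom
  | n + 1 => (shiftedDiff R (n + 3)).hom

lemma augDiff_augDiff (n : ℕ) (X : NoethSch k) (s : (augTerm R n).obj (op X)) :
    ((augDiff R (n + 1)).app (op X)).hom (((augDiff R n).app (op X)).hom s) = 0 := by
  match n with
  | 0 => exact dif_aug R X (assoc V X s)
  | n + 1 => exact dif_dif R (n + 3) X s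

variable {X Y Z : NoethSch k} (π : X ⟶ Y) (f : Z ⟶ Y)

lemma directImage_eq_zero (F : Sheaf (zariskiTopology k) AddCommGrpCat.{u + 1}) {U : Y.sch.Opens}
    (s : F.obj.obj (op (res Z (mor f ⁻¹ᵁ U))))
    (h : ∀ y ∈ U, ∃ (U' : Y.sch.Opens) (h : U' ≤ U), y ∈ U' ∧
      rst F.obj (resLE Z ((mor f).preimage_mono h)) s = 0) : s = 0 := by
  refine eq_of_locally_eq_res F fun x hx => ?_
  obtain ⟨U', h, hy, e⟩ := h (mor f x) hx
  exact ⟨mor f ⁻¹ᵁ U', _, hy, e.trans (map_zero _).symm⟩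

/-- The direct image of the complex `V → I⁰ → I¹ → ⋯` is exact, where sections may be
restricted to smaller open subsets of the target. -/
structure LocallyExact : Prop where
  zero : ∀ {U : Y.sch.Opens} (v : (augTerm R 0).obj (op (res X (mor π ⁻¹ᵁ U)))),
    ((augDiff R 0).app _).hom v = 0 → ∀ y ∈ U, ∃ (U' : Y.sch.Opens) (h : U' ≤ U), y ∈ U' ∧
      rst (augTerm R 0) (resLE X ((mor π).preimage_mono h)) v = 0
  succ : ∀ (n : ℕ) {U : Y.sch.Opens} (s : (augTerm R (n + 1)).obj (op (res X (mor π ⁻¹ᵁ U)))),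
    ((augDiff R (n + 1)).app _).hom s = 0 → ∀ y ∈ U, ∃ (U' : Y.sch.Opens) (h : U' ≤ U), y ∈ U' ∧
      ∃ w, ((augDiff R n).app (op (res X (mor π ⁻¹ᵁ U')))).hom w =
        rst (augTerm R (n + 1)) (resLE X ((mor π).preimage_mono h)) s

variable {π f R}

/-- `θ` is the `n`-th term of a map of complexes of direct images that extends `φ`. -/
def IsLift (φ : directImage (augTerm R 0) π ⟶ directImage (augTerm R 0) f) :
    ∀ n, (directImage (augTerm R n) π ⟶ directImage (augTerm R n) f) → Prop
  | 0, θ => θ = φ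
  | n + 1, θ => ∃ θ', IsLift φ n θ' ∧
      directImageMap (augDiff R n) π ≫ θ = θ' ≫ directImageMap (augDiff R n) f

lemma directImageMap_comp_self (n : ℕ) :
    directImageMap (augDiff R n) f ≫ directImageMap (augDiff R (n + 1)) f = 0 := by
  ext U s
  exact augDiff_augDiff R n _ s

lemma directImage_app_rst {F G : (NoethSch k)ᵒᵖ ⥤ AddCommGrpCat.{u + 1}}
    (θ : directImage F π ⟶ directImage G f) {U U' : Y.sch.Opens} (h : U' ≤ U)
    (s : F.obj (op (res X (mor π ⁻¹ᵁ U)))) :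
    (θ.app (op U')).hom (rst F (resLE X ((mor π).preimage_mono h)) s) =
      rst G (resLE Z ((mor f).preimage_mono h)) ((θ.app (op U)).hom s) :=
  congr($(θ.naturality (homOfLE h).op) s)

/-- `J` is a sheaf, so whether `ψ` kills the kernel of the differential can be tested locally on
`Y`. Hence exactness on stalks suffices, although all objects on `Y` are mere presheaves. -/
lemma exists_comp_eq_of_injective_of_locally (J : Sheaf (zariskiTopology k) AddCommGrpCat.{u + 1})
    [Injective J] (n : ℕ) (ψ : directImage (augTerm R n) π ⟶ directImage J.obj f)
    (hψ : ∀ (U : Y.sch.Opens) (s : (augTerm R n).obj (op (res X (mor π ⁻¹ᵁ U)))),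
      ((augDiff R n).app _).hom s = 0 → ∀ y ∈ U, ∃ (U' : Y.sch.Opens) (h : U' ≤ U), y ∈ U' ∧
        (ψ.app (op U')).hom (rst (augTerm R n) (resLE X ((mor π).preimage_mono h)) s) = 0) :
    ∃ ψ', directImageMap (augDiff R n) π ≫ ψ' = ψ := by
  refine exists_comp_eq_of_injective_of_ker f J _ ψ fun U s hs => ?_
  refine directImage_eq_zero f J _ fun y hy => ?_
  obtain ⟨U', h, hy', e⟩ := hψ U.unop s hs y hy
  exact ⟨U', h, hy', (directImage_app_rst ψ h s).symm.trans e⟩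

/-- Maps from the positive terms of a locally exact complex to the direct image of an injective
sheaf extend along the differential if they vanish on boundaries. -/
lemma LocallyExact.exists_comp_eq (hπ : LocallyExact R π)
    (J : Sheaf (zariskiTopology k) AddCommGrpCat.{u + 1})
    [Injective J] (n : ℕ) (ψ : directImage (augTerm R (n + 1)) π ⟶ directImage J.obj f)
    (hψ : directImageMap (augDiff R n) π ≫ ψ = 0) :
    ∃ ψ', directImageMap (augDiff R (n + 1)) π ≫ ψ' = ψ := by
  refine exists_comp_eq_of_injective_of_locally J (n + 1) ψ fun U s hs y hy => ?_
  obtain ⟨U', h, hy', w, hw⟩ := hπ.succ n s hs y hy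
  refine ⟨U', h, hy', ?_⟩
  rw [← hw]
  exact congr(($hψ).app (op U') w)

lemma LocallyExact.exists_comp_eq_zero (hπ : LocallyExact R π)
    (J : Sheaf (zariskiTopology k) AddCommGrpCat.{u + 1})
    [Injective J] (ψ : directImage (augTerm R 0) π ⟶ directImage J.obj f) :
    ∃ ψ', directImageMap (augDiff R 0) π ≫ ψ' = ψ := by
  refine exists_comp_eq_of_injective_of_locally J 0 ψ fun U s hs y hy => ?_
  obtain ⟨U', h, hy', e⟩ := hπ.zero s hs y hy
  exact ⟨U', h, hy', (congrArg (ψ.app (op U')).hom e).trans (map_zero (ψ.app (op U')).hom)⟩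

/-- The inductive step of the comparison theorem: `θ` followed by the differential vanishes on
boundaries, so it extends along the differential of the source. -/
lemma LocallyExact.exists_comp_eq_comp (hπ : LocallyExact R π)
    {φ : directImage (augTerm R 0) π ⟶ directImage (augTerm R 0) f} {n : ℕ}
    {θ : directImage (augTerm R n) π ⟶ directImage (augTerm R n) f} (h : IsLift φ n θ) :
    ∃ θ' : directImage (augTerm R (n + 1)) π ⟶ directImage (augTerm R (n + 1)) f,
      directImageMap (augDiff R n) π ≫ θ' = θ ≫ directImageMap (augDiff R n) f := by
  match n with
  | 0 => exact hπ.exists_comp_eq_zero (shiftedTerm R 3) (θ ≫ directImageMap (augDiff R 0) f)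
  | n + 1 =>
    obtain ⟨θ₀, -, h₀⟩ := h
    have h₁ : directImageMap (augDiff R n) π ≫ θ ≫ directImageMap (augDiff R (n + 1)) f = 0 := by
      rw [← Category.assoc, h₀, Category.assoc, directImageMap_comp_self, comp_zero]
    exact hπ.exists_comp_eq (shiftedTerm R (n + 4)) n _ h₁

lemma LocallyExact.exists_isLift (hπ : LocallyExact R π)
    (φ : directImage (augTerm R 0) π ⟶ directImage (augTerm R 0) f) (n : ℕ) :
    ∃ θ, IsLift φ n θ := by
  induction n with
  | zero => exact ⟨φ, rfl⟩
  | succ n ih =>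
    obtain ⟨θ', h⟩ := ih
    obtain ⟨θ, hθ⟩ := hπ.exists_comp_eq_comp h
    exact ⟨θ, θ', h, hθ⟩

variable (R) in
/-- The differentials that end in the positive terms of the complex `V → I⁰ → I¹ → ⋯`, with the
first of them replaced by zero. -/
def shiftedAugDiff (n : ℕ) : Cochains R (n + 2) ⟶ augTerm R (n + 1) :=
  (shiftedDiff R (n + 2)).hom

lemma directImageMap_shiftedAugDiff_comp (n : ℕ) :
    directImageMap (shiftedAugDiff R n) f ≫ directImageMap (augDiff R (n + 1)) f = 0 := by
  ext U s
  exact dif_dif R (n + 2) _ s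

/-- A lift of zero is null-homotopic. The homotopy starts with zero in the lowest degree, so it
never passes through `V`; this is why `shiftedAugDiff` replaces the augmentation. -/
lemma LocallyExact.exists_homotopy (hπ : LocallyExact R π) {n : ℕ}
    {θ : directImage (augTerm R (n + 1)) π ⟶ directImage (augTerm R (n + 1)) f}
    (h : IsLift 0 (n + 1) θ) :
    ∃ η : directImage (augTerm R (n + 1)) π ⟶ directImage (Cochains R (n + 2)) f,
      directImageMap (augDiff R n) π ≫
        (θ - η ≫ directImageMap (shiftedAugDiff R n) f) = 0 := by
  induction n with
  | zero =>
    obtain ⟨θ', rfl, h'⟩ := h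
    refine ⟨0, ?_⟩
    rw [zero_comp, sub_zero, h', zero_comp]
  | succ n ih =>
    obtain ⟨θ', h₁, h'⟩ := h
    obtain ⟨η, hη⟩ := ih h₁
    obtain ⟨η', hη'⟩ := hπ.exists_comp_eq (shiftedTerm R (n + 3)) n _ hη
    refine ⟨η', ?_⟩
    rw [Preadditive.comp_sub, h', sub_eq_zero, ← Category.assoc]
    refine Eq.trans ?_ (congrArg (· ≫ directImageMap (augDiff R (n + 1)) f) hη').symm
    rw [Preadditive.sub_comp, Category.assoc, directImageMap_shiftedAugDiff_comp,
      comp_zero, sub_zero]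

/-- `θ` minus the differential of `η` factors through the outgoing differential, so on cocycles `θ`
equals the coboundary of `η`. -/
lemma LocallyExact.exists_dif_eq_of_isLift_zero (hπ : LocallyExact R π) {n : ℕ}
    {θ : directImage (augTerm R (n + 1)) π ⟶ directImage (augTerm R (n + 1)) f}
    (h : IsLift 0 (n + 1) θ) {U : Y.sch.Opens}
    (z : (Cochains R (n + 3)).obj (op (res X (mor π ⁻¹ᵁ U))))
    (hz : dif R (n + 3) _ z = 0) : ∃ w, dif R (n + 2) _ w = (θ.app (op U)).hom z := by
  obtain ⟨η, hη⟩ := hπ.exists_homotopy h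
  obtain ⟨η', hη'⟩ := hπ.exists_comp_eq (shiftedTerm R (n + 3)) n _ hη
  refine ⟨(η.app (op U)).hom z, ?_⟩
  have h1 := congr(($hη').app (op U) z)
  have h2 : (η'.app (op U)).hom (dif R (n + 3) _ z) = 0 :=
    (congrArg (η'.app (op U)).hom hz).trans (map_zero (η'.app (op U)).hom)
  exact (sub_eq_zero.mp (h1.symm.trans h2)).symm

end Lifts

/-! ### Maps on cohomology that are induced by maps of presheaves -/

section Operations

variable (F G : (NoethSch k)ᵒᵖ ⥤ AddCommGrpCat.{u + 1}) {X Y Z Z' : NoethSch k}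

/-- The map of direct images that is induced by a morphism over the base. -/
def directImageComap {f : Z ⟶ Y} {f' : Z' ⟶ Y} (g : Z' ⟶ Z) (h : g ≫ f = f') :
    directImage F f ⟶ directImage F f' where
  app U := F.map (resMap g (mor f' ⁻¹ᵁ U.unop) (mor f ⁻¹ᵁ U.unop) (by subst h; exact le_rfl)).op
  naturality _ _ l := by
    refine (F.map_comp _ _).symm.trans (Eq.trans ?_ (F.map_comp _ _))
    refine congrArg (fun l => F.map (Quiver.Hom.op l)) ?_
    exact (resMap_resLE g _ _ _).trans (resLE_resMap g _ _ _).symm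

variable {F G}

/-- The direct image of a map of direct images. -/
def directImagePush {f : Z ⟶ Y} {f' : Z' ⟶ Y} (θ : directImage F f ⟶ directImage G f')
    (p : Y ⟶ X) : directImage F (f ≫ p) ⟶ directImage G (f' ≫ p) where
  app U := θ.app (op (mor p ⁻¹ᵁ U.unop))
  naturality _ _ l := θ.naturality (homOfLE ((mor p).preimage_mono (leOfHom l.unop))).op

/-- The map on global sections that is induced by a map of direct images. -/
def onSections {f : Z ⟶ Y} {f' : Z' ⟶ Y} (θ : directImage F f ⟶ directImage G f') :
    F.obj (op Z) →+ G.obj (op Z') :=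
  ((rst G (toResTop Z')).comp (θ.app (op ⊤)).hom).comp (rst F (resι Z ⊤))

lemma rst_resι_toResTop (F : (NoethSch k)ᵒᵖ ⥤ AddCommGrpCat.{u + 1}) {X : NoethSch k}
    (s : F.obj (op (res X ⊤))) : rst F (resι X ⊤) (rst F (toResTop X) s) = s := by
  rw [rst_comp, resι_toResTop, rst_id]

lemma onSections_comp {H : (NoethSch k)ᵒᵖ ⥤ AddCommGrpCat.{u + 1}} {f : Z ⟶ Y} {f' : Z' ⟶ Y}
    {f'' : X ⟶ Y} (θ : directImage F f ⟶ directImage G f')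
    (θ' : directImage G f' ⟶ directImage H f'') (s : F.obj (op Z)) :
    onSections (θ ≫ θ') s = onSections θ' (onSections θ s) := by
  refine congrArg (fun t => rst H (toResTop X) ((θ'.app (op ⊤)).hom t)) ?_
  exact (rst_resι_toResTop G _).symm

lemma onSections_comap {f : Z ⟶ Y} {f' : Z' ⟶ Y} (g : Z' ⟶ Z) (h : g ≫ f = f')
    (s : F.obj (op Z)) : onSections (directImageComap F g h) s = rst F g s := by
  refine (congrArg (rst F (toResTop Z')) (rst_comp F _ _ s)).trans ?_
  refine (rst_comp F _ _ s).trans (congrArg (fun l => rst F l s) ?_)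
  exact (congrArg (toResTop Z' ≫ ·) (resMap_resι g ⊤ ⊤ le_rfl)).trans (toResTop_resι_assoc _ _)

lemma onSections_add {f : Z ⟶ Y} {f' : Z' ⟶ Y} (θ θ' : directImage F f ⟶ directImage G f')
    (s : F.obj (op Z)) : onSections (θ + θ') s = onSections θ s + onSections θ' s :=
  map_add (rst G (toResTop Z')) _ _

lemma onSections_sub {f : Z ⟶ Y} {f' : Z' ⟶ Y} (θ θ' : directImage F f ⟶ directImage G f')
    (s : F.obj (op Z)) : onSections (θ - θ') s = onSections θ s - onSections θ' s :=
  map_sub (rst G (toResTop Z')) _ _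

lemma onSections_zero {f : Z ⟶ Y} {f' : Z' ⟶ Y} (s : F.obj (op Z)) :
    onSections (0 : directImage F f ⟶ directImage G f') s = 0 :=
  map_zero (rst G (toResTop Z'))

end Operations

section Lifts

variable {V : (NoethSch k)ᵒᵖ ⥤ AddCommGrpCat.{u + 1}} {R : InjectiveResolution (assocSheaf V)}
  {X Y Z Z' : NoethSch k} {π : X ⟶ Y} {f : Z ⟶ Y} {f' : Z' ⟶ Y}

/-- Inverse images commute with the differentials, so in each degree they are their own lifts. -/
lemma isLift_comap {g : Z ⟶ X} (h : g ≫ π = f) (n : ℕ) :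
    IsLift (directImageComap (augTerm R 0) g h) n (directImageComap (augTerm R n) g h) := by
  induction n with
  | zero => rfl
  | succ n ih =>
    refine ⟨_, ih, ?_⟩
    ext U s
    exact (rst_app (augDiff R n) _ s).symm

variable {φ φ₁ : directImage (augTerm R 0) π ⟶ directImage (augTerm R 0) f}

lemma IsLift.comp {φ' : directImage (augTerm R 0) f ⟶ directImage (augTerm R 0) f'} {n : ℕ}
    {θ : directImage (augTerm R n) π ⟶ directImage (augTerm R n) f}
    {θ' : directImage (augTerm R n) f ⟶ directImage (augTerm R n) f'}
    (h : IsLift φ n θ) (h' : IsLift φ' n θ') : IsLift (φ ≫ φ') n (θ ≫ θ') := by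
  induction n with
  | zero => exact congrArg₂ (· ≫ ·) h h'
  | succ n ih =>
    obtain ⟨θ₀, h₀, e⟩ := h
    obtain ⟨θ₀', h₀', e'⟩ := h'
    refine ⟨_, ih h₀ h₀', ?_⟩
    rw [← Category.assoc, e, Category.assoc, e', Category.assoc]

lemma IsLift.push {n : ℕ} {θ : directImage (augTerm R n) π ⟶ directImage (augTerm R n) f}
    (h : IsLift φ n θ) (p : Y ⟶ Z') : IsLift (directImagePush φ p) n (directImagePush θ p) := by
  induction n with
  | zero => exact congrArg (directImagePush · p) h
  | succ n ih =>
    obtain ⟨θ₀, h₀, e⟩ := h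
    refine ⟨_, ih h₀, ?_⟩
    ext U s
    exact congr(($e).app (op (mor p ⁻¹ᵁ U.unop)) s)

lemma IsLift.add {n : ℕ} {θ θ₁ : directImage (augTerm R n) π ⟶ directImage (augTerm R n) f}
    (h : IsLift φ n θ) (h₁ : IsLift φ₁ n θ₁) : IsLift (φ + φ₁) n (θ + θ₁) := by
  induction n with
  | zero => exact congrArg₂ (· + ·) h h₁
  | succ n ih =>
    obtain ⟨θ₀, h₀, e⟩ := h
    obtain ⟨θ₀', h₀', e'⟩ := h₁
    exact ⟨_, ih h₀ h₀', by rw [Preadditive.comp_add, e, e', Preadditive.add_comp]⟩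

lemma IsLift.sub {n : ℕ} {θ θ₁ : directImage (augTerm R n) π ⟶ directImage (augTerm R n) f}
    (h : IsLift φ n θ) (h₁ : IsLift φ₁ n θ₁) : IsLift (φ - φ₁) n (θ - θ₁) := by
  induction n with
  | zero => exact congrArg₂ (· - ·) h h₁
  | succ n ih =>
    obtain ⟨θ₀, h₀, e⟩ := h
    obtain ⟨θ₀', h₀', e'⟩ := h₁
    exact ⟨_, ih h₀ h₀', by rw [Preadditive.comp_sub, e, e', Preadditive.sub_comp]⟩

lemma isLift_zero (n : ℕ) :
    IsLift (0 : directImage (augTerm R 0) π ⟶ directImage (augTerm R 0) f) n 0 := by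
  induction n with
  | zero => rfl
  | succ n ih => exact ⟨_, ih, by rw [comp_zero, zero_comp]⟩

lemma IsLift.nsmul {n : ℕ} {θ : directImage (augTerm R n) π ⟶ directImage (augTerm R n) f}
    (h : IsLift φ n θ) (e : ℕ) : IsLift (e • φ) n (e • θ) := by
  induction e with
  | zero => rw [zero_nsmul, zero_nsmul]; exact isLift_zero n
  | succ e ih => rw [succ_nsmul, succ_nsmul]; exact ih.add h

lemma IsLift.sum {ι : Type*} (s : Finset ι) {n : ℕ}
    {φ : ι → (directImage (augTerm R 0) π ⟶ directImage (augTerm R 0) f)}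
    {θ : ι → (directImage (augTerm R n) π ⟶ directImage (augTerm R n) f)}
    (h : ∀ i, IsLift (φ i) n (θ i)) : IsLift (∑ i ∈ s, φ i) n (∑ i ∈ s, θ i) := by
  classical
  induction s using Finset.induction_on with
  | empty => simpa using isLift_zero n
  | insert i s hi ih => rw [Finset.sum_insert hi, Finset.sum_insert hi]; exact (h i).add ih

/-! ### Cohomology -/

lemma onSections_dif {n : ℕ}
    {θ : directImage (augTerm R (n + 1)) π ⟶ directImage (augTerm R (n + 1)) f}
    {θ' : directImage (augTerm R (n + 2)) π ⟶ directImage (augTerm R (n + 2)) f}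
    (h : directImageMap (augDiff R (n + 1)) π ≫ θ' = θ ≫ directImageMap (augDiff R (n + 1)) f)
    (s : (Cochains R (n + 3)).obj (op X)) :
    dif R (n + 3) Z (onSections θ s) = onSections θ' (dif R (n + 3) X s) := by
  refine (rst_app (augDiff R (n + 1)) (toResTop Z) _).trans ?_
  refine congrArg (rst (augTerm R (n + 2)) (toResTop Z)) ?_
  refine Eq.trans (congr(($h).app (op ⊤) (rst (augTerm R (n + 1)) (resι X ⊤) s))).symm ?_
  exact congrArg (θ'.app (op ⊤)).hom (rst_app (augDiff R (n + 1)) (resι X ⊤) s)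

lemma LocallyExact.dif_onSections (hπ : LocallyExact R π) {n : ℕ}
    {θ : directImage (augTerm R (n + 1)) π ⟶ directImage (augTerm R (n + 1)) f}
    (h : IsLift φ (n + 1) θ) {s : (Cochains R (n + 3)).obj (op X)} (hs : dif R (n + 3) X s = 0) :
    dif R (n + 3) Z (onSections θ s) = 0 := by
  obtain ⟨θ', h'⟩ := hπ.exists_comp_eq_comp h
  exact (onSections_dif h' s).trans ((congrArg (onSections θ') hs).trans (map_zero (onSections θ')))

lemma LocallyExact.exists_dif_eq_onSections (hπ : LocallyExact R π) {n : ℕ}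
    {θ : directImage (augTerm R (n + 1)) π ⟶ directImage (augTerm R (n + 1)) f}
    (h : IsLift 0 (n + 1) θ) {s : (Cochains R (n + 3)).obj (op X)} (hs : dif R (n + 3) X s = 0) :
    ∃ w, dif R (n + 2) Z w = onSections θ s := by
  obtain ⟨w, hw⟩ := hπ.exists_dif_eq_of_isLift_zero h (U := ⊤)
    (rst (Cochains R (n + 3)) (resι X ⊤) s)
    ((dif_rst R (n + 3) (resι X ⊤) s).trans ((congrArg _ hs).trans (map_zero _)))
  refine ⟨rst (Cochains R (n + 2)) (toResTop Z) w, ?_⟩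
  exact (dif_rst R (n + 2) (toResTop Z) w).trans
    (congrArg (rst (Cochains R (n + 3)) (toResTop Z)) hw)

lemma IsLift.exists_dif_eq_onSections_dif {n : ℕ}
    {θ : directImage (augTerm R (n + 1)) π ⟶ directImage (augTerm R (n + 1)) f}
    (h : IsLift φ (n + 1) θ) (s : (Cochains R (n + 2)).obj (op X)) :
    ∃ w, dif R (n + 2) Z w = onSections θ (dif R (n + 2) X s) := by
  match n with
  | 0 =>
    refine ⟨0, ?_⟩
    rw [(subsingleton_cochains_two R X).elim s 0, map_zero, map_zero]
    exact (map_zero (onSections θ)).symm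
  | n + 1 =>
    obtain ⟨θ', -, h'⟩ := h
    exact ⟨onSections θ' s, onSections_dif h' s⟩

/-- Two lifts differ by a lift of zero, which sends cocycles to coboundaries, and a lift sends
coboundaries to coboundaries. So neither the lift nor the cocycle matters. -/
lemma LocallyExact.unique (hπ : LocallyExact R π) {n : ℕ}
    {θ θ' : directImage (augTerm R (n + 1)) π ⟶ directImage (augTerm R (n + 1)) f}
    (h : IsLift φ (n + 1) θ) (h' : IsLift φ (n + 1) θ') {α : (zariskiCohomology V n).obj (op X)}
    {z z' : (Cochains R (n + 3)).obj (op X)} (hz : Represents R z α) (hz' : Represents R z' α)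
    {β β' : (zariskiCohomology V n).obj (op Z)} (hβ : Represents R (onSections θ z) β)
    (hβ' : Represents R (onSections θ' z') β') : β = β' := by
  rw [hβ.eq_iff hβ']
  obtain ⟨w, hw⟩ := (hz.eq_iff hz').mp rfl
  have h0 : IsLift 0 (n + 1) (θ - θ') := by simpa using h.sub h'
  obtain ⟨w₁, hw₁⟩ := hπ.exists_dif_eq_onSections h0 hz.dif_eq_zero
  obtain ⟨w₂, hw₂⟩ := h'.exists_dif_eq_onSections_dif w
  refine ⟨w₁ + w₂, ?_⟩
  have e₁ := onSections_sub θ θ' z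
  have e₂ : onSections θ' (dif R (n + 2) X w) = onSections θ' z - onSections θ' z' := by
    rw [hw]; exact map_sub (onSections θ') z z'
  refine (map_add _ _ _).trans ?_
  rw [hw₁, hw₂]
  refine (congrArg₂ (· + ·) e₁ e₂).trans ?_
  abel

lemma LocallyExact.exists_represents (hπ : LocallyExact R π)
    (φ : directImage (augTerm R 0) π ⟶ directImage (augTerm R 0) f) {n : ℕ}
    (α : (zariskiCohomology V n).obj (op X)) :
    ∃ β : (zariskiCohomology V n).obj (op Z), ∀ θ z, IsLift φ (n + 1) θ → Represents R z α →
      Represents R (onSections θ z) β := by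
  obtain ⟨θ, hθ⟩ := hπ.exists_isLift φ (n + 1)
  obtain ⟨z, hz⟩ := SuffRigid.exists_represents R α
  obtain ⟨β, hβ⟩ := exists_represented R (onSections θ z) (hπ.dif_onSections hθ hz.dif_eq_zero)
  refine ⟨β, fun θ' z' hθ' hz' => ?_⟩
  obtain ⟨β', hβ'⟩ := exists_represented R (onSections θ' z')
    (hπ.dif_onSections hθ' hz'.dif_eq_zero)
  rwa [hπ.unique hθ hθ' hz hz' hβ hβ']

/-- The map on cohomology that is induced by a map of presheaves of direct images. -/
def LocallyExact.induced (hπ : LocallyExact R π)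
    (φ : directImage (augTerm R 0) π ⟶ directImage (augTerm R 0) f) (n : ℕ) :
    (zariskiCohomology V n).obj (op X) →+ (zariskiCohomology V n).obj (op Z) :=
  AddMonoidHom.mk' (fun α => (hπ.exists_represents φ α).choose) fun α α' => by
    obtain ⟨θ, hθ⟩ := hπ.exists_isLift φ (n + 1)
    obtain ⟨z, hz⟩ := SuffRigid.exists_represents R α
    obtain ⟨z', hz'⟩ := SuffRigid.exists_represents R α'
    have h := (hπ.exists_represents φ α).choose_spec θ z hθ hz
    have h' := (hπ.exists_represents φ α').choose_spec θ z' hθ hz'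
    have h'' := (hπ.exists_represents φ (α + α')).choose_spec θ (z + z') hθ (hz.add hz')
    refine h''.unique ?_
    have e : onSections θ (z + z') = onSections θ z + onSections θ z' :=
      map_add (onSections θ) z z'
    exact e ▸ h.add h'

lemma LocallyExact.represents_induced (hπ : LocallyExact R π) {n : ℕ}
    {θ : directImage (augTerm R (n + 1)) π ⟶ directImage (augTerm R (n + 1)) f}
    (h : IsLift φ (n + 1) θ) {α : (zariskiCohomology V n).obj (op X)}
    {z : (Cochains R (n + 3)).obj (op X)} (hz : Represents R z α) :
    Represents R (onSections θ z) (hπ.induced φ n α) :=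
  (hπ.exists_represents φ α).choose_spec θ z h hz

end Lifts

/-! ### Transfers on cohomology -/

section TransferMap

variable {V : (NoethSch k)ᵒᵖ ⥤ AddCommGrpCat.{u + 1}} (T : TransferStructure V)

lemma TransferStructure.tr_rst {X' X Y' Y : NoethSch k} {f' : X' ⟶ X} {π' : X' ⟶ Y'} {π : X ⟶ Y}
    {f : Y' ⟶ Y} (H : IsPullback (mor f') (mor π') (mor π) (mor f)) (hπ : Admissible π)
    (hπ' : Admissible π') (s : V.obj (op X)) :
    rst V f ((T.tr π hπ).hom s) = (T.tr π' hπ').hom (rst V f' s) :=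
  congr($(T.base_change f' π' π f H hπ hπ') s)

lemma TransferStructure.tr_tr {X Y Z : NoethSch k} {π : X ⟶ Y} {ρ : Y ⟶ Z} {σ : X ⟶ Z}
    (e : π ≫ ρ = σ) (hπ : Admissible π) (hρ : Admissible ρ) (hσ : Admissible σ)
    (s : V.obj (op X)) : (T.tr ρ hρ).hom ((T.tr π hπ).hom s) = (T.tr σ hσ).hom s := by
  subst e
  exact congr($(T.tr_comp π ρ hπ hρ hσ) s).symm

lemma rst_resMap_id (F : (NoethSch k)ᵒᵖ ⥤ AddCommGrpCat.{w}) {X : NoethSch k} (U : X.sch.Opens)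
    (h : U ≤ mor (𝟙 X) ⁻¹ᵁ U) (s : F.obj (op (res X U))) :
    rst F (resMap (𝟙 X) U U h) s = s := by
  rw [resMap_id, rst_id]

/-- A transfer map of an isomorphism is inverse to the inverse image. -/
lemma TransferStructure.rst_tr_of_isIso {X Y : NoethSch k} {π : X ⟶ Y} [IsIso π]
    (hπ : Admissible π) (s : V.obj (op X)) : rst V π ((T.tr π hπ).hom s) = s := by
  have h : Admissible (𝟙 X) := by
    obtain ⟨h₁, h₂, L, _, _, d, hd, h₃, h₄⟩ := hπ
    refine ⟨inferInstanceAs (IsFinite (𝟙 X.sch)), inferInstanceAs (Flat (𝟙 X.sch)), L,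
      inferInstance, inferInstance, mor π ≫ d, ?_, h₄, ?_⟩
    · exact (Category.assoc _ _ _).trans ((congrArg (mor π ≫ ·) hd).trans (mor_str π))
    · exact (Category.id_comp (mor π ≫ d)).symm ▸ h₄
  have H : IsPullback (mor (𝟙 X)) (mor (𝟙 X)) (mor π) (mor π) :=
    IsKernelPair.id_of_mono (mor π)
  refine (T.tr_rst H hπ h s).trans ?_
  rw [T.tr_id]
  exact rst_id V s

variable {X Y Z Z' : NoethSch k} {π : X ⟶ Y} (hπ : Admissible π)

/-- The transfer maps over the open subsets of the target, followed by the inverse image under a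
morphism to the target. -/
def transferMap (f : Z ⟶ Y) : directImage V π ⟶ directImage V f where
  app U := T.tr (resMap π (mor π ⁻¹ᵁ U.unop) U.unop le_rfl) (admissible_resMap hπ U.unop) ≫
    V.map (resMap f (mor f ⁻¹ᵁ U.unop) U.unop le_rfl).op
  naturality U U' l := by
    ext s
    have hl : U'.unop ≤ U.unop := leOfHom l.unop
    -- Restricting from `U` to `U'` is base change along an open inclusion, so naturality is a case
    -- of the base change axiom.
    have H : IsPullback (mor (𝟙 X)) (mor π) (mor π) (mor (𝟙 Y)) :=
      (IsPullback.of_horiz_isIso ⟨rfl⟩ : IsPullback (𝟙 X.sch) (mor π) (mor π) (𝟙 Y.sch))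
    have h := T.tr_rst (isPullback_resMap H U.unop U'.unop hl) (admissible_resMap hπ U.unop)
      (admissible_resMap hπ U'.unop) s
    refine (congrArg (rst V (resMap f (mor f ⁻¹ᵁ U'.unop) U'.unop le_rfl)) h).symm.trans ?_
    refine (rst_rst_eq V ?_ _)
    exact (resMap_resLE f _ hl le_rfl).trans (resLE_resMap f _ _ le_rfl).symm

lemma transferMap_comap (f : Z ⟶ Y) (g : Z' ⟶ Z) {f' : Z' ⟶ Y} (h : g ≫ f = f') :
    transferMap T hπ f ≫ directImageComap V g h = transferMap T hπ f' := by
  subst h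
  ext U s
  refine (rst_comp V _ _ _).trans ?_
  exact congrArg (fun l => rst V l _) (resMap_comp g f _ _ _ le_rfl le_rfl)

variable {X' Y' : NoethSch k} {π' : X' ⟶ Y'} (hπ' : Admissible π') (f' : X' ⟶ X) (f : Y' ⟶ Y)

/-- The inverse image under `f'` followed by the transfer maps for `π'`, over the open subsets of
the target of `f`. -/
def pullTransfer (w : f' ≫ π = π' ≫ f) : directImage V π ⟶ directImage V f :=
  directImageComap V f' w ≫ directImagePush (transferMap T hπ' (𝟙 Y')) f ≫
    directImageComap V (𝟙 Y') (by rw [Category.id_comp, Category.id_comp])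

lemma pullTransfer_app (w : f' ≫ π = π' ≫ f) (W : Y.sch.Opens)
    (hW : mor π' ⁻¹ᵁ mor f ⁻¹ᵁ W ≤ mor f' ⁻¹ᵁ mor π ⁻¹ᵁ W)
    (s : V.obj (op (res X (mor π ⁻¹ᵁ W)))) :
    ((pullTransfer T hπ' f' f w).app (op W)).hom s =
      (T.tr (resMap π' (mor π' ⁻¹ᵁ mor f ⁻¹ᵁ W) (mor f ⁻¹ᵁ W) le_rfl)
        (admissible_resMap hπ' (mor f ⁻¹ᵁ W))).hom
          (rst V (resMap f' (mor π' ⁻¹ᵁ mor f ⁻¹ᵁ W) (mor π ⁻¹ᵁ W) hW) s) := by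
  refine (rst_comp V _ _ _).trans ?_
  refine Eq.trans (congrArg (fun l => rst V l _) ?_) (rst_id V _)
  refine (resMap_comp (𝟙 Y') (𝟙 Y') (mor f ⁻¹ᵁ W) _ (mor f ⁻¹ᵁ W) le_rfl le_rfl).trans ?_
  refine (resMap_congr (Category.comp_id _) _ _ _).trans (resMap_id _ _ _)

/-- The base change axiom of `V`, applied over each open subset of `Y`. -/
lemma pullTransfer_of_isPullback (H : IsPullback (mor f') (mor π') (mor π) (mor f)) :
    pullTransfer T hπ' f' f (isPullback_w H) = transferMap T hπ f := by
  ext W s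
  have hW : mor π' ⁻¹ᵁ mor f ⁻¹ᵁ W.unop ≤ mor f' ⁻¹ᵁ mor π ⁻¹ᵁ W.unop := by
    change mor (π' ≫ f) ⁻¹ᵁ W.unop ≤ mor (f' ≫ π) ⁻¹ᵁ W.unop
    rw [isPullback_w H]
  refine (pullTransfer_app T hπ' f' f _ W.unop hW s).trans (Eq.symm ?_)
  exact T.tr_rst (isPullback_resMap H W.unop (mor f ⁻¹ᵁ W.unop) le_rfl)
    (admissible_resMap hπ W.unop) (admissible_resMap hπ' (mor f ⁻¹ᵁ W.unop)) s

/-- The restricted identity is treated as an isomorphism: its transfer is inverse to its inverse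
image, which avoids identifying the preimage of `W` with `W`. -/
lemma transferMap_id (X : NoethSch k) (h : Admissible (𝟙 X)) :
    transferMap T h (𝟙 X) = 𝟙 _ := by
  ext W s
  have : IsIso (resMap (𝟙 X) (mor (𝟙 X) ⁻¹ᵁ W.unop) W.unop le_rfl) :=
    Eq.mpr (congrArg (fun l => IsIso l) (resMap_id X W.unop le_rfl)) (inferInstance : IsIso (𝟙 _))
  exact T.rst_tr_of_isIso (admissible_resMap h W.unop) s

lemma pullTransfer_id_app (ρ : Y ⟶ Z) (W : Z.sch.Opens)
    (h : Admissible (resMap π (mor π ⁻¹ᵁ mor ρ ⁻¹ᵁ W) (mor ρ ⁻¹ᵁ W) le_rfl))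
    (s : V.obj (op (res X (mor π ⁻¹ᵁ mor ρ ⁻¹ᵁ W)))) :
    ((pullTransfer T hπ (𝟙 X) ρ (Category.id_comp (π ≫ ρ))).app (op W)).hom s =
      (T.tr (resMap π (mor π ⁻¹ᵁ mor ρ ⁻¹ᵁ W) (mor ρ ⁻¹ᵁ W) le_rfl) h).hom s := by
  refine (pullTransfer_app T hπ (𝟙 X) ρ (Category.id_comp (π ≫ ρ)) W le_rfl s).trans ?_
  exact congrArg (T.tr _ h).hom (rst_resMap_id V (mor π ⁻¹ᵁ mor ρ ⁻¹ᵁ W) le_rfl s)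

lemma transferMap_app (f : Z ⟶ Y) (W : Y.sch.Opens)
    (h : Admissible (resMap π (mor π ⁻¹ᵁ W) W le_rfl))
    (s : V.obj (op (res X (mor π ⁻¹ᵁ W)))) :
    ((transferMap T hπ f).app (op W)).hom s =
      rst V (resMap f (mor f ⁻¹ᵁ W) W le_rfl) ((T.tr (resMap π _ W le_rfl) h).hom s) :=
  rfl

/-- Over each open subset of `Z` this is functoriality of transfers for the restrictions of `π` and
`ρ`. -/
lemma pullTransfer_comp {ρ : Y ⟶ Z} (hρ : Admissible ρ) (hπρ : Admissible (π ≫ ρ)) :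
    pullTransfer T hπ (𝟙 X) ρ (Category.id_comp (π ≫ ρ)) ≫ transferMap T hρ (𝟙 Z) =
      transferMap T hπρ (𝟙 Z) := by
  ext W s
  have h₁ := admissible_resMap hπ (mor ρ ⁻¹ᵁ W.unop)
  have h₂ := admissible_resMap hρ W.unop
  have h₃ := admissible_resMap hπρ W.unop
  have e₁ := pullTransfer_id_app T hπ ρ W.unop h₁ s
  have e₂ := T.tr_tr (resMap_comp π ρ (mor π ⁻¹ᵁ mor ρ ⁻¹ᵁ W.unop) (mor ρ ⁻¹ᵁ W.unop) W.unop
    le_rfl le_rfl) h₁ h₂ h₃ s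
  refine Eq.trans ?_ (transferMap_app T hπρ (𝟙 Z) W.unop h₃ s).symm
  refine (congrArg ((transferMap T hρ (𝟙 Z)).app (op W.unop)).hom e₁).trans ?_
  refine (transferMap_app T hρ (𝟙 Z) W.unop h₂ _).trans ?_
  exact congrArg (rst V (resMap (𝟙 Z) (mor (𝟙 Z) ⁻¹ᵁ W.unop) W.unop le_rfl)) e₂

end TransferMap

/-! ### The transfer on cohomology and its computation by lifts -/

section Transfers

variable {V : (NoethSch k)ᵒᵖ ⥤ AddCommGrpCat.{u + 1}} (hV : IsSufficientlyRigid V)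
  (semilocal : ∀ (A : Type u) [CommRing A] [Algebra k A] [IsNoetherianRing A],
      IsLocalizationOfSmooth k A → Finite (MaximalSpectrum A) →
        IsIso ((toAssocSheaf V).app (op (specObj k A))) ∧
        ∀ i : ℕ, 0 < i → IsZero ((zariskiCohomology V i).obj (op (specObj k A))))

include hV semilocal in
-- Exactness at `V`, at `I⁰` and in higher degrees uses, respectively, injectivity of the map from
-- `V` to `𝒱`, its surjectivity, and vanishing of higher cohomology on semi-local schemes.
lemma Admissible.locallyExact {X Y : NoethSch k} {π : X ⟶ Y} (hπ : Admissible π)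
    (R : InjectiveResolution (assocSheaf V)) : LocallyExact R π where
  zero v hv y hy := exists_eq_zero_of_admissible hV semilocal hπ v
    (aug_injective R _ (hv.trans (map_zero (aug R _)).symm)) hy
  succ n U s hs y hy := by
    match n with
    | 0 =>
      obtain ⟨t, rfl⟩ := exists_aug_eq R s hs
      obtain ⟨U', h, hy', v, hv⟩ := exists_assoc_eq_of_admissible hV semilocal hπ t hy
      exact ⟨U', h, hy', v, (congrArg (aug R _) hv).trans (aug_rst R _ t)⟩
    | n + 1 => exact exists_dif_eq_of_admissible hV semilocal hπ R s hs hy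

variable (V) in
/-- An injective resolution of the sheaf associated with a presheaf. -/
def resolution : InjectiveResolution (assocSheaf V) :=
  (HasInjectiveResolution.out (Z := assocSheaf V)).some

/-- The transfer on cohomology. -/
def cohomologyTransfer (T : TransferStructure V) (n : ℕ) {X Y : NoethSch k} {π : X ⟶ Y}
    (hπ : Admissible π) :
    (zariskiCohomology V n).obj (op X) →+ (zariskiCohomology V n).obj (op Y) :=
  (hπ.locallyExact hV semilocal (resolution V)).induced (transferMap T hπ (𝟙 Y)) n

variable (T : TransferStructure V) {n : ℕ} {X Y Z : NoethSch k} {π : X ⟶ Y} (hπ : Admissible π)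

lemma Represents.of_eq {R : InjectiveResolution (assocSheaf V)} {n : ℕ} {X : NoethSch k}
    {z z' : (Cochains R (n + 3)).obj (op X)} {α : (zariskiCohomology V n).obj (op X)}
    (h : Represents R z α) (e : z' = z) : Represents R z' α :=
  e ▸ h

/-- The inverse image of a transfer can be computed by means of any lift of the transfer map. -/
lemma represents_rst_cohomologyTransfer (f : Z ⟶ Y)
    {θ : directImage (augTerm (resolution V) (n + 1)) π ⟶
      directImage (augTerm (resolution V) (n + 1)) f}
    (h : IsLift (transferMap T hπ f) (n + 1) θ) {α : (zariskiCohomology V n).obj (op X)}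
    {z : (Cochains (resolution V) (n + 3)).obj (op X)} (hz : Represents (resolution V) z α) :
    Represents (resolution V) (onSections θ z)
      (rst (zariskiCohomology V n) f (cohomologyTransfer hV semilocal T n hπ α)) := by
  have hπ' := hπ.locallyExact hV semilocal (resolution V)
  obtain ⟨θ', h'⟩ := hπ'.exists_isLift (transferMap T hπ (𝟙 Y)) (n + 1)
  have hc : IsLift (transferMap T hπ f) (n + 1) (θ' ≫ directImageComap _ f _) :=
    transferMap_comap T hπ (𝟙 Y) f (Category.comp_id f) ▸
      h'.comp (isLift_comap (Category.comp_id f) (n + 1))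
  have h₃ := hπ'.represents_induced hc hz
  have h₁ := ((hπ'.represents_induced h' hz).rst f).unique (h₃.of_eq
    ((onSections_comp _ _ _).trans (onSections_comap _ _ _)).symm)
  exact Eq.subst (motive := fun β => Represents (resolution V) (onSections θ z) β) h₁.symm
    (hπ'.represents_induced h hz)

lemma rst_cohomologyTransfer_eq (f : Z ⟶ Y)
    {θ : directImage (augTerm (resolution V) (n + 1)) π ⟶
      directImage (augTerm (resolution V) (n + 1)) f}
    (h : IsLift (transferMap T hπ f) (n + 1) θ) {α : (zariskiCohomology V n).obj (op X)}
    {z : (Cochains (resolution V) (n + 3)).obj (op X)} (hz : Represents (resolution V) z α)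
    {β : (zariskiCohomology V n).obj (op Z)} (hβ : Represents (resolution V) (onSections θ z) β) :
    rst (zariskiCohomology V n) f (cohomologyTransfer hV semilocal T n hπ α) = β :=
  (represents_rst_cohomologyTransfer hV semilocal T hπ f h hz).unique hβ

/-- A lift of the transfers for `π'`, composed with inverse images, lifts `pullTransfer` and
computes the transfer of the pulled back class. Identities between `transferMap` and `pullTransfer`
thus pass to cohomology. -/
lemma exists_isLift_pullTransfer {X' Y' : NoethSch k} {π' : X' ⟶ Y'} (hπ' : Admissible π')
    (f' : X' ⟶ X) (f : Y' ⟶ Y) (w : f' ≫ π = π' ≫ f) (n : ℕ) :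
    ∃ θ : directImage (augTerm (resolution V) (n + 1)) π ⟶
      directImage (augTerm (resolution V) (n + 1)) f,
      IsLift (pullTransfer T hπ' f' f w) (n + 1) θ ∧
      ∀ (α : (zariskiCohomology V n).obj (op X)) (z : (Cochains (resolution V) (n + 3)).obj (op X)),
        Represents (resolution V) z α → Represents (resolution V) (onSections θ z)
          (cohomologyTransfer hV semilocal T n hπ' (rst (zariskiCohomology V n) f' α)) := by
  have hπ'' := hπ'.locallyExact hV semilocal (resolution V)
  obtain ⟨θ', h'⟩ := hπ''.exists_isLift (transferMap T hπ' (𝟙 Y')) (n + 1)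
  refine ⟨_, (isLift_comap w (n + 1)).comp ((h'.push f).comp (isLift_comap _ (n + 1))),
    fun α z hz => ?_⟩
  have h := hπ''.represents_induced h' (hz.rst f')
  refine h.of_eq ((onSections_comp _ _ _).trans ((onSections_comp _ _ _).trans ?_))
  refine (onSections_comap _ _ _).trans ((rst_id _ _).trans ?_)
  exact congrArg (onSections θ') (onSections_comap _ _ _)

end Transfers

/-! ### The transfer structure on cohomology -/

/-- Restricts the cartesian squares of the ramification axiom to smaller open subschemes. -/
lemma isPullback_resι_comp {P Y : NoethSch k} {A B : Scheme.{u}} {p : P.sch ⟶ A} {f : P ⟶ Y}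
    {a : A ⟶ B} {b : Y.sch ⟶ B} (H : IsPullback p (mor f) a b) (W : Y.sch.Opens)
    {W' : P.sch.Opens} (hW : W' = mor f ⁻¹ᵁ W) :
    IsPullback (mor (resι P W') ≫ p) (mor (resMap f W' W hW.le)) a (mor (resι Y W) ≫ b) := by
  subst hW
  have h : IsPullback (mor f ⁻¹ᵁ W).ι ((mor f).resLE W (mor f ⁻¹ᵁ W) le_rfl) (mor f) W.ι := by
    rw [Scheme.Hom.resLE_eq_morphismRestrict]
    exact (isPullback_morphismRestrict (mor f) W).flip
  exact h.paste_horiz H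

lemma hom_sum_nsmul_apply {A B : AddCommGrpCat.{w}} {ι : Type*} (s : Finset ι) (e : ι → ℕ)
    (g : ι → (A ⟶ B)) (a : A) : (∑ i ∈ s, e i • g i).hom a = ∑ i ∈ s, e i • (g i).hom a := by
  let ev : (A ⟶ B) →+ B := AddMonoidHom.mk' (fun l => l.hom a) fun _ _ => rfl
  exact (map_sum ev _ _).trans (Finset.sum_congr rfl fun i _ => map_nsmul ev _ _)

lemma directImage_sum_nsmul_app {F G : (NoethSch k)ᵒᵖ ⥤ AddCommGrpCat.{u + 1}} {Y Z Z' : NoethSch k}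
    {f : Z ⟶ Y} {f' : Z' ⟶ Y} {ι : Type*} (t : Finset ι) (e : ι → ℕ)
    (θ : ι → (directImage F f ⟶ directImage G f')) (W : Y.sch.Opens)
    (s : F.obj (op (res Z (mor f ⁻¹ᵁ W)))) :
    ((∑ i ∈ t, e i • θ i).app (op W)).hom s = ∑ i ∈ t, e i • ((θ i).app (op W)).hom s := by
  let ev : (directImage F f ⟶ directImage G f') →+ (directImage G f').obj (op W) :=
    AddMonoidHom.mk' (fun l => (l.app (op W)).hom s) fun _ _ => rfl
  exact (map_sum ev _ _).trans (Finset.sum_congr rfl fun i _ => map_nsmul ev _ _)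

/-! ### The ramification formula over open subsets -/

section Ramification

variable {V : (NoethSch k)ᵒᵖ ⥤ AddCommGrpCat.{u + 1}} (T : TransferStructure V)

/-- An open subset of `U` is again an open subscheme of `X ×_L D`. Because the axiom allows
arbitrary open subschemes, the formula holds over every `W` and becomes an identity of maps of
presheaves. -/
lemma transferMap_eq_sum (L : Type u) [Field L] [Algebra k L] {C D X : NoethSch k} (π : C ⟶ D)
    (d : D.sch ⟶ Spec (CommRingCat.of L)) (s : X.sch ⟶ Spec (CommRingCat.of L))
    (hd : IsStructureOver L D d) (hs : IsStructureOver L X s)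
    (hd₁ : SmoothOfRelativeDimension 1 d) (hπd : SmoothOfRelativeDimension 1 (mor π ≫ d))
    (hs₁ : Smooth s) (hfin : IsFinite (mor π)) (hflat : Flat (mor π))
    (y : D.sch) [Fintype {x : C.sch // mor π x = y}] {U UC Uy : NoethSch k}
    (j : U.sch ⟶ pullback s d) (hj : IsOpenImmersion j)
    (hU : IsStructureOver L U (j ≫ pullback.snd s d ≫ d))
    (πU : UC ⟶ U) (q : UC.sch ⟶ C.sch)
    (hq : IsPullback q (mor πU) (mor π) (j ≫ pullback.snd s d))
    (φy : Uy ⟶ U) (qy : Uy.sch ⟶ Spec (D.sch.residueField y))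
    (hqy : IsPullback qy (mor φy) (D.sch.fromSpecResidueField y) (j ≫ pullback.snd s d))
    (Ux : {x : C.sch // mor π x = y} → NoethSch k) (φx : ∀ x, Ux x ⟶ UC)
    (qx : ∀ x, (Ux x).sch ⟶ Spec (C.sch.residueField x.1))
    (hqx : ∀ x, IsPullback (qx x) (mor (φx x)) (C.sch.fromSpecResidueField x.1) q)
    (πx : ∀ x, Ux x ⟶ Uy) (w : ∀ x, πx x ≫ φy = φx x ≫ πU)
    (hπ : Admissible πU) (hπx : ∀ x, Admissible (πx x)) :
    transferMap T hπ φy =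
      ∑ x, ramificationIndex (mor π) x.1 • pullTransfer T (hπx x) (φx x) φy (w x).symm := by
  ext W v
  refine Eq.trans ?_ (directImage_sum_nsmul_app Finset.univ _ _ W.unop v).symm
  have hwx : ∀ x, mor (πx x) ⁻¹ᵁ mor φy ⁻¹ᵁ W.unop = mor (φx x) ⁻¹ᵁ mor πU ⁻¹ᵁ W.unop := fun x => by
    change mor (πx x ≫ φy) ⁻¹ᵁ W.unop = mor (φx x ≫ πU) ⁻¹ᵁ W.unop
    rw [w x]
  have hq' := isPullback_resι_comp hq W.unop rfl
  have hqy' := isPullback_resι_comp hqy W.unop rfl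
  rw [← Category.assoc] at hq' hqy'
  have hU' : IsStructureOver L (res U W.unop)
      ((mor (resι U W.unop) ≫ j) ≫ pullback.snd s d ≫ d) := by
    have e : (mor (resι U W.unop) ≫ j) ≫ pullback.snd s d ≫ d =
        mor (resι U W.unop) ≫ j ≫ pullback.snd s d ≫ d := Category.assoc _ _ _
    refine (congrArg (· ≫ _) e).trans ((Category.assoc _ _ _).trans ?_)
    exact (congrArg (mor (resι U W.unop) ≫ ·) hU).trans (mor_str _)
  have h := T.ramification L π d s hd hs hd₁ hπd hs₁ hfin hflat y (mor (resι U W.unop) ≫ j)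
    inferInstance hU' (resMap πU (mor πU ⁻¹ᵁ W.unop) W.unop le_rfl) _ hq'
    (resMap φy (mor φy ⁻¹ᵁ W.unop) W.unop le_rfl) _ hqy'
    (fun x => res (Ux x) (mor (πx x) ⁻¹ᵁ mor φy ⁻¹ᵁ W.unop))
    (fun x => resMap (φx x) _ (mor πU ⁻¹ᵁ W.unop) (hwx x).le) _
    (fun x => isPullback_resι_comp (hqx x) (mor πU ⁻¹ᵁ W.unop) (hwx x))
    (fun x => resMap (πx x) _ (mor φy ⁻¹ᵁ W.unop) le_rfl)
    (fun x => by
      rw [resMap_comp, resMap_comp]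
      exact resMap_congr (w x) _ _ _)
    (admissible_resMap hπ W.unop) (fun x => admissible_resMap (hπx x) _)
  rw [finsum_eq_sum_of_fintype] at h
  refine Eq.trans congr($h v) ((hom_sum_nsmul_apply _ _ _ _).trans ?_)
  refine Finset.sum_congr rfl fun x _ => congrArg (ramificationIndex (mor π) x.1 • ·) ?_
  exact (pullTransfer_app T (hπx x) (φx x) φy (w x).symm W.unop (hwx x).le v).symm

end Ramification

lemma directImageComap_id (F : (NoethSch k)ᵒᵖ ⥤ AddCommGrpCat.{u + 1}) {Z Y : NoethSch k}
    (f : Z ⟶ Y) : directImageComap F (𝟙 Z) (Category.id_comp f) = 𝟙 _ := by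
  ext W s
  exact rst_resMap_id F (mor f ⁻¹ᵁ W.unop) le_rfl s

/-! ### The axioms for transfers on cohomology -/

section Transfers

variable {V : (NoethSch k)ᵒᵖ ⥤ AddCommGrpCat.{u + 1}} (hV : IsSufficientlyRigid V)
  (semilocal : ∀ (A : Type u) [CommRing A] [Algebra k A] [IsNoetherianRing A],
      IsLocalizationOfSmooth k A → Finite (MaximalSpectrum A) →
        IsIso ((toAssocSheaf V).app (op (specObj k A))) ∧
        ∀ i : ℕ, 0 < i → IsZero ((zariskiCohomology V i).obj (op (specObj k A))))
  (T : TransferStructure V) (n : ℕ)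

lemma cohomologyTransfer_id (X : NoethSch k) (h : Admissible (𝟙 X))
    (α : (zariskiCohomology V n).obj (op X)) :
    cohomologyTransfer hV semilocal T n h α = α := by
  obtain ⟨z, hz⟩ := exists_represents (resolution V) α
  have hl : IsLift (R := resolution V) (transferMap T h (𝟙 X)) (n + 1)
      (directImageComap _ (𝟙 X) (Category.id_comp (𝟙 X))) :=
    transferMap_id T X h ▸ directImageComap_id V (𝟙 X) ▸ isLift_comap _ (n + 1)
  refine (rst_id _ _).symm.trans (rst_cohomologyTransfer_eq hV semilocal T h (𝟙 X) hl hz ?_)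
  exact hz.of_eq ((onSections_comap _ _ _).trans (rst_id _ _))

/-- A lift for `π`, pushed forward to `Z`, followed by a lift for `ρ` is a lift for `π ≫ ρ`. -/
lemma cohomologyTransfer_comp {X Y Z : NoethSch k} {π : X ⟶ Y} {ρ : Y ⟶ Z} (hπ : Admissible π)
    (hρ : Admissible ρ) (hπρ : Admissible (π ≫ ρ)) (α : (zariskiCohomology V n).obj (op X)) :
    cohomologyTransfer hV semilocal T n hπρ α =
      cohomologyTransfer hV semilocal T n hρ (cohomologyTransfer hV semilocal T n hπ α) := by
  obtain ⟨z, hz⟩ := exists_represents (resolution V) α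
  obtain ⟨θ, h, hθ⟩ := exists_isLift_pullTransfer hV semilocal T hπ (𝟙 X) ρ
    (Category.id_comp (π ≫ ρ)) n
  have hρ' := hρ.locallyExact hV semilocal (resolution V)
  obtain ⟨θ', h'⟩ := hρ'.exists_isLift (transferMap T hρ (𝟙 Z)) (n + 1)
  have hl : IsLift (R := resolution V) (transferMap T hπρ (𝟙 Z)) (n + 1) (θ ≫ θ') :=
    pullTransfer_comp T hπ hρ hπρ ▸ h.comp h'
  refine (rst_id _ _).symm.trans (rst_cohomologyTransfer_eq hV semilocal T hπρ (𝟙 Z) hl hz ?_)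
  have h₁ := hθ α z hz
  rw [rst_id] at h₁
  exact (hρ'.represents_induced h' h₁).of_eq (onSections_comp _ _ _)

lemma rst_cohomologyTransfer {X' X Y' Y : NoethSch k} {f' : X' ⟶ X} {π' : X' ⟶ Y'} {π : X ⟶ Y}
    {f : Y' ⟶ Y} (H : IsPullback (mor f') (mor π') (mor π) (mor f)) (hπ : Admissible π)
    (hπ' : Admissible π') (α : (zariskiCohomology V n).obj (op X)) :
    rst (zariskiCohomology V n) f (cohomologyTransfer hV semilocal T n hπ α) =
      cohomologyTransfer hV semilocal T n hπ' (rst (zariskiCohomology V n) f' α) := by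
  obtain ⟨z, hz⟩ := exists_represents (resolution V) α
  obtain ⟨θ, h, hθ⟩ := exists_isLift_pullTransfer hV semilocal T hπ' f' f (isPullback_w H) n
  rw [pullTransfer_of_isPullback T hπ hπ' f' f H] at h
  exact rst_cohomologyTransfer_eq hV semilocal T hπ f h hz (hθ α z hz)

lemma Represents.nsmul {R : InjectiveResolution (assocSheaf V)} {n : ℕ} {X : NoethSch k}
    {z : (Cochains R (n + 3)).obj (op X)} {α : (zariskiCohomology V n).obj (op X)}
    (h : Represents R z α) (e : ℕ) : Represents R (e • z) (e • α) := by
  induction e with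
  | zero =>
    rw [zero_nsmul, zero_nsmul, represents_zero_iff]
    exact ⟨0, map_zero _⟩
  | succ e ih => rw [succ_nsmul, succ_nsmul]; exact ih.add h

lemma Represents.sum {R : InjectiveResolution (assocSheaf V)} {n : ℕ} {X : NoethSch k} {ι : Type*}
    (s : Finset ι) {z : ι → (Cochains R (n + 3)).obj (op X)}
    {α : ι → (zariskiCohomology V n).obj (op X)}
    (h : ∀ i, Represents R (z i) (α i)) : Represents R (∑ i ∈ s, z i) (∑ i ∈ s, α i) := by
  classical
  induction s using Finset.induction_on with
  | empty => rw [Finset.sum_empty, Finset.sum_empty, represents_zero_iff]; exact ⟨0, map_zero _⟩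
  | insert i s hi ih => rw [Finset.sum_insert hi, Finset.sum_insert hi]; exact (h i).add ih

lemma onSections_nsmul {F G : (NoethSch k)ᵒᵖ ⥤ AddCommGrpCat.{u + 1}} {Y Z Z' : NoethSch k}
    {f : Z ⟶ Y} {f' : Z' ⟶ Y} (θ : directImage F f ⟶ directImage G f') (e : ℕ)
    (s : F.obj (op Z)) : onSections (e • θ) s = e • onSections θ s := by
  induction e with
  | zero => rw [zero_nsmul, zero_nsmul, onSections_zero]
  | succ e ih => rw [succ_nsmul, succ_nsmul, onSections_add, ih]

lemma onSections_sum {F G : (NoethSch k)ᵒᵖ ⥤ AddCommGrpCat.{u + 1}} {Y Z Z' : NoethSch k}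
    {f : Z ⟶ Y} {f' : Z' ⟶ Y} {ι : Type*} (t : Finset ι)
    (θ : ι → (directImage F f ⟶ directImage G f'))
    (s : F.obj (op Z)) : onSections (∑ i ∈ t, θ i) s = ∑ i ∈ t, onSections (θ i) s := by
  classical
  induction t using Finset.induction_on with
  | empty => rw [Finset.sum_empty, Finset.sum_empty, onSections_zero]
  | insert i t hi ih => rw [Finset.sum_insert hi, Finset.sum_insert hi, onSections_add, ih]

/-- Lifts are closed under sums and multiples, so the combination of the individual lifts is a lift
of `transferMap` and computes the left-hand side. -/
lemma rst_cohomologyTransfer_eq_sum {X Y Z : NoethSch k} {π : X ⟶ Y} (hπ : Admissible π)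
    (f : Z ⟶ Y) {ι : Type*} [Fintype ι] (e : ι → ℕ) {X' : ι → NoethSch k} {π' : ∀ i, X' i ⟶ Z}
    (hπ' : ∀ i, Admissible (π' i)) (f' : ∀ i, X' i ⟶ X) (w : ∀ i, f' i ≫ π = π' i ≫ f)
    (h : transferMap T hπ f = ∑ i, e i • pullTransfer T (hπ' i) (f' i) f (w i))
    (α : (zariskiCohomology V n).obj (op X)) :
    rst (zariskiCohomology V n) f (cohomologyTransfer hV semilocal T n hπ α) =
      ∑ i, e i • cohomologyTransfer hV semilocal T n (hπ' i)
        (rst (zariskiCohomology V n) (f' i) α) := by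
  obtain ⟨z, hz⟩ := exists_represents (resolution V) α
  choose θ hl hθ using fun i =>
    exists_isLift_pullTransfer hV semilocal T (hπ' i) (f' i) f (w i) n
  have hs : IsLift (R := resolution V) (transferMap T hπ f) (n + 1) (∑ i, e i • θ i) :=
    h ▸ IsLift.sum Finset.univ fun i => (hl i).nsmul (e i)
  refine rst_cohomologyTransfer_eq hV semilocal T hπ f hs hz ?_
  refine (Represents.sum Finset.univ fun i => (hθ i α z hz).nsmul (e i)).of_eq ?_
  refine (onSections_sum _ _ _).trans (Finset.sum_congr rfl fun i _ => ?_)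
  exact onSections_nsmul _ _ _

/-- The transfer structure on Zariski cohomology. -/
def cohomologyTransferStructure : TransferStructure (zariskiCohomology V n) where
  tr _ hπ := AddCommGrpCat.ofHom (cohomologyTransfer hV semilocal T n hπ)
  tr_id X h := by
    ext α
    exact cohomologyTransfer_id hV semilocal T n X h α
  tr_comp _ _ hπ hρ hπρ := by
    ext α
    exact cohomologyTransfer_comp hV semilocal T n hπ hρ hπρ α
  base_change _ _ _ _ H hπ hπ' := by
    ext α
    exact rst_cohomologyTransfer hV semilocal T n H hπ hπ' α
  ramification L _ _ C D X π d s hd hs hd₁ hπd hs₁ hfin hflat y U UC Uy j hj hU πU q hq φy qy hqy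
      Ux φx qx hqx πx w hπ hπx := by
    have : Finite {x : C.sch // mor π x = y} := (mor π).finite_preimage_singleton y
    have := Fintype.ofFinite {x : C.sch // mor π x = y}
    rw [finsum_eq_sum_of_fintype]
    have h := rst_cohomologyTransfer_eq_sum hV semilocal T n hπ φy _ hπx φx (fun x => (w x).symm)
      (transferMap_eq_sum T L π d s hd hs hd₁ hπd hs₁ hfin hflat y j hj hU πU q hq φy qy hqy
        Ux φx qx hqx πx w hπ hπx)
    refine AddCommGrpCat.hom_ext (AddMonoidHom.ext fun α => ?_)
    refine Eq.trans (h α) (Eq.symm ?_)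
    exact hom_sum_nsmul_apply _ _ _ α

end Transfers

end

end SuffRigid

/-! ### Sufficient rigidity of cohomology -/

theorem theorem4p1 {k : Type u} [Field k]
    (V : (SuffRigid.NoethSch k)ᵒᵖ ⥤ AddCommGrpCat.{u + 1})
    (hV : SuffRigid.IsSufficientlyRigid V)
    (semilocal : ∀ (A : Type u) [CommRing A] [Algebra k A] [IsNoetherianRing A],
      SuffRigid.IsLocalizationOfSmooth k A → Finite (MaximalSpectrum A) →
        IsIso ((SuffRigid.toAssocSheaf V).app (op (SuffRigid.specObj k A))) ∧
        ∀ i : ℕ, 0 < i →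
          IsZero ((SuffRigid.zariskiCohomology V i).obj (op (SuffRigid.specObj k A))))
    (homotopy : ∀ (A : Type u) [CommRing A] [Algebra k A] [IsNoetherianRing A],
      SuffRigid.IsLocalizationOfSmooth k A → IsLocalRing A →
        IsIso ((SuffRigid.assocSheaf V).obj.map
          (SuffRigid.specMap (Polynomial.CAlgHom (R := k) (A := A))).op) ∧
        ∀ i : ℕ, 0 < i →
          IsZero ((SuffRigid.zariskiCohomology V i).obj
            (op (SuffRigid.specObj k (Polynomial A)))))
    (ν : ℕ) :
    SuffRigid.IsSufficientlyRigid (SuffRigid.zariskiCohomology V ν) where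
  transfers := hV.transfers.map fun T =>
    SuffRigid.cohomologyTransferStructure hV semilocal T ν
  homotopy _ hX := SuffRigid.isIso_zariskiCohomology_map_affineLineProj hV homotopy hX ν
  continuity _ _ _ _ _ hF hc := SuffRigid.isColimit_zariskiCohomology hF hc.some hV ν
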